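/- Let $\Bbbk$ be a commutative ring. For a simplicial set $X$ let $C(X)$ be the normalized chain complex with coefficients in $\Bbbk$ (a coalgebra via $\Delta x=\sum_l x(0\dots l)\otimes x(l\dots m)$ for $x\in X_m$) and $C^*(X)=C(X)^\vee$ the normalized cochain algebra. The Koszul sign rule is used throughout; the transpose of a map $f$ is $f^*(\beta)=(-1)^{|f||\beta|}\beta f$, and $\stackrel{K}{=}$ means equality up to the sign incurred by permuting variables and by moving maps past variables. **The Gugenheim–Munkholm structure.** For simplicial sets $X,Y$ let $AW\colon C(X\times Y)\to C(X)\otimes C(Y)$ be the Alexander–Whitney map and let $h$ be the opposite Eilenberg–Mac Lane homotopy on $C(X\times Y)$: for $(x,y)\in X_m\times Y_m$, $$h(x,y)=\sum_{0\le p+q<m}\ \sum_{(\alpha,\beta)\vdash(p,q+1)}(-1)^{p+q+(\alpha,\beta)}\bigl(s_\beta\,\partial_{p+1}\cdots\partial_{p+q}x,\ s_{p+q+1}s_\alpha\,\partial_0\cdots\partial_{p-1}y\bigr),$$ where $(\alpha,\beta)$ runs over the partitions of $\{0,\dots,p+q\}$ with $|\alpha|=p$, $|\beta|=q+1$, and $(-1)^{(\alpha,\beta)}$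 is the signature of the shuffle. The components $G_n=(G_{X,Y})_n\colon C(X\times Y)\to(C(X)\otimes C(Y))^{\otimes n}$, $n\ge1$, of Gugenheim–Munkholm are given by $G_1=AW$ and $$G_n=-\sum_{l=1}^{n-1}(-1)^{n-l}(G_l\otimes G_{n-l})\,\Delta\,h\qquad(n\ge2).$$ The shc structure $\Phi^{\mathrm{GM}}\colon C^*(X)\otimes C^*(X)\Rightarrow C^*(X)$ is the composition $$C^*(X)\otimes C^*(X)\to(C(X)\otimes C(X))^\vee\xRightarrow{\,G_{X,X}^*\,}C^*(X\times X)\to C^*(X)$$ of the canonical map, the $A_\infty$-map with components $(G_n)^*$, and the map induced by the diagonal $X\to X\times X$. **The hga structure.** For a sequence $u=(u(1),\dots,u(N))$ with set of values $\{1,\dots,r\}$ and without equal neighbours, the interval cut operation $AW_u\colon C(X)\to C(X)^{\otimes r}$ sends $x\in X_m$ to $\sum\pm x_1\otimes\dots\otimes x_r$. The sum is over all $0=m_0\le m_1\le\dots\le m_N=m$, and $x_i$ is the restriction of $x$ to the concatenation of the intervals $[m_{t-1},m_t]$ with $u(t)=i$ (common endpoints are repeated). The interval $[m_{t-1},m_t]$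 is called final if the value $u(t)$ does not occur in $u$ after position $t$, and inner otherwise; it is given the length $m_t-m_{t-1}$ if final and $m_t-m_{t-1}+1$ if inner. The sign is $(-1)^{e+e'}$, where $e$ is the sum of the products of the lengths of all pairs of intervals at positions $s<t$ with $u(s)>u(t)$, and $e'$ is the sum of the right endpoints of the inner intervals. Set $E^k=AW_{(1,2,1,3,1,\dots,1,k+1,1)}$, and let $E_k=(E^k)^*\colon C^*(X)\otimes C^*(X)^{\otimes k}\to C^*(X)$ be the homotopy Gerstenhaber operations (so $E_0=1$). The associated shc structure $\Phi^{\mathrm{hga}}$ has components $$\Phi^{\mathrm{hga}}_n=(-1)^{n-1}\sum_{\mathbf j}\Phi_{\mathbf j},$$ $$\Phi_{\mathbf j}(a_1\otimes b_1,\dots,a_n\otimes b_n)\stackrel{K}{=}E_{j_1}(a_1;b_1,\dots,b_{j_1})\,E_{j_2}(a_2;b_{j_1+1},\dots,b_{j_1+j_2})\cdots E_{j_n}(a_n;b_{n-j_n},\dots,b_{n-1})\,b_n,$$ where $\mathbf j=(j_1,\dots,j_n)$ runs over the tuples of non-negative integers with $j_1+\dots+j_n=n-1$ and $j_1+\dots+j_s<s$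 for $1\le s\le n$. On chains, set $\Psi^{\mathrm{hgc}}_n=(-1)^{n-1}\sum_{\mathbf j}AW_{u(\mathbf j)}\colon C(X)\to C(X)^{\otimes 2n}=(C(X)\otimes C(X))^{\otimes n}$, where, with $v_t=2t-1$ and $w_t=2t$, $$u(\mathbf j)=(v_1,w_1,v_1,\dots,v_1,w_{j_1},v_1,\;v_2,w_{j_1+1},v_2,\dots,v_2,w_{j_1+j_2},v_2,\;\dots,\;v_n,w_{n-j_n},v_n,\dots,v_n,w_{n-1},v_n,\;w_n).$$ **Theorem.** For every simplicial set $X$ the two shc structures on $C^*(X)$ agree: $\Phi^{\mathrm{GM}}=\Phi^{\mathrm{hga}}$, that is, for all $n\ge1$ and all homogeneous cochains $a_1,b_1,\dots,a_n,b_n\in C^*(X)$, $$\Phi^{\mathrm{GM}}_n(a_1\otimes b_1,\dots,a_n\otimes b_n)=\Phi^{\mathrm{hga}}_n(a_1\otimes b_1,\dots,a_n\otimes b_n).$$ Moreover, for all simplicial sets $X,Y$ one has $G_{X,Y}=(p_X\otimes p_Y)\circ\Psi^{\mathrm{hgc}}_{X\times Y}$, that is, for all $n\ge1$, $$(G_{X,Y})_n=(p_X\otimes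 p_Y)^{\otimes n}\,\Psi^{\mathrm{hgc}}_n\colon C(X\times Y)\to(C(X)\otimes C(Y))^{\otimes n},$$ where $p_X,p_Y$ are induced by the projections of $X\times Y$. -/

import Mathlib

open CategoryTheory Simplicial Module
open scoped TensorProduct

universe u v

noncomputable section

namespace ShcCochains

/-! ### Simplicial operators given by vertex sequences -/

/-- The map of ordinals `[d] → [m]` with vertex sequence `v 0 ≤ v 1 ≤ … ≤ v d ≤ m`.
(To have a total function, a sequence that does not satisfy these inequalities is replaced by
its running maximum, capped at `m`. Only sequences satisfying them are used below.) -/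
def vertexMap (d m : ℕ) (v : ℕ → ℕ) : ⦋d⦌ ⟶ ⦋m⦌ :=
  SimplexCategory.mkHom
    { toFun := fun i =>
        ⟨min m ((Finset.range (i.val + 1)).sup v), Nat.lt_succ_of_le (min_le_left _ _)⟩
      monotone' := by
        intro i i' h
        have h' : i.val ≤ i'.val := h
        exact Fin.mk_le_mk.mpr (min_le_min le_rfl
          (Finset.sup_mono (Finset.range_subset_range.mpr (by omega)))) }

section Simplices

variable {X : SSet.{u}} {m : ℕ}

/-- The `d`-simplex `x(v 0, …, v d)` obtained from the `m`-simplex `x` by selecting (possibly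
repeated) vertices. -/
def pull (x : X _⦋m⦌) (d : ℕ) (v : ℕ → ℕ) : X _⦋d⦌ := X.map (vertexMap d m v).op x

/-- The front face `x(0…l)`. -/
def frontFace (x : X _⦋m⦌) (l : ℕ) : X _⦋l⦌ := pull x l fun i => i

/-- The back face `x(l…m)`. -/
def backFace (x : X _⦋m⦌) (l : ℕ) : X _⦋m - l⦌ := pull x (m - l) fun i => l + i

/-- The iterated face operator `∂_i ∘ ∂_{i+1} ∘ ⋯ ∘ ∂_{i+c-1}`, which leaves out the `c` vertices
`i, …, i+c-1`. -/
def iterFace (x : X _⦋m⦌) (i c : ℕ) : X _⦋m - c⦌ :=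
  pull x (m - c) fun w => if w < i then w else w + c

/-- The iterated degeneracy operator `s_S = s_{a_r} ∘ ⋯ ∘ s_{a_1}` for `S = {a_1 < ⋯ < a_r}`,
where `d = m + r` is the dimension of the result: the vertex `v` of `s_S x` is the vertex
`v - #{a ∈ S | a < v}` of `x`. -/
def iterDegen (d : ℕ) (S : Finset ℕ) (x : X _⦋m⦌) : X _⦋d⦌ :=
  pull x d fun w => w - (S.filter (· < w)).card

end Simplices

/-! ### Normalized chains -/

/-- The graded module of normalized chains `C(X)`: the free module on the non-degenerate simplices
of `X`, graded by dimension; degenerate simplices represent zero (see `cls`). -/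
abbrev Chains (k : Type v) [CommRing k] (X : SSet.{u}) : Type (max u v) :=
  (Σ m : ℕ, X.nonDegenerate m) →₀ k

variable (k : Type v) [CommRing k]

open Classical in
/-- The class of a simplex in the normalized chains. -/
def cls {X : SSet.{u}} {m : ℕ} (x : X _⦋m⦌) : Chains k X :=
  if h : x ∈ X.nonDegenerate m then Finsupp.single ⟨m, ⟨x, h⟩⟩ 1 else 0

/-- The linear map on `C(X)` with prescribed values on non-degenerate simplices. -/
def chainLift {X : SSet.{u}} {N : Type*} [AddCommMonoid N] [Module k N]
    (F : ∀ m : ℕ, X _⦋m⦌ → N) : Chains k X →ₗ[k] N :=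
  Finsupp.linearCombination k fun s : (Σ m : ℕ, X.nonDegenerate m) => F s.1 s.2.1

/-- The sign operator `c ↦ (-1)^{|c|} c` on `C(X)`. -/
def signOp (X : SSet.{u}) : Module.End k (Chains k X) :=
  chainLift k fun m x => (-1 : k) ^ m • cls k x

/-- The chain map induced by a map of simplicial sets. -/
def chainMap {X Y : SSet.{u}} (f : X ⟶ Y) : Chains k X →ₗ[k] Chains k Y :=
  chainLift k fun _ x => cls k (f.app _ x)

/-- The diagonal of the coalgebra `C(X)`: `Δ x = ∑_l x(0…l) ⊗ x(l…m)`. -/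
def diag (X : SSet.{u}) : Chains k X →ₗ[k] Chains k X ⊗[k] Chains k X :=
  chainLift k fun m x => ∑ l ∈ Finset.range (m + 1), cls k (frontFace x l) ⊗ₜ[k] cls k (backFace x l)

/-! ### The Eilenberg–Zilber data -/

/-- The product of two simplicial sets. -/
abbrev sprod (X Y : SSet.{u}) : SSet.{u} := MonoidalCategoryStruct.tensorObj X Y

/-- The projection `p_X : X × Y → X`. -/
abbrev prX (X Y : SSet.{u}) : sprod X Y ⟶ X := SemiCartesianMonoidalCategory.fst X Y

/-- The projection `p_Y : X × Y → Y`. -/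
abbrev prY (X Y : SSet.{u}) : sprod X Y ⟶ Y := SemiCartesianMonoidalCategory.snd X Y

/-- The diagonal map `X → X × X`. -/
abbrev diagMap (X : SSet.{u}) : X ⟶ sprod X X := CartesianMonoidalCategory.lift (𝟙 X) (𝟙 X)

/-- The Alexander–Whitney map `AW(x, y) = ∑_l x(0…l) ⊗ y(l…m)`. -/
def alexanderWhitney (X Y : SSet.{u}) :
    Chains k (sprod X Y) →ₗ[k] Chains k X ⊗[k] Chains k Y :=
  chainLift k fun m z => ∑ l ∈ Finset.range (m + 1),
    cls k (frontFace ((prX X Y).app _ z) l) ⊗ₜ[k] cls k (backFace ((prY X Y).app _ z) l)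

/-- The exponent of the signature of a shuffle `(α, β)`: the number of inversions. -/
def shuffleInv (α β : Finset ℕ) : ℕ := ((α ×ˢ β).filter fun ab => ab.2 < ab.1).card

/-- The opposite Eilenberg–Mac Lane homotopy: for `(x, y) ∈ X_m × Y_m`,
`h(x,y) = ∑ (-1)^{p+q+(α,β)} (s_β ∂_{p+1}^{p+q} x, s_{p+q+1} s_α ∂_0^{p-1} y)`, summed over
`0 ≤ p + q < m` and the partitions `(α, β)` of `{0, …, p+q}` with `#α = p`, `#β = q + 1`. -/
def emHomotopy (X Y : SSet.{u}) : Chains k (sprod X Y) →ₗ[k] Chains k (sprod X Y) :=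
  chainLift k fun m z =>
    ∑ p ∈ Finset.range m, ∑ q ∈ Finset.range (m - p),
      ∑ α ∈ (Finset.range (p + q + 1)).powersetCard p,
        (-1 : k) ^ (p + q + shuffleInv α (Finset.range (p + q + 1) \ α)) •
          cls k (X := sprod X Y) (m := m + 1)
            (iterDegen (m + 1) (Finset.range (p + q + 1) \ α)
                (iterFace ((prX X Y).app _ z) (p + 1) q),
              iterDegen (m + 1) (insert (p + q + 1) α)
                (iterFace ((prY X Y).app _ z) 0 p))

/-- The components `G_n : C(X × Y) → (C(X) ⊗ C(Y))^{⊗n}`, `n ≥ 1`, given by the Gugenheim–Munkholm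
recursion `G_1 = AW` and `G_n = -∑_{l=1}^{n-1} (-1)^{n-l} (G_l ⊗ G_{n-l}) Δ h`. In the code the
recursive clause defines `G_{n+2}`, with `l = i + 1`. Since `G_{n-l}` has degree `n-l-1`, the
Koszul rule gives `(G_l ⊗ G_{n-l})(c ⊗ c') = (-1)^{(n-l-1)|c|} G_l(c) ⊗ G_{n-l}(c')`. -/
def gm (X Y : SSet.{u}) (n : ℕ) :
    Chains k (sprod X Y) →ₗ[k] ⨂[k]^n (Chains k X ⊗[k] Chains k Y) :=
  match n with
  | 0 => 0
  | 1 => (PiTensorProduct.subsingletonEquiv (0 : Fin 1)).symm.toLinearMap ∘ₗ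
      (alexanderWhitney k X Y)
  | n + 2 => (-1 : k) • ∑ i : Fin (n + 1), (-1 : k) ^ (n + 1 - i.val) •
      ((TensorPower.cast k (Chains k X ⊗[k] Chains k Y)
          (show (i.val + 1) + (n + 1 - i.val) = n + 2 by omega)).toLinearMap ∘ₗ
        TensorPower.mulEquiv.toLinearMap ∘ₗ
        TensorProduct.map (gm X Y (i.val + 1) ∘ₗ (signOp k (sprod X Y) ^ (n - i.val)))
          (gm X Y (n + 1 - i.val)) ∘ₗ
        diag k (sprod X Y) ∘ₗ emHomotopy k X Y)
termination_by n
decreasing_by all_goals omega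

/-! ### Interval cut operations -/

/-- The subdivisions `0 = c_0 ≤ c_1 ≤ ⋯ ≤ c_N = m` of `[0, m]` into `N` intervals. -/
def cuts (N m : ℕ) : Finset (Fin (N + 1) → Fin (m + 1)) :=
  open Classical in
  Finset.univ.filter fun c => Monotone c ∧ c 0 = 0 ∧ c (Fin.last N) = Fin.last m

section Cuts

variable (u : List ℕ) {m : ℕ} (c : Fin (u.length + 1) → Fin (m + 1))

/-- The `t`-th interval is inner if its label occurs again later on (otherwise it is final). -/
def IsInner (t : Fin u.length) : Prop := ∃ t' : Fin u.length, t < t' ∧ u.get t' = u.get t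

open Classical in
/-- The length of the `t`-th interval `[c_t, c_{t+1}]` as used in the permutation sign:
`c_{t+1} - c_t` for final and `c_{t+1} - c_t + 1` for inner intervals. -/
def cutLength (t : Fin u.length) : ℕ :=
  (c t.succ).val - (c t.castSucc).val + if IsInner u t then 1 else 0

/-- The exponent of the permutation sign: the intervals, weighted by their lengths, are sorted
(stably) by their labels. -/
def permExp : ℕ :=
  ∑ s : Fin u.length, ∑ t : Fin u.length,
    if s < t ∧ u.get t < u.get s then cutLength u c s * cutLength u c t else 0

open Classical in
/-- The exponent of the position sign: the sum of the right endpoints of the inner intervals. -/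
def posExp : ℕ := ∑ t : Fin u.length, if IsInner u t then (c t.succ).val else 0

/-- The concatenation of all intervals `[c_t, c_{t+1}]` with label `j`. -/
def labelVertices (j : ℕ) : List ℕ :=
  (List.finRange u.length).flatMap fun t =>
    if u.get t = j then
      List.range' (c t.castSucc).val ((c t.succ).val - (c t.castSucc).val + 1)
    else []

/-- The restriction `x_j` of `x` to the concatenation of all intervals with label `j`. -/
def piece {X : SSet.{u}} (x : X _⦋m⦌) (j : ℕ) : Chains k X :=
  cls k (pull x ((labelVertices u c j).length - 1) fun i => (labelVertices u c j).getD i 0)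

end Cuts

/-- The interval cut operation of the surjection `u` (with labels `1, …, r`), that is
`x ↦ ∑ ± x_1 ⊗ ⋯ ⊗ x_r`. The tensor product of the pieces is formed by the multilinear
expression `T`, so that the bracketing of the target can be chosen. -/
def intervalCut {X : SSet.{u}} {N : Type*} [AddCommMonoid N] [Module k N] (u : List ℕ)
    (T : (ℕ → Chains k X) → N) : Chains k X →ₗ[k] N :=
  chainLift k fun m x => ∑ c ∈ cuts u.length m,
    (-1 : k) ^ (permExp u c + posExp u c) • T (piece k u c x)

/-- The surjection `(1,2,1,3,1,…,1,r+1,1)`. -/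
def surjE (r : ℕ) : List ℕ := 1 :: (List.range r).flatMap fun i => [i + 2, 1]

/-- The homotopy Gerstenhaber cooperation `E^r : C(X) → C(X)^{⊗(r+1)}`. -/
def hgcE (X : SSet.{u}) (r : ℕ) : Chains k X →ₗ[k] ⨂[k]^(r + 1) (Chains k X) :=
  intervalCut k (surjE r) fun y => PiTensorProduct.tprod k fun i : Fin (r + 1) => y (i.val + 1)

/-- `j_1 + ⋯ + j_{t-1}` (the sum of all entries before the position `t`). -/
def partialSum {n : ℕ} (j : Fin n → ℕ) (t : Fin n) : ℕ := ∑ s ∈ Finset.Iio t, j s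

/-- The decompositions `j_1 + ⋯ + j_n = n - 1` such that `j_1 + ⋯ + j_s < s` for `1 ≤ s ≤ n`. -/
def decomps (n : ℕ) : Finset (Fin n → ℕ) :=
  (Finset.Nat.antidiagonalTuple n (n - 1)).filter
    fun j => ∀ s : Fin n, ∑ i ∈ Finset.Iic s, j i < s.val + 1

/-- The surjection `u(j)`: the concatenation of the blocks
`v_t, w_{r+1}, v_t, …, v_t, w_{r+j_t}, v_t` with `r = j_1 + ⋯ + j_{t-1}`, for `1 ≤ t ≤ n`, followed
by `w_n`. Here `v_t = 2t-1` and `w_t = 2t`; in the code `t` is counted from `0`. -/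
def surjJ {n : ℕ} (j : Fin n → ℕ) : List ℕ :=
  ((List.finRange n).flatMap fun t =>
    (2 * t.val + 1) ::
      (List.range (j t)).flatMap fun i => [2 * (partialSum j t + i + 1), 2 * t.val + 1]) ++ [2 * n]

/-- The components `Ψ^{hgc}_n : C(X) → (C(X) ⊗ C(X))^{⊗n}`, that is `(-1)^{n-1}` times the sum over
all `j` of the interval cut operations `Ψ_j` for `u(j)`. -/
def psiHgc (X : SSet.{u}) (n : ℕ) :
    Chains k X →ₗ[k] ⨂[k]^n (Chains k X ⊗[k] Chains k X) :=
  (-1 : k) ^ (n - 1) • ∑ j ∈ decomps n, intervalCut k (surjJ j) fun y =>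
    PiTensorProduct.tprod k fun t : Fin n => y (2 * t.val + 1) ⊗ₜ[k] y (2 * t.val + 2)

/-! ### Cochains -/

/-- The sign `(-1)^e`. -/
def sgn (e : ℤ) : k := ((e.negOnePow : ℤ) : k)

/-- A functional on `C(X)` together with an integer, its degree; it is an element of `C^{deg}(X)` if
it is homogeneous in the sense of `GradedCochain.IsHomogeneous`. -/
structure GradedCochain (X : SSet.{u}) where
  /-- the degree -/
  deg : ℤ
  /-- the underlying functional -/
  val : Dual k (Chains k X)

variable {k}

/-- The functional vanishes on all simplices of dimension different from the degree. -/
def GradedCochain.IsHomogeneous {X : SSet.{u}} (a : GradedCochain k X) : Prop :=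
  ∀ (m : ℕ) (x : X _⦋m⦌), (m : ℤ) ≠ a.deg → a.val (cls k x) = 0

/-- The canonical map `M^∨ ⊗ N^∨ → (M ⊗ N)^∨` on functionals of degrees `p` and `q`, with the
Koszul sign: `(a ⊗ b)(c ⊗ c') = (-1)^{|b||c|} a(c) b(c')`, where `|c| = |a|` up to sign. -/
def dualTensorTwo {M N : Type*} [AddCommMonoid M] [Module k M] [AddCommMonoid N] [Module k N]
    (p q : ℤ) (a : Dual k M) (b : Dual k N) : Dual k (M ⊗[k] N) :=
  sgn k (p * q) • TensorProduct.dualDistrib k M N (a ⊗ₜ[k] b)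

/-- The canonical map `(M^∨)^{⊗n} → (M^{⊗n})^∨` on functionals of degrees `p_1, …, p_n`, with the
Koszul sign `(-1)^e`, `e = ∑_{s<t} p_s p_t`. -/
def dualTensor {M : Type*} [AddCommMonoid M] [Module k M] {n : ℕ}
    (p : Fin n → ℤ) (a : Fin n → Dual k M) : Dual k (⨂[k]^n M) :=
  sgn k (∑ s : Fin n, ∑ t ∈ Finset.Ioi s, p s * p t) •
    PiTensorProduct.dualDistrib (PiTensorProduct.tprod k a)

/-- The transpose `f^*(β) = (-1)^{|f||β|} β f` of a map `f` of degree `r`, where `|β| = p`. -/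
def transpose {M N : Type*} [AddCommMonoid M] [Module k M] [AddCommMonoid N] [Module k N]
    (r p : ℤ) (f : M →ₗ[k] N) (β : Dual k N) : Dual k M := sgn k (r * p) • (β ∘ₗ f)

/-- The (cup) product on `C^*(X) = C(X)^∨`. -/
def cup {X : SSet.{u}} (a b : GradedCochain k X) : GradedCochain k X where
  deg := a.deg + b.deg
  val := transpose 0 (a.deg + b.deg) (diag k X) (dualTensorTwo a.deg b.deg a.val b.val)

/-- The operation `E_r(a; b_1, …, b_r)` on `C^*(X)`, the transpose of `E^r`. -/
def hgaE {X : SSet.{u}} {r : ℕ} (a : GradedCochain k X) (b : Fin r → GradedCochain k X) :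
    GradedCochain k X :=
  let c : Fin (r + 1) → GradedCochain k X := Fin.cons a b
  { deg := (∑ i, (c i).deg) - r
    val := transpose r (∑ i, (c i).deg) (hgcE k X r)
      (dualTensor (fun i => (c i).deg) fun i => (c i).val) }

section Phi

variable {X : SSet.{u}} (a b : ℕ → GradedCochain k X)

/-- The exponent of the Koszul sign that is incurred by bringing
`E_{j_1}, …, E_{j_n}, a_1, b_1, …, a_n, b_n` into the order of the formula for `Φ_j` below:
`b_i` is moved past `a_t` if `i < t` and `b_i` appears to the right of `a_t`, and the map
`E_{j_t}`, of degree `-j_t`, is moved past all variables appearing to the left of it.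
(Indices are counted from `0` here.) -/
def koszulExp {n : ℕ} (j : Fin n → ℕ) : ℤ :=
  ∑ t : Fin n, ((∑ i ∈ Finset.Ico (partialSum j t) t.val, (b i).deg * (a t.val).deg) +
    j t * ((∑ i ∈ Finset.range t.val, (a i).deg) +
      ∑ i ∈ Finset.range (partialSum j t), (b i).deg))

/-- `Φ_j(a_1 ⊗ b_1, …, a_n ⊗ b_n)`, that is, up to the Koszul sign,
`E_{j_1}(a_1; b_1, …, b_{j_1}) E_{j_2}(a_2; b_{j_1+1}, …) ⋯ E_{j_n}(a_n; …, b_{n-1}) b_n`. The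
variables are `a 0, …, a (n-1)` and `b 0, …, b (n-1)`. -/
def phiJ {n : ℕ} (j : Fin n → ℕ) : Dual k (Chains k X) :=
  sgn k (koszulExp a b j) •
    ((List.finRange n).foldr
      (fun t r => cup (hgaE (a t.val) fun i : Fin (j t) => b (partialSum j t + i.val)) r)
      (b (n - 1))).val

/-- The component `Φ^{hga}_n(a_1 ⊗ b_1, …, a_n ⊗ b_n)` of the shc structure coming from the hga
structure of `C^*(X)`. -/
def phiHga (n : ℕ) : Dual k (Chains k X) :=
  (-1 : k) ^ (n - 1) • ∑ j ∈ decomps n, phiJ a b j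

/-- The component `Φ^{GM}_n(a_1 ⊗ b_1, …, a_n ⊗ b_n)` of the Gugenheim–Munkholm shc structure,
that is, of the composition
`C^*(X) ⊗ C^*(X) → (C(X) ⊗ C(X))^∨ ⇒ C^*(X × X) → C^*(X)` of the canonical map, the transpose of
`G` and the transpose of the diagonal `X → X × X`. -/
def phiGM (n : ℕ) : Dual k (Chains k X) :=
  let p : Fin n → ℤ := fun i => (a i.val).deg + (b i.val).deg
  let β : Fin n → Dual k (Chains k X ⊗[k] Chains k X) := fun i =>
    dualTensorTwo (a i.val).deg (b i.val).deg (a i.val).val (b i.val).val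
  transpose ((n : ℤ) - 1) (∑ i, p i) (gm k X X n) (dualTensor p β) ∘ₗ chainMap k (diagMap X)

end Phi

end ShcCochains

end

open ShcCochains

open CategoryTheory Simplicial Module
open scoped TensorProduct

noncomputable section

namespace ShcCochains

/-! ### Simplicial operators given by vertex sequences -/

section Vertices

/-! Both sides are expanded into sums over subdivisions of `[0, m]` into labelled intervals. Almost
all terms of the Gugenheim–Munkholm recursion vanish because some tensor factor is degenerate, and
the surviving ones follow the recursion satisfied by the interval cuts.

The chain-level identity goes by induction on `n`. A summand of `h(x, y)` is a lattice path from
`(0, p)`: `p` steps in `x` and `q + 1` steps in `y`, ordered by the shuffle, then one step on which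
`x` jumps from `p` to `p + q + 1` while `y` rests, and from there on both coordinates run together.
By induction the lower `G_l` are interval cuts. In a nonzero term no piece repeats a vertex: `x`
moves on every step inside an interval with odd label, `y` on every step inside one with even label.
Except for the last letter, an even letter stands between two copies of one odd letter, so `x` must
also change across an even interval. Since a shuffle step moves only one coordinate, such an
interval cannot end within the shuffle part (`lt_hi_of_even`). Hence `G_l` with `l ≥ 2` vanishes on
all front faces of the path (`psiSum_shuffle_eq_zero`), and only `l = 1` is left. There the shuffle
must consist of `a` steps in `x`, `q + 1` steps in `y` and `p - a` steps in `x`, and the path is cut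
after the second run (`corner_of_ne_zero`, `sum_shuffles`). Thus `G_n(x, y)` is the signed sum of
`x(0…a) ⊗ y(p…p+q+1) ⊗ G_{n-1}`, with `G_{n-1}` evaluated on the rest of the path, given by `pathX`
and `pathY`.

The interval cuts obey the same recursion (`psiSum_succ`). Each admissible tuple arises uniquely
from one that is shorter by one, by prepending a zero and raising by one an entry that has only
zeros before it (`sum_admLists_succ`). On words, this puts the letter `1` in front and splits an odd
letter in two by a letter `2` (`fullWord_insertIdx`). Removing the intervals `[0, a]` and `[p, p + q
+ 1]` with labels `1` and `2` leaves a subdivision of the remaining path whose split interval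
contains the jump of `x`; conversely, in a nonzero term the jump always lies in an interval of this
kind (`sum_step_zerosAt`). The change of sign is computed in `sign_insertIv`.

For cochains, the chain-level identity and a block-by-block evaluation of the products of operations
`E_r` express both components as sums over the same subdivisions with the same values (`phiGM_cls`,
`phiHga_cls`). Only signs remain. In a nonzero term the lengths of the intervals with a given label
add up to the degree of the cochain evaluated there, so inversion counts become products of degrees.
Modulo 2, the relabelling inside the blocks and the inversions between blocks are compensated by the
Koszul sign (`even_foldExp`). -/

theorem vertexMap_val {d m : ℕ} {v : ℕ → ℕ} (hv : ∀ i j, i ≤ j → j ≤ d → v i ≤ v j)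
    (hb : ∀ i, i ≤ d → v i ≤ m) (i : Fin (d + 1)) :
    ((vertexMap d m v).toOrderHom i).val = v i := by
  have h : (Finset.range (i.val + 1)).sup v = v i := by
    apply le_antisymm
    · apply Finset.sup_le
      intro j hj
      exact hv _ _ (by simpa [Nat.lt_succ_iff] using hj) (by omega)
    · exact Finset.le_sup (f := v) (by simp)
  change min m ((Finset.range (i.val + 1)).sup v) = v i
  rw [h]
  exact min_eq_right (hb _ (by omega))

theorem vertexMap_congr {d m : ℕ} {v v' : ℕ → ℕ} (h : ∀ i, i ≤ d → v i = v' i) :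
    vertexMap d m v = vertexMap d m v' := by
  unfold vertexMap
  congr 1
  ext i : 2
  apply Fin.ext
  change min m ((Finset.range (i.val + 1)).sup v) = min m ((Finset.range (i.val + 1)).sup v')
  congr 1
  apply Finset.sup_congr rfl
  intro j hj
  have := i.2
  simp at hj
  exact h _ (by omega)

variable {X Y : SSet.{u}} {m : ℕ}

theorem pull_congr (x : X _⦋m⦌) {d : ℕ} {v v' : ℕ → ℕ} (h : ∀ i, i ≤ d → v i = v' i) :
    pull x d v = pull x d v' := by
  unfold pull
  rw [vertexMap_congr h]

theorem pull_pull (x : X _⦋m⦌) {d e : ℕ} {v w : ℕ → ℕ}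
    (hv : ∀ i j, i ≤ j → j ≤ d → v i ≤ v j) (hb : ∀ i, i ≤ d → v i ≤ m)
    (hw : ∀ i j, i ≤ j → j ≤ e → w i ≤ w j) (hwb : ∀ i, i ≤ e → w i ≤ d) :
    pull (pull x d v) e w = pull x e (fun i => v (w i)) := by
  unfold pull
  have : vertexMap e m (fun i => v (w i)) = vertexMap e d w ≫ vertexMap d m v := by
    ext i : 3
    apply Fin.ext
    rw [vertexMap_val (fun i j hij hj => hv _ _ (hw _ _ hij hj) (hwb _ hj))
      (fun i hi => hb _ (hwb _ hi))]
    have := vertexMap_val hv hb ((vertexMap e d w).toOrderHom i)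
    rw [vertexMap_val hw hwb] at this
    exact this.symm
  rw [this]
  simp

theorem pull_self (x : X _⦋m⦌) : pull x m (fun i => i) = x := by
  unfold pull
  have : vertexMap m m (fun i => i) = 𝟙 _ := by
    ext i : 3
    apply Fin.ext
    rw [vertexMap_val (fun i j h _ => h) (fun i h => h)]
    rfl
  rw [this]
  simp

theorem app_pull (f : X ⟶ Y) (x : X _⦋m⦌) (d : ℕ) (v : ℕ → ℕ) :
    f.app _ (pull x d v) = pull (f.app _ x) d v := by
  unfold pull
  exact congrFun (congrArg (fun g => g.hom) (f.naturality (vertexMap d m v).op)) x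

variable (k : Type v) [CommRing k]

/-- If the simplex were nondegenerate, `g` would be a monomorphism. This is the source of all
vanishing below. -/
theorem cls_map_eq_zero {d : ℕ} (x : X _⦋m⦌) (g : ⦋d⦌ ⟶ ⦋m⦌) {i j : Fin (d + 1)}
    (hij : i ≠ j) (h : g.toOrderHom i = g.toOrderHom j) : cls k (X.map g.op x) = 0 := by
  have : X.map g.op x ∉ X.nonDegenerate d := by
    intro hn
    have hm := SSet.mono_of_nonDegenerate X ⟨_, hn⟩ g x rfl
    rw [SimplexCategory.mono_iff_injective] at hm
    exact hij (hm h)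
  simp [cls, this]

end Vertices

/-! ### Simplices selected by vertex lists; linear maps on normalized chains -/

section VertexLists

variable (k : Type v) [CommRing k] {X Y : SSet.{u}} {m : ℕ}

/-- The class of the simplex of `x` with the given list of vertices. -/
def vcls (x : X _⦋m⦌) (l : List ℕ) : Chains k X :=
  cls k (pull x (l.length - 1) fun i => l.getD i 0)

theorem getD_mono {l : List ℕ} (hl : l.Pairwise (· ≤ ·)) (i j : ℕ) (hij : i ≤ j)
    (hj : j ≤ l.length - 1) : l.getD i 0 ≤ l.getD j 0 := by
  rcases Nat.eq_zero_or_pos l.length with h | h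
  · have : l = [] := List.length_eq_zero_iff.mp h
    simp [this]
  · rw [List.getD_eq_getElem _ _ (by omega), List.getD_eq_getElem _ _ (by omega)]
    rcases hij.eq_or_lt with rfl | hlt
    · rfl
    · exact List.pairwise_iff_getElem.mp hl _ _ _ _ hlt

theorem getD_le {l : List ℕ} {d : ℕ} (hb : ∀ a ∈ l, a ≤ d) (i : ℕ) : l.getD i 0 ≤ d := by
  rcases lt_or_ge i l.length with h | h
  · rw [List.getD_eq_getElem _ _ h]
    exact hb _ (List.getElem_mem h)
  · rw [List.getD_eq_default _ _ h]
    omega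

/-- The list must not be empty: by the default value, `vcls` then selects vertex `0`, which on the
left is the vertex `v 0` of `x`. -/
theorem vcls_pull (x : X _⦋m⦌) {d : ℕ} {v : ℕ → ℕ} (hv : ∀ i j, i ≤ j → j ≤ d → v i ≤ v j)
    (hb : ∀ i, i ≤ d → v i ≤ m) {l : List ℕ} (hl : l.Pairwise (· ≤ ·)) (hld : ∀ a ∈ l, a ≤ d)
    (hne : l ≠ []) : vcls k (pull x d v) l = vcls k x (l.map v) := by
  have hpos : 0 < l.length := List.length_pos_iff.mpr hne
  unfold vcls
  rw [pull_pull x hv hb (getD_mono hl) (fun i _ => getD_le hld i)]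
  have : (l.map v).length = l.length := by simp
  rw [this]
  congr 1
  apply pull_congr
  intro i hi
  rw [List.getD_eq_getElem _ _ (by omega), List.getD_eq_getElem _ _ (by simp; omega)]
  simp

/-- The two listed vertices need not be equal, only identified by `g`. With `g = 𝟙` this treats
repeated vertices, with `g` a degeneracy it treats lists in a degenerate simplex. -/
theorem vcls_congr_of_map_eq_zero {e : ℕ} (x : X _⦋m⦌) (g : ⦋e⦌ ⟶ ⦋m⦌) {l : List ℕ}
    (hl : l.Pairwise (· ≤ ·)) (hb : ∀ a ∈ l, a ≤ e) {i j : ℕ} (hi : i < j) (hj : j < l.length)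
    (h : ∀ p q : Fin (e + 1), p.val = l.getD i 0 → q.val = l.getD j 0 →
      g.toOrderHom p = g.toOrderHom q) :
    vcls k (X.map g.op x) l = 0 := by
  unfold vcls pull
  rw [← Functor.map_comp_apply, ← op_comp]
  apply cls_map_eq_zero k x _ (i := ⟨i, by omega⟩) (j := ⟨j, by omega⟩)
  · simp; omega
  · apply h
    · exact vertexMap_val (getD_mono hl) (fun i _ => getD_le hb i) ⟨i, by omega⟩
    · exact vertexMap_val (getD_mono hl) (fun i _ => getD_le hb i) ⟨j, by omega⟩

theorem vcls_eq_zero (x : X _⦋m⦌) {l : List ℕ} (hl : l.Pairwise (· ≤ ·)) (hb : ∀ a ∈ l, a ≤ m)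
    (hnd : ¬ l.Nodup) : vcls k x l = 0 := by
  rw [List.Nodup, List.pairwise_iff_getElem] at hnd
  push Not at hnd
  obtain ⟨i, j, hi, hj, hij, h⟩ := hnd
  have := vcls_congr_of_map_eq_zero k x (𝟙 _) hl hb hij hj (by
    intro p q hp hq
    rw [List.getD_eq_getElem _ _ hi] at hp
    rw [List.getD_eq_getElem _ _ hj] at hq
    have : p = q := Fin.ext (by omega)
    rw [this])
  simpa using this

variable {k} in
-- A degenerate simplex comes from a map to a smaller ordinal, which identifies two consecutive
-- vertices, for otherwise it would be strictly increasing. A piece that contains both of them is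
-- degenerate. This is what shows that formulas given on nondegenerate simplices hold for all
-- classes.
theorem cls_eq_zero_or {z : X _⦋m⦌} (hz : z ∉ X.nonDegenerate m) :
    ∃ i < m, ∀ l : List ℕ, l.Pairwise (· ≤ ·) → (∀ a ∈ l, a ≤ m) → i ∈ l → i + 1 ∈ l →
      vcls k z l = 0 := by
  rw [← SSet.mem_degenerate_iff_notMem_nonDegenerate] at hz
  obtain ⟨d, hd, f, w, rfl⟩ := hz
  have hmono : ∀ i j : Fin (m + 1), i ≤ j → f.toOrderHom i ≤ f.toOrderHom j :=
    fun i j h => f.toOrderHom.monotone h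
  have hex : ∃ i, ∃ h : i < m, ∀ a b : Fin (m + 1), a.val = i → b.val = i + 1 →
      f.toOrderHom a = f.toOrderHom b := by
    by_contra! hne
    have hlt : ∀ i : ℕ, ∀ a : Fin (m + 1), a.val = i → i ≤ (f.toOrderHom a).val := by
      intro i
      induction i with
      | zero => intro _ _; omega
      | succ i ih =>
        intro c hc
        obtain ⟨a, b, ha, hb, h2⟩ := hne i (by omega)
        have hbc : b = c := Fin.ext (by omega)
        subst hbc
        have h1 := ih a ha
        have h3 := hmono a b (Fin.le_def.mpr (by omega))
        have h4 := Fin.lt_def.mp (lt_of_le_of_ne h3 h2)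
        omega
    have := hlt m (Fin.last m) rfl
    have h5 := (f.toOrderHom (Fin.last m)).2
    simp only [SimplexCategory.len_mk] at h5
    omega
  obtain ⟨i, him, hi⟩ := hex
  refine ⟨i, him, fun l hl hb h1 h2 => ?_⟩
  obtain ⟨p, hp, hpi⟩ := List.getElem_of_mem h1
  obtain ⟨q, hq, hqi⟩ := List.getElem_of_mem h2
  have hpq : p < q := by
    by_contra! hle
    rcases hle.eq_or_lt with h | h
    · subst h; omega
    · have := List.pairwise_iff_getElem.mp hl _ _ hq hp h
      omega
  apply vcls_congr_of_map_eq_zero k w f hl hb hpq hq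
  intro a b ha hb'
  rw [List.getD_eq_getElem _ _ hp, hpi] at ha
  rw [List.getD_eq_getElem _ _ hq, hqi] at hb'
  exact hi a b ha hb'

theorem cls_of_notMem {z : X _⦋m⦌} (hz : z ∉ X.nonDegenerate m) : cls k z = 0 := by
  simp [cls, hz]

/-- `chainLift` only uses the values of `F` on nondegenerate simplices; its formula extends to the
others if `F` kills them. -/
theorem chainLift_cls {N : Type*} [AddCommMonoid N] [Module k N] (F : ∀ m : ℕ, X _⦋m⦌ → N)
    (z : X _⦋m⦌) (h : z ∉ X.nonDegenerate m → F m z = 0) : chainLift k F (cls k z) = F m z := by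
  by_cases hz : z ∈ X.nonDegenerate m
  · simp [cls, hz, chainLift]
  · rw [cls_of_notMem k hz, map_zero, h hz]

theorem chainMap_cls (f : X ⟶ Y) (z : X _⦋m⦌) : chainMap k f (cls k z) = cls k (f.app _ z) := by
  refine chainLift_cls k _ z fun hz => ?_
  apply cls_of_notMem
  intro h
  exact h (SSet.degenerate_app_apply
    ((SSet.mem_degenerate_iff_notMem_nonDegenerate _ _).mpr hz) f)

theorem chainMap_vcls (f : X ⟶ Y) (z : X _⦋m⦌) (l : List ℕ) :
    chainMap k f (vcls k z l) = vcls k (f.app _ z) l := by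
  unfold vcls
  rw [chainMap_cls, app_pull]

theorem signOp_cls (z : X _⦋m⦌) : signOp k X (cls k z) = (-1 : k) ^ m • cls k z := by
  refine chainLift_cls k _ z fun hz => ?_
  rw [cls_of_notMem k hz, smul_zero]

theorem signOp_pow_cls (n : ℕ) (z : X _⦋m⦌) :
    (signOp k X ^ n) (cls k z) = (-1 : k) ^ (m * n) • cls k z := by
  induction n with
  | zero => simp
  | succ n ih =>
    rw [pow_succ, Module.End.mul_apply, signOp_cls, map_smul, ih, smul_smul, mul_add, pow_add,
      mul_comm, mul_one]

theorem chains_ext {N : Type*} [AddCommMonoid N] [Module k N] {f g : Chains k X →ₗ[k] N}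
    (h : ∀ (m : ℕ) (z : X _⦋m⦌), z ∈ X.nonDegenerate m → f (cls k z) = g (cls k z)) : f = g := by
  apply Finsupp.lhom_ext'
  rintro ⟨m, z, hz⟩
  ext
  simpa [cls, hz] using h m z hz

end VertexLists

/-! ### Subdivisions as lists of labelled intervals -/

section Intervals

/-- An interval `[lo, hi]` of a subdivision, with its label and a flag that tells whether it is
inner. -/
@[ext]
structure Iv where
  lab : ℕ
  inner : Bool
  lo : ℕ
  hi : ℕ

namespace Iv

/-- The label and the flag. -/
def key (I : Iv) : ℕ × Bool := (I.lab, I.inner)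

/-- The length used in the permutation sign. -/
def len (I : Iv) : ℕ := I.hi - I.lo + if I.inner then 1 else 0

/-- The vertices of the interval. -/
def verts (I : Iv) : List ℕ := List.range' I.lo (I.hi - I.lo + 1)

end Iv

/-- The vertices of all intervals with label `j`. -/
def dv (j : ℕ) (L : List Iv) : List ℕ := L.flatMap fun I => if I.lab = j then I.verts else []

/-- The sum of the lengths of all intervals whose labels are smaller than `j`. -/
def lenBelow (j : ℕ) (L : List Iv) : ℕ := (L.map fun J => if J.lab < j then J.len else 0).sum

/-- The exponent of the permutation sign. -/
def pe (L : List Iv) : ℕ :=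
  match L with
  | [] => 0
  | I :: L => I.len * lenBelow I.lab L + pe L

/-- The exponent of the position sign. -/
def po (L : List Iv) : ℕ := (L.map fun I => if I.inner then I.hi else 0).sum

open Classical in
/-- All subdivisions of `[s, m]` into intervals with given labels and flags. -/
def cutL (U : List (ℕ × Bool)) (s m : ℕ) : Finset (List Iv) :=
  match U with
  | [] => if s = m then {[]} else ∅
  | a :: U => (Finset.Icc s m).biUnion fun e =>
      (cutL U e m).image fun L => ⟨a.1, a.2, s, e⟩ :: L

theorem mem_cutL_nil {s m : ℕ} {L : List Iv} : L ∈ cutL [] s m ↔ s = m ∧ L = [] := by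
  unfold cutL
  split_ifs with h <;> simp [h]

theorem mem_cutL_cons {a : ℕ × Bool} {U : List (ℕ × Bool)} {s m : ℕ} {L : List Iv} :
    L ∈ cutL (a :: U) s m ↔
      ∃ e, s ≤ e ∧ e ≤ m ∧ ∃ L' ∈ cutL U e m, L = ⟨a.1, a.2, s, e⟩ :: L' := by
  rw [cutL]
  simp only [Finset.mem_biUnion, Finset.mem_Icc, Finset.mem_image, and_assoc, eq_comm]

variable {N : Type*} [AddCommMonoid N]

theorem sum_cutL_nil (s m : ℕ) (f : List Iv → N) :
    ∑ L ∈ cutL [] s m, f L = if s = m then f [] else 0 := by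
  unfold cutL
  split_ifs with h <;> simp

theorem sum_cutL_cons (a : ℕ × Bool) (U : List (ℕ × Bool)) (s m : ℕ) (f : List Iv → N) :
    ∑ L ∈ cutL (a :: U) s m, f L =
      ∑ e ∈ Finset.Icc s m, ∑ L ∈ cutL U e m, f (⟨a.1, a.2, s, e⟩ :: L) := by
  classical
  rw [cutL, Finset.sum_biUnion]
  · apply Finset.sum_congr rfl
    intro e _
    rw [Finset.sum_image]
    intro L _ L' _ h
    exact (List.cons.inj h).2
  · intro e _ e' _ hne
    rw [Function.onFun, Finset.disjoint_left]
    intro L hL hL'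
    simp only [Finset.mem_image] at hL hL'
    obtain ⟨_, _, rfl⟩ := hL
    obtain ⟨_, _, h⟩ := hL'
    exact hne (congrArg Iv.hi (List.cons.inj h).1).symm

theorem le_of_mem_cutL {U : List (ℕ × Bool)} {s m : ℕ} {L : List Iv} (h : L ∈ cutL U s m) :
    s ≤ m := by
  cases U with
  | nil => exact (mem_cutL_nil.mp h).1.le
  | cons a U =>
    obtain ⟨e, h1, h2, _⟩ := mem_cutL_cons.mp h
    omega

theorem cutL_eq_empty {U : List (ℕ × Bool)} {s m : ℕ} (h : m < s) : cutL U s m = ∅ := by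
  rw [Finset.eq_empty_iff_forall_notMem]
  intro L hL
  have := le_of_mem_cutL hL
  omega

theorem sum_cutL_append (U V : List (ℕ × Bool)) (s m : ℕ) (f : List Iv → N) :
    ∑ L ∈ cutL (U ++ V) s m, f L =
      ∑ e ∈ Finset.Icc s m, ∑ A ∈ cutL U s e, ∑ B ∈ cutL V e m, f (A ++ B) := by
  induction U generalizing s f with
  | nil =>
    simp only [List.nil_append, sum_cutL_nil, Finset.sum_ite_eq, Finset.mem_Icc, le_refl, true_and]
    split_ifs with h
    · rfl
    · rw [cutL_eq_empty (by omega), Finset.sum_empty]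
  | cons a U ih =>
    simp only [List.cons_append, sum_cutL_cons, ih]
    rw [Finset.sum_comm']
    intro e e'
    simp only [Finset.mem_Icc]
    omega

theorem mem_cutL_append {U V : List (ℕ × Bool)} {s m : ℕ} {L : List Iv} :
    L ∈ cutL (U ++ V) s m ↔ ∃ e, s ≤ e ∧ e ≤ m ∧ ∃ A ∈ cutL U s e, ∃ B ∈ cutL V e m,
      L = A ++ B := by
  induction U generalizing s L with
  | nil =>
    constructor
    · intro h
      exact ⟨s, le_rfl, le_of_mem_cutL h, [], mem_cutL_nil.mpr ⟨rfl, rfl⟩, L, h, rfl⟩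
    · rintro ⟨e, h1, h2, A, hA, B, hB, rfl⟩
      obtain ⟨rfl, rfl⟩ := mem_cutL_nil.mp hA
      exact hB
  | cons a U ih =>
    simp only [List.cons_append, mem_cutL_cons, ih]
    constructor
    · rintro ⟨e, h1, h2, L', ⟨e', h3, h4, A, hA, B, hB, rfl⟩, rfl⟩
      exact ⟨e', by omega, h4, _, ⟨e, h1, h3, A, hA, rfl⟩, B, hB, rfl⟩
    · rintro ⟨e', h1, h2, _, ⟨e, h3, h4, A, hA, rfl⟩, B, hB, rfl⟩
      exact ⟨e, h3, by omega, _, ⟨e', h4, h2, A, hA, B, hB, rfl⟩, rfl⟩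

theorem map_key_of_mem {U : List (ℕ × Bool)} {s m : ℕ} {L : List Iv} (h : L ∈ cutL U s m) :
    L.map Iv.key = U := by
  induction U generalizing s L with
  | nil => simp [(mem_cutL_nil.mp h).2]
  | cons a U ih =>
    obtain ⟨e, _, _, L', hL', rfl⟩ := mem_cutL_cons.mp h
    simp [ih hL', Iv.key]

/-- Relabelling and translation of an interval. -/
def Iv.move (r : ℕ → ℕ) (c : ℕ) (I : Iv) : Iv := ⟨r I.lab, I.inner, I.lo + c, I.hi + c⟩

theorem sum_cutL_move (r : ℕ → ℕ) (c : ℕ) (U : List (ℕ × Bool)) (s m : ℕ) (f : List Iv → N) :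
    ∑ L ∈ cutL (U.map fun a => (r a.1, a.2)) (s + c) (m + c), f L =
      ∑ L ∈ cutL U s m, f (L.map (Iv.move r c)) := by
  induction U generalizing s f with
  | nil => simp [sum_cutL_nil]
  | cons a U ih =>
    simp only [List.map_cons, sum_cutL_cons]
    rw [← Finset.map_add_right_Icc, Finset.sum_map]
    apply Finset.sum_congr rfl
    intro e _
    rw [addRightEmbedding_apply, ih]
    rfl

theorem Iv.len_move (r : ℕ → ℕ) (c : ℕ) (I : Iv) : (I.move r c).len = I.len := by
  simp only [Iv.len, Iv.move]
  congr 1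
  omega

theorem Iv.verts_move (r : ℕ → ℕ) (c : ℕ) (I : Iv) :
    (I.move r c).verts = I.verts.map (· + c) := by
  simp only [Iv.verts, Iv.move]
  have : I.hi + c - (I.lo + c) + 1 = I.hi - I.lo + 1 := by omega
  rw [this]
  apply List.ext_getElem <;> simp
  omega

theorem dv_append (j : ℕ) (A B : List Iv) : dv j (A ++ B) = dv j A ++ dv j B := by
  simp [dv]

theorem dv_cons (j : ℕ) (I : Iv) (B : List Iv) :
    dv j (I :: B) = (if I.lab = j then I.verts else []) ++ dv j B := by
  simp [dv]

theorem dv_nil (j : ℕ) : dv j [] = [] := rfl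

theorem dv_eq_nil {j : ℕ} {L : List Iv} (h : ∀ I ∈ L, I.lab ≠ j) : dv j L = [] := by
  simp only [dv, List.flatMap_eq_nil_iff]
  intro I hI
  rw [if_neg (h I hI)]

theorem dv_move {r : ℕ → ℕ} (c j : ℕ) {L : List Iv} {j' : ℕ}
    (h : ∀ I ∈ L, (r I.lab = j' ↔ I.lab = j)) :
    dv j' (L.map (Iv.move r c)) = (dv j L).map (· + c) := by
  induction L with
  | nil => rfl
  | cons I L ih =>
    rw [List.map_cons, dv_cons, dv_cons, List.map_append, ih fun J hJ => h J (by simp [hJ])]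
    congr 1
    have := h I (by simp)
    by_cases hI : I.lab = j
    · rw [if_pos hI, if_pos (show (I.move r c).lab = j' from this.mpr hI), Iv.verts_move]
    · rw [if_neg hI, if_neg (show ¬ (I.move r c).lab = j' from fun h => hI (this.mp h)),
        List.map_nil]

theorem lenBelow_append (j : ℕ) (A B : List Iv) :
    lenBelow j (A ++ B) = lenBelow j A + lenBelow j B := by
  simp [lenBelow]

theorem lenBelow_cons (j : ℕ) (I : Iv) (B : List Iv) :
    lenBelow j (I :: B) = (if I.lab < j then I.len else 0) + lenBelow j B := by
  simp [lenBelow]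

theorem lenBelow_eq_zero {j : ℕ} {L : List Iv} (h : ∀ I ∈ L, j ≤ I.lab) : lenBelow j L = 0 := by
  simp only [lenBelow, List.sum_eq_zero_iff, List.mem_map]
  rintro _ ⟨I, hI, rfl⟩
  rw [if_neg (by have := h I hI; omega)]

theorem lenBelow_move {r : ℕ → ℕ} (c j : ℕ) {L : List Iv} {j' : ℕ}
    (h : ∀ I ∈ L, (r I.lab < j' ↔ I.lab < j)) :
    lenBelow j' (L.map (Iv.move r c)) = lenBelow j L := by
  simp only [lenBelow, List.map_map]
  congr 1
  apply List.map_congr_left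
  intro I hI
  simp only [Function.comp, Iv.len_move]
  simp only [Iv.move, h I hI]

theorem pe_cons (I : Iv) (L : List Iv) : pe (I :: L) = I.len * lenBelow I.lab L + pe L := rfl

theorem pe_move {r : ℕ → ℕ} (c : ℕ) {L : List Iv}
    (h : ∀ I ∈ L, ∀ J ∈ L, (r I.lab < r J.lab ↔ I.lab < J.lab)) :
    pe (L.map (Iv.move r c)) = pe L := by
  induction L with
  | nil => rfl
  | cons I L ih =>
    rw [List.map_cons, pe_cons, pe_cons, Iv.len_move,
      ih fun J hJ K hK => h J (by simp [hJ]) K (by simp [hK]), lenBelow_move c I.lab]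
    intro J hJ
    exact h J (by simp [hJ]) I (by simp)

/-- The inversions between two lists of intervals. -/
def crossInv (A B : List Iv) : ℕ := (A.map fun I => I.len * lenBelow I.lab B).sum

theorem crossInv_cons (I : Iv) (A B : List Iv) :
    crossInv (I :: A) B = I.len * lenBelow I.lab B + crossInv A B := by
  simp [crossInv]

theorem pe_append (A B : List Iv) : pe (A ++ B) = pe A + pe B + crossInv A B := by
  induction A with
  | nil => simp [pe, crossInv]
  | cons I A ih =>
    rw [List.cons_append, pe_cons, pe_cons, ih, lenBelow_append, crossInv_cons]
    ring

theorem po_cons (I : Iv) (L : List Iv) : po (I :: L) = (if I.inner then I.hi else 0) + po L := by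
  simp [po]

theorem po_append (A B : List Iv) : po (A ++ B) = po A + po B := by
  simp [po]

theorem po_move (r : ℕ → ℕ) (c : ℕ) (L : List Iv) :
    po (L.map (Iv.move r c)) = po L + c * (L.map Iv.key).countP (·.2) := by
  induction L with
  | nil => rfl
  | cons I L ih =>
    rw [List.map_cons, po_cons, po_cons, ih, List.map_cons, List.countP_cons]
    simp only [Iv.move, Iv.key]
    rcases Bool.eq_false_or_eq_true I.inner with h | h
    · simp [h]
      ring
    · simp [h]

end Intervals

/-! ### Passage from cut functions to lists of intervals -/

section Decorated

/-- The labels of a surjection, together with the flags that tell which intervals are inner. -/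
def decorate (u : List ℕ) : List (ℕ × Bool) :=
  match u with
  | [] => []
  | a :: u => (a, decide (a ∈ u)) :: decorate u

open Classical in
theorem decorate_eq_ofFn (u : List ℕ) :
    decorate u = List.ofFn fun t : Fin u.length => (u.get t, decide (IsInner u t)) := by
  induction u with
  | nil => rfl
  | cons a u ih =>
    rw [decorate, ih, List.ofFn_succ]
    congr 1
    · congr 1
      rw [decide_eq_decide]
      constructor
      · intro h
        obtain ⟨i, hi⟩ := List.get_of_mem h
        exact ⟨i.succ, Fin.succ_pos i, hi⟩
      · rintro ⟨t, ht, h⟩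
        obtain ⟨i, rfl⟩ := Fin.exists_succ_eq.mpr (ne_of_gt ht)
        rw [show a = u.get i from h.symm]
        exact List.get_mem _ _
    · congr 1
      funext t
      congr 1
      rw [decide_eq_decide]
      constructor
      · rintro ⟨t', ht, h⟩
        exact ⟨t'.succ, Fin.succ_lt_succ_iff.mpr ht, h⟩
      · rintro ⟨t', ht, h⟩
        obtain ⟨i, rfl⟩ := Fin.exists_succ_eq.mpr (ne_of_gt (lt_of_le_of_lt (Fin.zero_le _) ht))
        exact ⟨i, Fin.succ_lt_succ_iff.mp ht, h⟩

/-- The intervals with given endpoints. -/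
def ivsOf {N : ℕ} (κ : Fin N → ℕ × Bool) (c : Fin (N + 1) → ℕ) : List Iv :=
  List.ofFn fun t => ⟨(κ t).1, (κ t).2, c t.castSucc, c t.succ⟩

theorem mem_cutL_ofFn {N : ℕ} (κ : Fin N → ℕ × Bool) (s m : ℕ) (L : List Iv) :
    L ∈ cutL (List.ofFn κ) s m ↔ ∃ c : Fin (N + 1) → ℕ, Monotone c ∧ c 0 = s ∧
      c (Fin.last N) = m ∧ L = ivsOf κ c := by
  induction N generalizing s L with
  | zero =>
    rw [List.ofFn_zero, mem_cutL_nil]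
    constructor
    · rintro ⟨rfl, rfl⟩
      exact ⟨fun _ => s, fun _ _ _ => le_rfl, rfl, rfl, rfl⟩
    · rintro ⟨c, _, h1, h2, rfl⟩
      exact ⟨h1.symm.trans h2, rfl⟩
  | succ N ih =>
    rw [List.ofFn_succ, mem_cutL_cons]
    simp only [ih]
    constructor
    · rintro ⟨e, h1, h2, L', ⟨c, hc, h3, h4, rfl⟩, rfl⟩
      refine ⟨Fin.cons s c, ?_, rfl, ?_, ?_⟩
      · rw [Fin.monotone_iff_le_succ]
        intro i
        refine Fin.cases ?_ (fun i => ?_) i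
        · simp [h3, h1]
        · simpa using Fin.monotone_iff_le_succ.mp hc i
      · rw [← Fin.succ_last, Fin.cons_succ, h4]
      · simp only [ivsOf, List.ofFn_succ, Fin.castSucc_zero, Fin.cons_zero, Fin.cons_succ, h3,
          ← Fin.succ_castSucc]
    · rintro ⟨c, hc, rfl, rfl, rfl⟩
      refine ⟨c 1, hc (Fin.zero_le _), hc (Fin.le_last _), ivsOf (fun i => κ i.succ)
        (fun i => c i.succ), ⟨fun i => c i.succ, fun i j h => hc (Fin.succ_le_succ_iff.mpr h), rfl,
          rfl, rfl⟩, ?_⟩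
      simp only [ivsOf, List.ofFn_succ]
      rfl

theorem pe_ofFn {N : ℕ} (g : Fin N → Iv) :
    pe (List.ofFn g) = ∑ s : Fin N, ∑ t : Fin N,
      if s < t ∧ (g t).lab < (g s).lab then (g s).len * (g t).len else 0 := by
  induction N with
  | zero => simp [pe]
  | succ N ih =>
    rw [List.ofFn_succ, pe_cons, ih, Fin.sum_univ_succ]
    congr 1
    · rw [Fin.sum_univ_succ]
      simp only [lt_self_iff_false, false_and, if_false, zero_add, Fin.succ_pos, true_and, lenBelow,
        List.map_ofFn, List.sum_ofFn, Finset.mul_sum, Function.comp]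
      exact Finset.sum_congr rfl fun i _ => by split_ifs <;> simp
    · apply Finset.sum_congr rfl
      intro s _
      rw [Fin.sum_univ_succ]
      simp

open Classical in
theorem pe_po_dv_ivsOf (u : List ℕ) {m : ℕ} (c : Fin (u.length + 1) → Fin (m + 1)) :
    let L := ivsOf (fun t => (u.get t, decide (IsInner u t))) fun i => (c i).val
    pe L = permExp u c ∧ po L = posExp u c ∧ ∀ j, dv j L = labelVertices u c j := by
  refine ⟨?_, ?_, ?_⟩
  · rw [ivsOf, pe_ofFn]
    simp only [permExp, Iv.len, cutLength, decide_eq_true_eq]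
  · simp [po, ivsOf, posExp, List.map_ofFn, List.sum_ofFn]
  · intro j
    simp only [dv, ivsOf, labelVertices, List.ofFn_eq_map, List.flatMap_map, Iv.verts]

/-- A term of an interval cut operation depends on the cut only through its sign exponent and the
vertex lists of its labels, so an arbitrary function `F` of these covers all uses. -/
theorem sum_cuts {N : Type*} [AddCommMonoid N] (u : List ℕ) (m : ℕ)
    (F : ℕ → (ℕ → List ℕ) → N) :
    ∑ c ∈ cuts u.length m, F (permExp u c + posExp u c) (labelVertices u c) =
      ∑ L ∈ cutL (decorate u) 0 m, F (pe L + po L) (fun j => dv j L) := by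
  classical
  refine Finset.sum_bij
    (fun c _ => ivsOf (fun t => (u.get t, decide (IsInner u t))) fun i => (c i).val) ?_ ?_ ?_ ?_
  · intro c hc
    simp only [cuts, Finset.mem_filter, Finset.mem_univ, true_and] at hc
    rw [decorate_eq_ofFn, mem_cutL_ofFn]
    exact ⟨_, fun i j h => hc.1 h, by simp [hc.2.1], by simp [hc.2.2], rfl⟩
  · intro c hc c' hc' h
    simp only [cuts, Finset.mem_filter, Finset.mem_univ, true_and] at hc hc'
    have h' := List.ofFn_injective h
    funext i
    refine Fin.cases ?_ (fun i => ?_) i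
    · rw [hc.2.1, hc'.2.1]
    · exact Fin.ext (congrArg Iv.hi (congrFun h' i))
  · intro L hL
    rw [decorate_eq_ofFn, mem_cutL_ofFn] at hL
    obtain ⟨c, hc, h0, hm, rfl⟩ := hL
    have hb : ∀ i, c i < m + 1 := fun i => by
      have := hc (Fin.le_last i)
      omega
    refine ⟨fun i => ⟨c i, hb i⟩, ?_, rfl⟩
    simp only [cuts, Finset.mem_filter, Finset.mem_univ, true_and]
    exact ⟨fun i j h => hc h, Fin.ext h0, Fin.ext hm⟩
  · intro c _
    obtain ⟨h1, h2, h3⟩ := pe_po_dv_ivsOf u c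
    rw [h1, h2]
    congr 1
    funext j
    exact (h3 j).symm

end Decorated

/-! ### Vertex lists of a subdivision -/

section Vertices

theorem exists_append_of_mem {L : List Iv} {U V : List (ℕ × Bool)} {a : ℕ × Bool} {s m : ℕ}
    (h : L ∈ cutL (U ++ a :: V) s m) : ∃ lo hi, s ≤ lo ∧ lo ≤ hi ∧ hi ≤ m ∧
      ∃ A ∈ cutL U s lo, ∃ B ∈ cutL V hi m, L = A ++ ⟨a.1, a.2, lo, hi⟩ :: B := by
  obtain ⟨lo, h1, h2, A, hA, B, hB, rfl⟩ := mem_cutL_append.mp h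
  obtain ⟨hi, h3, h4, B', hB', rfl⟩ := mem_cutL_cons.mp hB
  exact ⟨lo, hi, h1, h3, h4, A, hA, B', hB', rfl⟩

theorem mem_cutL_split {L : List Iv} {U : List (ℕ × Bool)} {s m : ℕ} {A B : List Iv} {I : Iv}
    (h : L ∈ cutL U s m) (hL : L = A ++ I :: B) : s ≤ I.lo ∧ I.lo ≤ I.hi ∧ I.hi ≤ m ∧
      A ∈ cutL (A.map Iv.key) s I.lo ∧ B ∈ cutL (B.map Iv.key) I.hi m ∧
      U = A.map Iv.key ++ I.key :: B.map Iv.key := by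
  have hU := map_key_of_mem h
  subst hU hL
  rw [List.map_append, List.map_cons] at h
  obtain ⟨lo, hi, h1, h2, h3, A', hA', B', hB', heq⟩ := exists_append_of_mem h
  have hlen : A.length = A'.length := by
    have := congrArg List.length (map_key_of_mem hA')
    simpa using this.symm
  obtain ⟨rfl, h4⟩ := List.append_inj heq hlen
  obtain ⟨h5, rfl⟩ := List.cons.inj h4
  have e1 : I.lo = lo := by rw [h5]
  have e2 : I.hi = hi := by rw [h5]
  rw [e1, e2]
  exact ⟨h1, h2, h3, hA', hB', by simp⟩

theorem exists_interval_of_step {U : List (ℕ × Bool)} {s m e : ℕ} {L : List Iv}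
    (h : L ∈ cutL U s m) (h1 : s ≤ e) (h2 : e < m) :
    ∃ A I B, L = A ++ I :: B ∧ I.lo ≤ e ∧ e < I.hi := by
  induction U generalizing s L with
  | nil =>
    have := (mem_cutL_nil.mp h).1
    omega
  | cons a U ih =>
    obtain ⟨x, h3, h4, L', hL', rfl⟩ := mem_cutL_cons.mp h
    rcases lt_or_ge e x with h5 | h5
    · exact ⟨[], _, L', rfl, h1, h5⟩
    · obtain ⟨A, I, B, rfl, h6, h7⟩ := ih hL' h5
      exact ⟨_ :: A, I, B, rfl, h6, h7⟩

theorem Iv.mem_verts {I : Iv} {x : ℕ} (h : I.lo ≤ I.hi) : x ∈ I.verts ↔ I.lo ≤ x ∧ x ≤ I.hi := by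
  simp only [Iv.verts, List.mem_range'_1]
  omega

theorem dv_sorted {U : List (ℕ × Bool)} {s m : ℕ} {L : List Iv} (h : L ∈ cutL U s m) (j : ℕ) :
    (dv j L).Pairwise (· ≤ ·) ∧ ∀ x ∈ dv j L, s ≤ x ∧ x ≤ m := by
  induction U generalizing s L with
  | nil =>
    obtain ⟨_, rfl⟩ := mem_cutL_nil.mp h
    simp [dv_nil]
  | cons a U ih =>
    obtain ⟨x, h3, h4, L', hL', rfl⟩ := mem_cutL_cons.mp h
    obtain ⟨ih1, ih2⟩ := ih hL'
    rw [dv_cons]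
    split_ifs with hj
    · refine ⟨List.pairwise_append.mpr ⟨?_, ih1, ?_⟩, ?_⟩
      · exact List.pairwise_le_range' 1
      · intro y hy z hz
        have := (Iv.mem_verts h3).mp hy
        have := ih2 z hz
        simp only at *
        omega
      · intro y hy
        rcases List.mem_append.mp hy with hy | hy
        · have := (Iv.mem_verts h3).mp hy
          simp only at *
          omega
        · have := ih2 y hy
          omega
    · refine ⟨ih1, fun y hy => ?_⟩
      have := ih2 y hy
      omega

theorem verts_sublist_dv {L : List Iv} {I : Iv} (h : I ∈ L) : I.verts.Sublist (dv I.lab L) := by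
  obtain ⟨A, B, rfl⟩ := List.append_of_mem h
  rw [dv_append, dv_cons, if_pos rfl]
  exact (List.sublist_append_left _ _).trans (List.sublist_append_right _ _)

theorem dv_ne_nil {L : List Iv} {j : ℕ} (h : j ∈ (L.map Iv.key).map Prod.fst) : dv j L ≠ [] := by
  simp only [List.map_map, List.mem_map, Function.comp] at h
  obtain ⟨I, hI, rfl⟩ := h
  have h1 : I.lo ∈ dv I.lab L :=
    (verts_sublist_dv hI).subset (by simp [Iv.verts])
  exact List.ne_nil_of_mem h1

end Vertices

/-! ### Interval cut operations on arbitrary simplices -/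

section IntervalCut

variable (k : Type v) [CommRing k] {X : SSet.{u}}

/-- On a degenerate simplex with collapsed step from `i` to `i + 1`, every subdivision has an
interval that contains this step. The piece with the label of that interval vanishes, and with it
the term, by `hT`. -/
theorem intervalCut_cls {N : Type*} [AddCommMonoid N] [Module k N] (u : List ℕ)
    (T : (ℕ → Chains k X) → N) (hT : ∀ y, ∀ j ∈ u, y j = 0 → T y = 0) {m : ℕ} (z : X _⦋m⦌) :
    intervalCut k u T (cls k z) = ∑ L ∈ cutL (decorate u) 0 m,
      (-1 : k) ^ (pe L + po L) • T (fun j => vcls k z (dv j L)) := by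
  unfold intervalCut
  rw [← sum_cuts u m (fun e l => (-1 : k) ^ e • T (fun j => vcls k z (l j)))]
  refine chainLift_cls k (fun m z => _) z fun hz => ?_
  change ∑ c ∈ cuts u.length m, (-1 : k) ^ (permExp u c + posExp u c) •
    T (fun j => vcls k z (labelVertices u c j)) = 0
  rw [sum_cuts u m (fun e l => (-1 : k) ^ e • T (fun j => vcls k z (l j)))]
  apply Finset.sum_eq_zero
  intro L hL
  obtain ⟨i, him, hi⟩ := cls_eq_zero_or (k := k) hz
  obtain ⟨A, I, B, rfl, h1, h2⟩ := exists_interval_of_step hL (Nat.zero_le i) him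
  have hk := map_key_of_mem hL
  have hfst : ∀ u, (decorate u).map Prod.fst = u := by
    intro u
    induction u with
    | nil => rfl
    | cons a u ih => simp [decorate, ih]
  rw [hT _ I.lab, smul_zero]
  · rw [← hfst u, ← hk]
    simp [Iv.key]
  · have hle := (mem_cutL_split hL rfl).2.1
    have hsub := (verts_sublist_dv (L := A ++ I :: B) (I := I) (by simp)).subset
    apply hi
    · exact (dv_sorted hL _).1
    · exact fun a ha => ((dv_sorted hL _).2 a ha).2
    · exact hsub ((Iv.mem_verts hle).mpr ⟨h1, h2.le⟩)
    · exact hsub ((Iv.mem_verts hle).mpr ⟨by omega, h2⟩)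

end IntervalCut

/-! ### The words `u(j)` with their inner/final flags -/

section Words

/-- The decorated block `v, w 0, v, …, v, w (r-1), v`. -/
def blockW (v : ℕ) (w : ℕ → ℕ) (r : ℕ) : List (ℕ × Bool) :=
  (v, decide (0 < r)) :: (List.range r).flatMap fun c => [(w c, false), (v, decide (c + 1 < r))]

theorem blockW_succ (v : ℕ) (w : ℕ → ℕ) (r : ℕ) :
    blockW v w (r + 1) = (v, true) :: (w 0, false) :: blockW v (fun c => w (c + 1)) r := by
  simp [blockW, List.range_succ_eq_map, List.flatMap_map]

theorem mem_blockW {v : ℕ} {w : ℕ → ℕ} {r : ℕ} {a : ℕ × Bool} (h : a ∈ blockW v w r) :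
    a.1 = v ∨ ∃ c < r, a.1 = w c := by
  induction r generalizing w with
  | zero =>
    simp [blockW] at h
    simp [h]
  | succ r ih =>
    rw [blockW_succ] at h
    simp only [List.mem_cons] at h
    rcases h with rfl | rfl | h
    · exact Or.inl rfl
    · exact Or.inr ⟨0, by omega, rfl⟩
    · rcases ih h with h | ⟨c, hc, h⟩
      · exact Or.inl h
      · exact Or.inr ⟨c + 1, by omega, h⟩

theorem decorate_map_fst (u : List ℕ) : (decorate u).map Prod.fst = u := by
  induction u with
  | nil => rfl
  | cons a u ih => simp [decorate, ih]

theorem decorate_append {A B : List ℕ} (h : ∀ a ∈ A, a ∉ B) :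
    decorate (A ++ B) = decorate A ++ decorate B := by
  induction A with
  | nil => rfl
  | cons a A ih =>
    rw [List.cons_append, decorate, decorate, ih fun b hb => h b (by simp [hb])]
    simp [h a (by simp)]

theorem decorate_block (v : ℕ) {w : ℕ → ℕ} (hw : Function.Injective w) (hv : ∀ c, w c ≠ v)
    (r : ℕ) : decorate (v :: (List.range r).flatMap fun c => [w c, v]) = blockW v w r := by
  induction r generalizing w with
  | zero => rfl
  | succ r ih =>
    have h := ih (w := fun c => w (c + 1)) (fun a b h => by simpa using hw h) (fun c => hv _)
    rw [List.range_succ_eq_map]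
    simp only [List.flatMap_cons, List.flatMap_map, List.cons_append, List.nil_append,
      Nat.succ_eq_add_one]
    rw [decorate, decorate, h, blockW_succ]
    congr 2
    · simp
    · congr 1
      simp only [List.mem_cons, decide_eq_false_iff_not, not_or, List.mem_flatMap, not_exists,
        not_and]
      refine ⟨hv 0, fun c _ => ⟨fun h => ?_, hv 0, by simp⟩⟩
      have := hw h
      omega

/-- The triples of an index, the sum of the preceding entries and the entry of a list. -/
def triples (t i : ℕ) (js : List ℕ) : List (ℕ × ℕ × ℕ) :=
  match js with
  | [] => []
  | r :: js => (t, i, r) :: triples (t + 1) (i + r) js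

theorem map_finRange_eq_triples {n : ℕ} (j : Fin n → ℕ) :
    (List.finRange n).map (fun t => (t.val, partialSum j t, j t)) =
      triples 0 0 (List.ofFn j) := by
  suffices H : ∀ (t i : ℕ), (List.finRange n).map (fun s => (t + s.val, i + partialSum j s, j s)) =
      triples t i (List.ofFn j) by simpa using H 0 0
  induction n with
  | zero => intro _ _; rfl
  | succ n ih =>
    intro t i
    rw [List.finRange_succ, List.map_cons, List.ofFn_succ, triples, List.map_map,
      ← ih (fun s => j s.succ)]
    refine congrArg₂ List.cons ?_ ?_
    · simp [partialSum]
    · rw [List.map_inj_left]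
      intro s _
      simp only [Function.comp, Fin.val_succ, partialSum, Prod.mk.injEq, and_true]
      refine ⟨by omega, ?_⟩
      have : Finset.Iio s.succ = Finset.cons 0 ((Finset.Iio s).map (Fin.succEmb n)) (by simp) := by
        ext a
        refine Fin.cases ?_ (fun a => ?_) a <;> simp
      rw [this, Finset.sum_cons, Finset.sum_map]
      simp [add_assoc]

/-- The decorated block `v_t, w_i, v_t, …, w_{i+r-1}, v_t`. -/
def block (t i r : ℕ) : List (ℕ × Bool) := blockW (2 * t + 1) (fun c => 2 * (i + c + 1)) r

/-- The concatenation of decorated blocks, starting at the indices `t` and `i`. -/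
def word (t i : ℕ) (js : List ℕ) : List (ℕ × Bool) :=
  (triples t i js).flatMap fun x => block x.1 x.2.1 x.2.2

theorem word_nil (t i : ℕ) : word t i [] = [] := rfl

theorem word_cons (t i r : ℕ) (js : List ℕ) :
    word t i (r :: js) = block t i r ++ word (t + 1) (i + r) js := by
  simp [word, triples]

theorem block_succ (t i r : ℕ) :
    block t i (r + 1) = (2 * t + 1, true) :: (2 * (i + 1), false) :: block t (i + 1) r := by
  rw [block, blockW_succ]
  simp only [block, Nat.add_zero]
  congr 4
  funext c
  ring

theorem mem_block {t i r : ℕ} {a : ℕ × Bool} (h : a ∈ block t i r) :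
    a.1 = 2 * t + 1 ∨ ∃ c, i ≤ c ∧ c < i + r ∧ a.1 = 2 * (c + 1) := by
  rcases mem_blockW h with h | ⟨c, hc, h⟩
  · exact Or.inl h
  · exact Or.inr ⟨i + c, by omega, by omega, h⟩

theorem mem_word {t i : ℕ} {js : List ℕ} {a : ℕ × Bool} (h : a ∈ word t i js) :
    (∃ s, t ≤ s ∧ s < t + js.length ∧ a.1 = 2 * s + 1) ∨
      ∃ c, i ≤ c ∧ c < i + js.sum ∧ a.1 = 2 * (c + 1) := by
  induction js generalizing t i with
  | nil => simp [word_nil] at h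
  | cons r js ih =>
    rw [word_cons, List.mem_append] at h
    simp only [List.length_cons, List.sum_cons]
    rcases h with h | h
    · rcases mem_block h with h | ⟨c, h1, h2, h3⟩
      · exact Or.inl ⟨t, by omega, by omega, h⟩
      · exact Or.inr ⟨c, by omega, by omega, h3⟩
    · rcases ih h with ⟨s, h1, h2, h3⟩ | ⟨c, h1, h2, h3⟩
      · exact Or.inl ⟨s, by omega, by omega, h3⟩
      · exact Or.inr ⟨c, by omega, by omega, h3⟩

theorem block_map_fst (t i r : ℕ) :
    (block t i r).map Prod.fst =
      (2 * t + 1) :: (List.range r).flatMap fun c => [2 * (i + c + 1), 2 * t + 1] := by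
  rw [block, ← decorate_block, decorate_map_fst]
  · intro a b h
    simp only at h
    omega
  · intro c
    omega

/-- Different blocks have no letter in common, so the flags are determined inside each block. The
bound `h` keeps the last letter `2 * n` out of the blocks. -/
theorem decorate_word (t i n : ℕ) (js : List ℕ) (h : i + js.sum < n) :
    decorate (((triples t i js).flatMap fun x => (2 * x.1 + 1) ::
      (List.range x.2.2).flatMap fun c => [2 * (x.2.1 + c + 1), 2 * x.1 + 1]) ++ [2 * n]) =
      word t i js ++ [(2 * n, false)] := by
  induction js generalizing t i with
  | nil => rfl
  | cons r js ih =>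
    rw [List.sum_cons] at h
    rw [triples, List.flatMap_cons, List.append_assoc, decorate_append, ih _ _ (by omega),
      word_cons, List.append_assoc, decorate_block, block]
    · intro a b h
      simp only at h
      omega
    · intro c
      omega
    · intro a ha hb
      rw [← block_map_fst, List.mem_map] at ha
      rw [← decorate_map_fst (_ ++ _), ih _ _ (by omega), List.mem_map] at hb
      obtain ⟨x, hx, rfl⟩ := ha
      obtain ⟨y, hy, hxy⟩ := hb
      rw [List.mem_append, List.mem_singleton] at hy
      dsimp only at hx
      rcases mem_block hx with h1 | ⟨c, h1, h2, h3⟩ <;>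
        rcases hy with hy | rfl
      · rcases mem_word hy with ⟨s, h4, h5, h6⟩ | ⟨c, h4, h5, h6⟩ <;> omega
      · simp only at hxy
        omega
      · rcases mem_word hy with ⟨s, h4, h5, h6⟩ | ⟨c', h4, h5, h6⟩ <;> omega
      · simp only at hxy
        omega

/-- The decorated surjection `u(j)`. -/
def fullWord (n : ℕ) (js : List ℕ) : List (ℕ × Bool) := word 0 0 js ++ [(2 * n, false)]

theorem mem_decomps {n : ℕ} {j : Fin n → ℕ} :
    j ∈ decomps n ↔ ∑ i, j i = n - 1 ∧ ∀ s : Fin n, ∑ i ∈ Finset.Iic s, j i < s.val + 1 := by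
  simp [decomps, Finset.Nat.mem_antidiagonalTuple]

theorem surjJ_eq {n : ℕ} (j : Fin n → ℕ) :
    surjJ j = ((triples 0 0 (List.ofFn j)).flatMap fun x => (2 * x.1 + 1) ::
      (List.range x.2.2).flatMap fun c => [2 * (x.2.1 + c + 1), 2 * x.1 + 1]) ++ [2 * n] := by
  rw [surjJ, ← map_finRange_eq_triples, List.flatMap_map]

theorem decorate_surjJ {n : ℕ} (hn : 1 ≤ n) {j : Fin n → ℕ} (hj : j ∈ decomps n) :
    decorate (surjJ j) = fullWord n (List.ofFn j) := by
  rw [surjJ_eq, decorate_word, fullWord]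
  rw [List.sum_ofFn, (mem_decomps.mp hj).1]
  omega

theorem word_append (t i : ℕ) (A B : List ℕ) :
    word t i (A ++ B) = word t i A ++ word (t + A.length) (i + A.sum) B := by
  induction A generalizing t i with
  | nil => simp [word_nil]
  | cons r A ih =>
    rw [List.cons_append, word_cons, word_cons, ih, List.append_assoc]
    simp only [List.length_cons, List.sum_cons]
    congr 3 <;> omega

/-- The shift of labels by `2`. -/
def shiftKey (a : ℕ × Bool) : ℕ × Bool := (a.1 + 2, a.2)

theorem block_shift (t i r : ℕ) : (block t i r).map shiftKey = block (t + 1) (i + 1) r := by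
  induction r generalizing i with
  | zero => simp [block, blockW, shiftKey]; ring
  | succ r ih =>
    rw [block_succ, block_succ, List.map_cons, List.map_cons, ih]
    congr 1

theorem word_shift (t i : ℕ) (js : List ℕ) :
    (word t i js).map shiftKey = word (t + 1) (i + 1) js := by
  induction js generalizing t i with
  | nil => rfl
  | cons r js ih =>
    rw [word_cons, word_cons, List.map_append, block_shift, ih]
    congr 2
    ring

/-- The letters `v_t, …, v_{t+s-1}`. -/
def oddLetters (t s : ℕ) : List (ℕ × Bool) := word t 0 (List.replicate s 0)

theorem fullWord_split (n s r : ℕ) (js : List ℕ) :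
    fullWord n (List.replicate s 0 ++ r :: js) =
      oddLetters 0 s ++ (block s 0 r ++ word (s + 1) r js ++ [(2 * n, false)]) := by
  rw [fullWord, word_append, word_cons, oddLetters]
  simp

/-- Labels shift by 2, the letter `1` appears in front, and the first letter of the block after the
`s` trivial ones is replaced by two copies of itself with `2` in between. This is the combinatorial
core of the recursion. -/
theorem fullWord_insert (n s r : ℕ) (js : List ℕ) :
    fullWord (n + 1) (0 :: (List.replicate s 0 ++ (r + 1) :: js)) =
      (1, false) :: ((oddLetters 0 s).map shiftKey ++ (2 * s + 3, true) :: (2, false) ::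
        (block s 0 r ++ word (s + 1) r js ++ [(2 * n, false)]).map shiftKey) := by
  rw [fullWord, word_cons, word_append, word_cons, oddLetters, List.map_append, List.map_append,
    block_shift, word_shift, word_shift]
  have h1 : word (0 + 1) (0 + 1) (List.replicate s 0) = word (0 + 1) (0 + 0) (List.replicate s 0) := by
    -- Trivial blocks contain no even letters, so the second index does not matter for them.
    have : ∀ t i i', word t i (List.replicate s 0) = word t i' (List.replicate s 0) := by
      induction s with
      | zero => intro _ _ _; rfl
      | succ s ih =>
        intro t i i'
        rw [List.replicate_succ, word_cons, word_cons, ih (t + 1) (i + 0) (i' + 0)]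
        congr 1
    exact this _ _ _
  rw [h1]
  simp only [List.length_replicate, List.sum_replicate, block_succ]
  simp [block, blockW, shiftKey]
  ring_nf
  simp

end Words

/-! ### Admissible tuples and their recursion -/

section Admissible

/-- The tuples in `decomps n`, as lists. -/
def admLists (n : ℕ) : Finset (List ℕ) := (decomps n).image List.ofFn

theorem sum_admLists {N : Type*} [AddCommMonoid N] (n : ℕ) (f : List ℕ → N) :
    ∑ js ∈ admLists n, f js = ∑ j ∈ decomps n, f (List.ofFn j) :=
  Finset.sum_image fun _ _ _ _ h => List.ofFn_injective h

theorem take_ofFn_sum {n : ℕ} (j : Fin n → ℕ) (s : Fin n) :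
    ((List.ofFn j).take (s.val + 1)).sum = ∑ i ∈ Finset.Iic s, j i := by
  rw [List.sum_take_ofFn]
  refine Finset.sum_congr (Finset.ext fun i => ?_) fun _ _ => rfl
  simp only [Finset.mem_filter, Finset.mem_univ, true_and, Finset.mem_Iic, Fin.le_def]
  omega

theorem mem_admLists {n : ℕ} {js : List ℕ} : js ∈ admLists n ↔
    js.length = n ∧ js.sum = n - 1 ∧ ∀ i < n, (js.take (i + 1)).sum < i + 1 := by
  simp only [admLists, Finset.mem_image, mem_decomps]
  constructor
  · rintro ⟨j, ⟨h1, h2⟩, rfl⟩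
    refine ⟨List.length_ofFn, by rw [List.sum_ofFn, h1], fun i hi => ?_⟩
    rw [take_ofFn_sum j ⟨i, hi⟩]
    exact h2 ⟨i, hi⟩
  · rintro ⟨rfl, h2, h3⟩
    refine ⟨js.get, ⟨?_, ?_⟩, List.ofFn_get js⟩
    · rw [← List.sum_ofFn, List.ofFn_get, h2]
    · intro s
      rw [← take_ofFn_sum, List.ofFn_get]
      exact h3 s s.2

theorem mem_admLists_split {n s r : ℕ} {js : List ℕ} :
    List.replicate s 0 ++ r :: js ∈ admLists n ↔ s + 1 + js.length = n ∧ r + js.sum = n - 1 ∧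
      ∀ e ≤ js.length, r + (js.take e).sum < s + 1 + e := by
  rw [mem_admLists]
  have h1 : (List.replicate s 0 ++ r :: js).length = s + 1 + js.length := by simp; omega
  have h2 : (List.replicate s 0 ++ r :: js).sum = r + js.sum := by simp
  rw [h1, h2]
  refine and_congr_right fun hn => and_congr_right fun _ => ⟨fun h e he => ?_, fun h i hi => ?_⟩
  · have := h (s + e) (by omega)
    rw [show s + e + 1 = s + (e + 1) by ring, List.take_append, List.take_of_length_le (by simp)]
      at this
    simp at this
    omega
  · rcases lt_or_ge i s with h3 | h3
    · rw [List.take_append_of_le_length (by simp; omega)]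
      simp
    · obtain ⟨e, rfl⟩ := Nat.exists_eq_add_of_le h3
      rw [show s + e + 1 = s + (e + 1) by ring, List.take_append, List.take_of_length_le (by simp)]
      have := h e (by omega)
      simp
      omega

/-- The list `0, …, 0, r + 1, …` with `s + 1` zeros, for the list `0, …, 0, r, …` with `s` zeros. -/
def insertIdx (s : ℕ) (js : List ℕ) : List ℕ :=
  0 :: (List.replicate s 0 ++ (js.getD s 0 + 1) :: js.drop (s + 1))

/-- The number of leading zeros can be taken to be `s`. -/
def zerosAt (n : ℕ) (js : List ℕ) : Finset ℕ :=
  (Finset.range n).filter fun s => js.take s = List.replicate s 0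

theorem eq_of_mem_zerosAt {n s : ℕ} {js : List ℕ} (h : s ∈ zerosAt n js) (hn : js.length = n) :
    js = List.replicate s 0 ++ js.getD s 0 :: js.drop (s + 1) := by
  simp only [zerosAt, Finset.mem_filter, Finset.mem_range] at h
  have h1 : js.getD s 0 :: js.drop (s + 1) = js.drop s := by
    rw [List.getD_eq_getElem _ _ (by omega), List.cons_getElem_drop_succ]
  rw [h1, ← h.2, List.take_append_drop]

theorem replicate_append_inj {s s' r r' : ℕ} {B B' : List ℕ}
    (h : List.replicate s 0 ++ (r + 1) :: B = List.replicate s' 0 ++ (r' + 1) :: B') :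
    s = s' ∧ r = r' ∧ B = B' := by
  induction s generalizing s' with
  | zero =>
    cases s' with
    | zero => simpa using h
    | succ s' => simp [List.replicate_succ] at h
  | succ s ih =>
    cases s' with
    | zero => simp [List.replicate_succ] at h
    | succ s' =>
      simp only [List.replicate_succ, List.cons_append, List.cons.injEq, true_and] at h
      obtain ⟨h1, h2⟩ := ih h
      exact ⟨by omega, h2⟩

theorem exists_replicate_of_sum_pos {js : List ℕ} (h : 0 < js.sum) :
    ∃ s r B, js = List.replicate s 0 ++ (r + 1) :: B := by
  induction js with
  | nil => simp at h
  | cons a js ih =>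
    cases a with
    | zero =>
      obtain ⟨s, r, B, rfl⟩ := ih (by simpa using h)
      exact ⟨s + 1, r, B, rfl⟩
    | succ a => exact ⟨0, a, js, rfl⟩

/-- In an admissible list of length `n + 2` the first entry is zero and the sum is positive.
Deleting that zero and lowering the first positive entry inverts `insertIdx`. The lowered entry may
become zero, so the shorter list does not determine `s`; hence the inner sum over `zerosAt`. -/
theorem sum_admLists_succ {N : Type*} [AddCommMonoid N] (n : ℕ) (f : List ℕ → N) :
    ∑ js ∈ admLists (n + 2), f js =
      ∑ js ∈ admLists (n + 1), ∑ s ∈ zerosAt (n + 1) js, f (insertIdx s js) := by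
  rw [Finset.sum_sigma']
  symm
  refine Finset.sum_bij (fun x _ => insertIdx x.2 x.1) ?_ ?_ ?_ fun _ _ => rfl
  · rintro ⟨js, s⟩ h
    simp only [Finset.mem_sigma] at h
    obtain ⟨h1, h2⟩ := h
    have hs := eq_of_mem_zerosAt h2 (mem_admLists.mp h1).1
    rw [hs, mem_admLists_split] at h1
    have : insertIdx s js = List.replicate (s + 1) 0 ++ (js.getD s 0 + 1) :: js.drop (s + 1) := rfl
    simp only [this, mem_admLists_split]
    refine ⟨by omega, by omega, fun e he => ?_⟩
    have := h1.2.2 e he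
    omega
  · rintro ⟨js, s⟩ h ⟨js', s'⟩ h' heq
    simp only [Finset.mem_sigma] at h h'
    have hs := eq_of_mem_zerosAt h.2 (mem_admLists.mp h.1).1
    have hs' := eq_of_mem_zerosAt h'.2 (mem_admLists.mp h'.1).1
    obtain ⟨rfl, h2, h3⟩ := replicate_append_inj (List.cons.inj heq).2
    rw [h2, h3, ← hs'] at hs
    rw [hs]
  · intro js h
    obtain ⟨s, r, B, rfl⟩ := exists_replicate_of_sum_pos (js := js) (by
      rw [(mem_admLists.mp h).2.1]; omega)
    rw [mem_admLists_split] at h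
    -- Admissibility at the first positive entry forces a zero in front of it.
    have h0 := h.2.2 0 (Nat.zero_le _)
    simp only [List.take_zero, List.sum_nil] at h0
    obtain ⟨s, rfl⟩ : ∃ s', s = s' + 1 := ⟨s - 1, by omega⟩
    refine ⟨⟨List.replicate s 0 ++ r :: B, s⟩, ?_, ?_⟩
    · simp only [Finset.mem_sigma, mem_admLists_split, zerosAt, Finset.mem_filter, Finset.mem_range]
      refine ⟨⟨by omega, by omega, fun e he => ?_⟩, by omega, by simp⟩
      have := h.2.2 e he
      omega
    · simp [insertIdx, List.replicate_succ]
      rw [List.drop_append]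
      simp

end Admissible

/-! ### Odd and even letters in a word -/

section Parity

theorem fullWord_lab {n : ℕ} {js : List ℕ} (h : js ∈ admLists n) (hn : 1 ≤ n) {a : ℕ × Bool}
    (ha : a ∈ fullWord n js) : ∃ t < n, a.1 = 2 * t + 1 ∨ a.1 = 2 * t + 2 := by
  obtain ⟨h1, h2, _⟩ := mem_admLists.mp h
  rw [fullWord, List.mem_append, List.mem_singleton] at ha
  rcases ha with ha | rfl
  · rcases mem_word ha with ⟨s, h3, h4, h5⟩ | ⟨c, h3, h4, h5⟩
    · exact ⟨s, by omega, Or.inl h5⟩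
    · exact ⟨c, by omega, Or.inr (by omega)⟩
  · exact ⟨n - 1, by omega, Or.inr (by simp only; omega)⟩

theorem odd_mem_fullWord {n : ℕ} {js : List ℕ} (h : js.length = n) {t : ℕ} (ht : t < n) :
    2 * t + 1 ∈ (fullWord n js).map Prod.fst := by
  suffices H : ∀ t0 i, ∀ s < js.length, 2 * (t0 + s) + 1 ∈ (word t0 i js).map Prod.fst by
    have := H 0 0 t (by omega)
    rw [fullWord, List.map_append, List.mem_append]
    exact Or.inl (by simpa using this)
  clear h
  induction js with
  | nil => intro _ _ _ h; simp at h
  | cons r js ih =>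
    intro t0 i s hs
    rw [word_cons, List.map_append, List.mem_append, block_map_fst]
    cases s with
    | zero => exact Or.inl (by simp)
    | succ s =>
      refine Or.inr ?_
      have := ih (t0 + 1) (i + r) s (by simpa using hs)
      rwa [show t0 + (s + 1) = t0 + 1 + s by ring]

theorem even_mem_fullWord {n : ℕ} {js : List ℕ} (h : js.sum = n - 1) {t : ℕ} (ht : t < n) :
    2 * t + 2 ∈ (fullWord n js).map Prod.fst := by
  rw [fullWord, List.map_append, List.mem_append]
  rcases Nat.lt_or_ge t (n - 1) with h1 | h1
  · left
    suffices H : ∀ t0 i, ∀ s < js.sum, 2 * (i + s) + 2 ∈ (word t0 i js).map Prod.fst by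
      simpa using H 0 0 t (by omega)
    clear h
    induction js with
    | nil => intro _ _ _ h; simp at h
    | cons r js ih =>
      intro t0 i s hs
      rw [word_cons, List.map_append, List.mem_append, block_map_fst]
      rw [List.sum_cons] at hs
      rcases lt_or_ge s r with h2 | h2
      · left
        simp only [List.mem_cons, List.mem_flatMap, List.mem_range]
        exact Or.inr ⟨s, h2, Or.inl (by ring)⟩
      · right
        have := ih (t0 + 1) (i + r) (s - r) (by omega)
        rwa [show i + r + (s - r) = i + s by omega] at this
  · right
    simp
    omega

/-- Every even letter stands between two equal odd letters. -/
def EvenFlanked (U : List (ℕ × Bool)) : Prop :=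
  ∀ A a B, U = A ++ a :: B → Even a.1 →
    ∃ v A' b b' B', Odd v ∧ A = A' ++ [(v, b)] ∧ B = (v, b') :: B'

theorem EvenFlanked.append {U V : List (ℕ × Bool)} (hU : EvenFlanked U) (hV : EvenFlanked V) :
    EvenFlanked (U ++ V) := by
  intro A a B h ha
  rcases List.append_eq_append_iff.mp h with ⟨C, rfl, hC⟩ | ⟨C, rfl, hC⟩
  · obtain ⟨v, A', b, b', B', h1, rfl, h3⟩ := hV C a B hC ha
    exact ⟨v, U ++ A', b, b', B', h1, by simp, h3⟩
  · cases C with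
    | nil =>
      obtain ⟨v, A', b, b', B', h1, h2, h3⟩ := hV [] a B (by simpa using hC.symm) ha
      simp at h2
    | cons c C =>
      obtain ⟨rfl, rfl⟩ := List.cons.inj hC
      obtain ⟨v, A', b, b', B', h1, h2, rfl⟩ := hU A a C rfl ha
      exact ⟨v, A', b, b', B' ++ V, h1, h2, rfl⟩

theorem evenFlanked_blockW {v : ℕ} (hv : Odd v) (w : ℕ → ℕ) (r : ℕ) :
    EvenFlanked (blockW v w r) := by
  -- The flags are irrelevant; with arbitrary ones, an induction over the list of indices goes
  -- through.
  suffices H : ∀ (l : List ℕ) (b : Bool) (g : ℕ → Bool),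
      EvenFlanked ((v, b) :: l.flatMap fun c => [(w c, false), (v, g c)]) from H _ _ _
  intro l
  induction l with
  | nil =>
    intro b g A a B h ha
    cases A with
    | nil =>
      obtain ⟨rfl, _⟩ := List.cons.inj h
      exact absurd ha (Nat.not_even_iff_odd.mpr hv)
    | cons x A => simp at h
  | cons c l ih =>
    intro b g A a B h ha
    rcases A with _ | ⟨x, _ | ⟨y, A⟩⟩
    · obtain ⟨rfl, _⟩ := List.cons.inj h
      exact absurd ha (Nat.not_even_iff_odd.mpr hv)
    · simp only [List.flatMap_cons, List.cons_append, List.nil_append, List.cons.injEq] at h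
      obtain ⟨rfl, rfl, rfl⟩ := h
      exact ⟨v, [], b, _, _, hv, rfl, rfl⟩
    · simp only [List.flatMap_cons, List.cons_append, List.nil_append, List.cons.injEq] at h
      obtain ⟨rfl, rfl, h⟩ := h
      obtain ⟨v', A', b1, b', B', h1, rfl, h3⟩ := ih _ g A a B h ha
      exact ⟨v', _ :: _ :: A', b1, b', B', h1, rfl, h3⟩

theorem evenFlanked_word (t i : ℕ) (js : List ℕ) : EvenFlanked (word t i js) := by
  induction js generalizing t i with
  | nil =>
    intro A a B h
    simp [word_nil] at h
  | cons r js ih =>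
    rw [word_cons]
    exact (evenFlanked_blockW ⟨t, rfl⟩ _ _).append (ih _ _)

/-- A block with positive entry has an even letter in second position, so a run of odd letters
passes only through trivial blocks. Its last letter `a` may start a nontrivial block. -/
theorem odd_prefix {t i n : ℕ} {js : List ℕ} {K W : List (ℕ × Bool)} {a : ℕ × Bool}
    (h : word t i js ++ [(2 * n, false)] = K ++ a :: W) (ho : ∀ x ∈ K ++ [a], Odd x.1) :
    K.length < js.length ∧ js.take K.length = List.replicate K.length 0 := by
  induction K generalizing t i js with
  | nil =>
    cases js with
    | nil =>
      have h1 : (2 * n, false) = a := (List.cons.inj h).1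
      have h2 := ho a (by simp)
      rw [← h1] at h2
      exact absurd (even_two_mul n) (Nat.not_even_iff_odd.mpr h2)
    | cons r js => simp
  | cons b K ih =>
    cases js with
    | nil =>
      have h1 := (List.cons.inj h).2
      simp at h1
    | cons r js =>
      cases r with
      | zero =>
        rw [word_cons] at h
        obtain ⟨_, h1⟩ := List.cons.inj h
        obtain ⟨h2, h3⟩ := ih h1 fun x hx => ho x (by simp at hx ⊢; tauto)
        exact ⟨by simpa using h2, by simpa [List.replicate_succ] using h3⟩
      | succ r =>
        rw [word_cons, block_succ] at h
        obtain ⟨_, h1⟩ := List.cons.inj h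
        exfalso
        have h2 : Odd (2 * (i + 1)) := by
          cases K with
          | nil =>
            have h3 := (List.cons.inj h1).1
            have := ho a (by simp)
            rwa [← h3] at this
          | cons c K =>
            have h3 := (List.cons.inj h1).1
            have := ho c (by simp)
            rwa [← h3] at this
        exact absurd (even_two_mul (i + 1)) (Nat.not_even_iff_odd.mpr h2)

end Parity

/-! ### The projected sum and its nonvanishing terms -/

section PsiSum

variable (k : Type v) [CommRing k] {X Y : SSet.{u}}

/-- `v` is a monotone sequence `v 0 ≤ … ≤ v d ≤ m`. -/
structure IsSeq (d m : ℕ) (v : ℕ → ℕ) : Prop where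
  mono : ∀ i j, i ≤ j → j ≤ d → v i ≤ v j
  le : ∀ i, i ≤ d → v i ≤ m

theorem isSeq_id (m : ℕ) : IsSeq m m fun i => i := ⟨fun _ _ h _ => h, fun _ h => h⟩

/-- The tensor of the faces of `x` and `y` determined by a subdivision. -/
def faceTensor (n : ℕ) {m m' : ℕ} (x : X _⦋m⦌) (y : Y _⦋m'⦌) (ξ η : ℕ → ℕ) (L : List Iv) :
    ⨂[k]^n (Chains k X ⊗[k] Chains k Y) :=
  PiTensorProduct.tprod k fun t : Fin n =>
    vcls k x ((dv (2 * t.val + 1) L).map ξ) ⊗ₜ[k] vcls k y ((dv (2 * t.val + 2) L).map η)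

/-- The value of the projection of `psiHgc` on a pair of simplices obtained from `x` and `y` by
vertex sequences. -/
def psiSum (n : ℕ) {m m' : ℕ} (x : X _⦋m⦌) (y : Y _⦋m'⦌) (ξ η : ℕ → ℕ) (d : ℕ) :
    ⨂[k]^n (Chains k X ⊗[k] Chains k Y) :=
  (-1 : k) ^ (n - 1) • ∑ js ∈ admLists n, ∑ L ∈ cutL (fullWord n js) 0 d,
    (-1 : k) ^ (pe L + po L) • faceTensor k n x y ξ η L

theorem map_psiHgc_cls {Z : SSet.{u}} (f : Z ⟶ X) (g : Z ⟶ Y) {n : ℕ} (hn : 1 ≤ n) {d : ℕ}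
    (z : Z _⦋d⦌) :
    PiTensorProduct.map (fun _ : Fin n => TensorProduct.map (chainMap k f) (chainMap k g))
      (psiHgc k Z n (cls k z)) =
      psiSum k n (f.app _ z) (g.app _ z) (fun i => i) (fun i => i) d := by
  unfold psiHgc psiSum
  rw [LinearMap.smul_apply, map_smul, LinearMap.sum_apply, map_sum, sum_admLists]
  congr 1
  apply Finset.sum_congr rfl
  intro j hj
  rw [intervalCut_cls, map_sum, decorate_surjJ hn hj]
  · apply Finset.sum_congr rfl
    intro L _
    rw [map_smul, PiTensorProduct.map_tprod]
    simp only [TensorProduct.map_tmul, chainMap_vcls, faceTensor, List.map_id']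
  · intro y l hl hy
    have hl' : l ∈ (decorate (surjJ j)).map Prod.fst := by rwa [decorate_map_fst]
    rw [decorate_surjJ hn hj, List.mem_map] at hl'
    obtain ⟨a, ha, rfl⟩ := hl'
    obtain ⟨t, ht, h⟩ := fullWord_lab (Finset.mem_image_of_mem _ hj) hn ha
    apply MultilinearMap.map_coord_zero _ (⟨t, ht⟩ : Fin n)
    rcases h with h | h <;> rw [← h, hy] <;> simp

theorem faceTensor_pull {n : ℕ} {js : List ℕ} (hjs : js ∈ admLists n) {m m' d : ℕ}
    (x : X _⦋m⦌) (y : Y _⦋m'⦌) {ξ η : ℕ → ℕ} (hξ : IsSeq d m ξ) (hη : IsSeq d m' η) {L : List Iv}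
    (hL : L ∈ cutL (fullWord n js) 0 d) :
    faceTensor k n (pull x d ξ) (pull y d η) (fun i => i) (fun i => i) L =
      faceTensor k n x y ξ η L := by
  unfold faceTensor
  congr 1
  funext t
  obtain ⟨h1, h2, _⟩ := mem_admLists.mp hjs
  have hk := map_key_of_mem hL
  rw [List.map_id', List.map_id']
  rw [vcls_pull k x hξ.mono hξ.le (dv_sorted hL _).1 (fun a ha => ((dv_sorted hL _).2 a ha).2),
    vcls_pull k y hη.mono hη.le (dv_sorted hL _).1 (fun a ha => ((dv_sorted hL _).2 a ha).2)]
  -- Every label occurs in the word, so no vertex list is empty, as `vcls_pull` requires.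
  · apply dv_ne_nil
    rw [hk]
    exact even_mem_fullWord h2 t.2
  · apply dv_ne_nil
    rw [hk]
    exact odd_mem_fullWord h1 t.2

theorem psiSum_pull (n : ℕ) {m m' d : ℕ} (x : X _⦋m⦌) (y : Y _⦋m'⦌) {ξ η : ℕ → ℕ}
    (hξ : IsSeq d m ξ) (hη : IsSeq d m' η) :
    psiSum k n (pull x d ξ) (pull y d η) (fun i => i) (fun i => i) d =
      psiSum k n x y ξ η d := by
  unfold psiSum
  congr 1
  refine Finset.sum_congr rfl fun js hjs => Finset.sum_congr rfl fun L hL => ?_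
  rw [faceTensor_pull k hjs x y hξ hη hL]

variable {k}

theorem map_sorted {d m : ℕ} {ξ : ℕ → ℕ} (hξ : IsSeq d m ξ) {l : List ℕ}
    (hl : l.Pairwise (· ≤ ·)) (hb : ∀ a ∈ l, a ≤ d) : (l.map ξ).Pairwise (· ≤ ·) ∧
      ∀ a ∈ l.map ξ, a ≤ m := by
  constructor
  · rw [List.pairwise_map]
    exact hl.imp_of_mem fun {a b} ha hb' h => hξ.mono a b h (hb b hb')
  · simp only [List.mem_map]
    rintro _ ⟨a, ha, rfl⟩
    exact hξ.le a (hb a ha)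

theorem nodup_of_faceTensor_ne_zero {n : ℕ} {m m' d : ℕ} {x : X _⦋m⦌} {y : Y _⦋m'⦌} {ξ η : ℕ → ℕ}
    (hξ : IsSeq d m ξ) (hη : IsSeq d m' η) {U : List (ℕ × Bool)} {L : List Iv}
    (hL : L ∈ cutL U 0 d) (h : faceTensor k n x y ξ η L ≠ 0) :
    ∀ t < n, ((dv (2 * t + 1) L).map ξ).Nodup ∧ ((dv (2 * t + 2) L).map η).Nodup := by
  intro t ht
  have hs := fun j => map_sorted hξ (dv_sorted hL j).1 fun a ha => ((dv_sorted hL j).2 a ha).2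
  have hs' := fun j => map_sorted hη (dv_sorted hL j).1 fun a ha => ((dv_sorted hL j).2 a ha).2
  constructor <;> by_contra hd <;> refine h (MultilinearMap.map_coord_zero _ (⟨t, ht⟩ : Fin n) ?_)
  · simp only
    rw [vcls_eq_zero k x (hs _).1 (hs _).2 hd, TensorProduct.zero_tmul]
  · simp only
    rw [vcls_eq_zero k y (hs' _).1 (hs' _).2 hd, TensorProduct.tmul_zero]

theorem ne_of_nodup {ξ : ℕ → ℕ} {j : ℕ} {L : List Iv} {I : Iv} (hd : ((dv j L).map ξ).Nodup)
    (hI : I ∈ L) (hj : I.lab = j) {a b : ℕ} (ha : I.lo ≤ a) (hab : a < b) (hb : b ≤ I.hi) :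
    ξ a ≠ ξ b := by
  subst hj
  intro h
  have hsub := (verts_sublist_dv hI).subset
  have := List.inj_on_of_nodup_map hd
    (hsub ((Iv.mem_verts (by omega)).mpr ⟨ha, by omega⟩))
    (hsub ((Iv.mem_verts (by omega)).mpr ⟨by omega, hb⟩)) h
  omega

/-- The label `j` contains both endpoints of `J`: one as the end of its left neighbour, the other as
the beginning of its right neighbour. -/
theorem ne_of_nodup_of_flanked {ξ : ℕ → ℕ} {j : ℕ} {A B : List Iv} {I J K : Iv}
    (hd : ((dv j (A ++ I :: J :: K :: B)).map ξ).Nodup) (hI : I.lab = j) (hK : K.lab = j)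
    (hle : I.lo ≤ I.hi) (hIJ : I.hi = J.lo) (hJK : K.lo = J.hi) : ξ J.lo ≠ ξ J.hi := by
  have h : [J.lo, J.hi].Sublist (dv j (A ++ I :: J :: K :: B)) := by
    rw [dv_append, dv_cons, dv_cons, dv_cons, if_pos hI, if_pos hK]
    have h1 : [J.lo].Sublist I.verts := by
      rw [List.singleton_sublist, Iv.mem_verts hle]
      omega
    have h2 : [J.hi].Sublist K.verts := by
      rw [List.singleton_sublist, ← hJK]
      simp [Iv.verts]
    refine List.Sublist.trans ?_ (List.sublist_append_right _ _)
    have h3 := h2.trans (List.sublist_append_left K.verts (dv j B))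
    exact List.Sublist.append h1 (h3.trans (List.sublist_append_right _ _))
  have h2 := hd.sublist (h.map ξ)
  simpa using h2

/-! ### Constraints on nonzero terms along a lattice path -/

section Nonvanishing

variable {n N : ℕ} {js : List ℕ} (hjs : js ∈ admLists n) (hn : 1 ≤ n) {ξ η : ℕ → ℕ} {L : List Iv}
  (hL : L ∈ cutL (fullWord n js) 0 N)
  (hd : ∀ t < n, ((dv (2 * t + 1) L).map ξ).Nodup ∧ ((dv (2 * t + 2) L).map η).Nodup)
  {e : ℕ} (hsh : ∀ i < e, ξ i = ξ (i + 1) ∨ η i = η (i + 1))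

theorem exists_lab {n N : ℕ} {js : List ℕ} (hjs : js ∈ admLists n) (hn : 1 ≤ n) {L : List Iv}
    (hL : L ∈ cutL (fullWord n js) 0 N) {I : Iv} (hI : I ∈ L) :
    ∃ t < n, I.lab = 2 * t + 1 ∨ I.lab = 2 * t + 2 := by
  have : I.key ∈ fullWord n js := by
    rw [← map_key_of_mem hL]
    exact List.mem_map_of_mem hI
  exact fullWord_lab hjs hn this

theorem const_of_steps {ξ : ℕ → ℕ} {a b : ℕ} (hab : a ≤ b)
    (h : ∀ i, a ≤ i → i < b → ξ i = ξ (i + 1)) : ξ a = ξ b := by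
  induction b, hab using Nat.le_induction with
  | base => rfl
  | succ b hb ih => rw [ih fun i h1 h2 => h i h1 (by omega), h b hb (by omega)]

include hjs hn hL hd hsh in
-- Suppose that `J` ends at or before `e`. Its label is even, so every step in it changes `η` and
-- hence, by `hsh`, fixes `ξ`. Then `ξ` agrees at both endpoints of `J`, and the odd letter on
-- either side of `J` repeats a vertex.
theorem lt_hi_of_even {A B : List Iv} {J : Iv} (hs : L = A ++ J :: B) (hB : B ≠ [])
    (hJ : Even J.lab) : e < J.hi := by
  obtain ⟨_, hle, _, hA, hB', hU⟩ := mem_cutL_split hL hs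
  -- The last letter, the only even one without a right neighbour, is removed to apply
  -- `evenFlanked_word`.
  have hw : word 0 0 js = A.map Iv.key ++ J.key :: (B.map Iv.key).dropLast := by
    have := congrArg List.dropLast hU
    rw [fullWord, List.dropLast_concat, List.dropLast_append_of_ne_nil (by simp),
      List.dropLast_cons_of_ne_nil (by simpa using hB)] at this
    exact this
  obtain ⟨v, A', b, b', B', hv, h1, h2⟩ := evenFlanked_word 0 0 js _ _ _ hw hJ
  obtain ⟨A, rfl⟩ | ⟨A, I, rfl⟩ : (∃ A0 : Unit, A = []) ∨ ∃ A0 I, A = A0 ++ [I] := by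
    rcases List.eq_nil_or_concat A with h | ⟨A0, I, h⟩
    · exact Or.inl ⟨(), h⟩
    · exact Or.inr ⟨A0, I, by simpa using h⟩
  · simp at h1
  obtain _ | ⟨K, B⟩ := B
  · exact absurd rfl hB
  rw [List.map_append] at h1
  obtain ⟨_, h3⟩ := List.append_inj' h1 rfl
  have hI : I.lab = v := congrArg (fun l => (l.headD (0, true)).1) h3
  have hK : K.lab = v := by
    obtain _ | ⟨K', B⟩ := B
    · simp at h2
    · rw [List.map_cons, List.map_cons, List.dropLast_cons_cons] at h2
      exact congrArg Prod.fst (List.cons.inj h2).1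
  have hIJ : I.lo ≤ I.hi ∧ I.hi = J.lo := by
    obtain ⟨_, h5, h6, _, h7, _⟩ := mem_cutL_split hA rfl
    exact ⟨h5, (mem_cutL_nil.mp h7).1⟩
  have hJK : K.lo = J.hi := by
    obtain ⟨h5, h6, _, h7, _⟩ := mem_cutL_split (A := []) hB' rfl
    exact (mem_cutL_nil.mp h7).1.symm
  by_contra! hlt
  obtain ⟨t, ht, hlab⟩ := exists_lab hjs hn hL (I := J) (by simp [hs])
  have hlab : J.lab = 2 * t + 2 := by
    rcases hlab with h | h
    · rw [h] at hJ
      exact absurd hJ (by simp)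
    · exact h
  obtain ⟨t', ht', hlab'⟩ := exists_lab hjs hn hL (I := I) (by simp [hs])
  have hlab' : v = 2 * t' + 1 := by
    rw [hI] at hlab'
    rcases hlab' with h | h
    · exact h
    · rw [h] at hv
      obtain ⟨c, hc⟩ := hv
      omega
  have hs' : L = A ++ I :: J :: K :: B := by simp [hs]
  refine ne_of_nodup_of_flanked (ξ := ξ) (j := v) (hs' ▸ hlab' ▸ (hd t' ht').1) hI hK hIJ.1 hIJ.2
    hJK ?_
  apply const_of_steps hle
  intro i h1 h2
  refine (hsh i (by omega)).resolve_right ?_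
  exact ne_of_nodup (hd t ht).2 (I := J) (by simp [hs]) hlab h1 (by omega) (by omega)

include hjs hn hL hd hsh in
-- For larger `n` the word has an even letter besides the last one, and its interval would have to
-- end beyond `N`.
theorem eq_one_of_shuffle (he : e = N) : n = 1 := by
  by_contra hne
  have h1 : 0 < js.sum := by rw [(mem_admLists.mp hjs).2.1]; omega
  obtain ⟨s, r, B, rfl⟩ := exists_replicate_of_sum_pos h1
  have hU := map_key_of_mem hL
  rw [fullWord_split, block_succ] at hU
  rw [List.map_eq_append_iff] at hU
  obtain ⟨A, L', rfl, hA, hL'⟩ := hU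
  obtain _ | ⟨I, _ | ⟨J, B'⟩⟩ := L'
  · simp at hL'
  · simp at hL'
  · simp only [List.map_cons, List.cons_append, List.cons.injEq] at hL'
    have hJ : J.lab = 2 * (0 + 1) := congrArg Prod.fst hL'.2.1
    have hB : B' ≠ [] := by
      rintro rfl
      simp at hL'
    have := lt_hi_of_even hjs hn hL hd hsh (A := A ++ [I]) (J := J) (B := B') (by simp) hB
      (by rw [hJ]; exact even_two_mul _)
    have h2 := (mem_cutL_split (A := A ++ [I]) (I := J) (B := B') hL (by simp)).2.2.1
    omega

variable (he : e < N) (hη : η e = η (e + 1))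

include hjs hn hL hd hsh hη in
-- The interval containing the step `e` is not even, since `η` rests there; an earlier even interval
-- would end at or before `e`, against `lt_hi_of_even`.
theorem odd_prefix_of_step {A B : List Iv} {I : Iv} (hs : L = A ++ I :: B) (h1 : I.lo ≤ e)
    (h2 : e < I.hi) : ∀ J ∈ A ++ [I], Odd J.lab := by
  intro J hJ
  by_contra hev
  rw [Nat.not_odd_iff_even] at hev
  rw [List.mem_append, List.mem_singleton] at hJ
  rcases hJ with hJ | rfl
  · obtain ⟨A1, A2, rfl⟩ := List.append_of_mem hJ
    have := lt_hi_of_even hjs hn hL hd hsh (A := A1) (J := J) (B := A2 ++ I :: B) (by simp [hs])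
      (by simp) hev
    obtain ⟨_, _, _, hA, _⟩ := mem_cutL_split hL hs
    have := (mem_cutL_split hA rfl).2.2.1
    omega
  · obtain ⟨t, ht, hlab⟩ := exists_lab hjs hn hL (I := J) (by simp [hs])
    have hlab : J.lab = 2 * t + 2 := by
      rcases hlab with h | h
      · rw [h] at hev
        exact absurd hev (by simp)
      · exact h
    exact ne_of_nodup (hd t ht).2 (I := J) (by simp [hs]) hlab h1 (by omega) (by omega) hη

include hjs hn hL hd hsh he hη in
-- Up to the step `e` at which `η` rests all intervals are odd, and inside an odd interval each step
-- changes `ξ`.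
theorem step_ne_of_nodup {i : ℕ} (hi : i < e) : ξ i ≠ ξ (i + 1) := by
  obtain ⟨A, I, B, hs, h1, h2⟩ := exists_interval_of_step hL (Nat.zero_le e) he
  have hodd := odd_prefix_of_step hjs hn hL hd hsh hη hs h1 h2
  obtain ⟨_, _, _, hA, _⟩ := mem_cutL_split hL hs
  have key : ∀ J ∈ A ++ [I], J.lo ≤ i → i < J.hi → ξ i ≠ ξ (i + 1) := by
    intro J hJ h3 h4
    have hJL : J ∈ L := by
      rw [hs]
      simp only [List.mem_append, List.mem_cons, List.not_mem_nil, or_false] at hJ ⊢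
      tauto
    obtain ⟨t, ht, hlab⟩ := exists_lab hjs hn hL hJL
    have hlab : J.lab = 2 * t + 1 := by
      rcases hlab with h | h
      · exact h
      · obtain ⟨c, hc⟩ := hodd J hJ
        omega
    exact ne_of_nodup (hd t ht).1 hJL hlab h3 (by omega) (by omega)
  rcases lt_or_ge i I.lo with h3 | h3
  · obtain ⟨A1, J, A2, rfl, h4, h5⟩ := exists_interval_of_step hA (Nat.zero_le i) h3
    exact key J (by simp) h4 h5
  · exact key I (by simp) h3 (by omega)

end Nonvanishing

end PsiSum

/-! ### Reindexing sums over subdivisions -/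

section Reindexing

variable {N : Type*} [AddCommMonoid N]

theorem sum_Icc_split (s d m : ℕ) (hs : s ≤ d) (hm : d < m) (f : ℕ → N) :
    ∑ e ∈ Finset.Icc s m, f e = ∑ e ∈ Finset.Icc s d, f e + ∑ e ∈ Finset.Icc (d + 1) m, f e := by
  rw [← Finset.sum_union]
  · apply Finset.sum_congr _ fun _ _ => rfl
    ext e
    simp only [Finset.mem_union, Finset.mem_Icc]
    omega
  · rw [Finset.disjoint_left]
    intro e
    simp only [Finset.mem_Icc]
    omega

/-- The subdivisions, classified by the interval that contains the step from `d` to `d + 1`. -/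
theorem sum_cutL_step (U : List (ℕ × Bool)) (s d m : ℕ) (hs : s ≤ d) (hm : d < m)
    (g : List Iv → N) :
    ∑ L ∈ cutL U s m, g L =
      ∑ i ∈ Finset.range U.length, ∑ lo ∈ Finset.Icc s d, ∑ hi ∈ Finset.Icc (d + 1) m,
        ∑ A ∈ cutL (U.take i) s lo, ∑ B ∈ cutL (U.drop (i + 1)) hi m,
          g (A ++ ⟨(U.getD i (0, false)).1, (U.getD i (0, false)).2, lo, hi⟩ :: B) := by
  induction U generalizing s g with
  | nil =>
    rw [sum_cutL_nil, if_neg (by omega)]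
    simp
  | cons a U ih =>
    rw [sum_cutL_cons, sum_Icc_split s d m hs hm, List.length_cons, Finset.sum_range_succ']
    congr 1
    · rw [Finset.sum_congr rfl fun e he => ih e (Finset.mem_Icc.mp he).2 _, Finset.sum_comm]
      refine Finset.sum_congr rfl fun i _ => ?_
      simp only [List.take_succ_cons, sum_cutL_cons, List.drop_succ_cons, List.getD_cons_succ,
        List.cons_append]
      rw [Finset.sum_comm' (t' := Finset.Icc s d) (s' := fun lo => Finset.Icc s lo)]
      · refine Finset.sum_congr rfl fun lo _ => ?_
        rw [Finset.sum_comm]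
      · intro e lo
        simp only [Finset.mem_Icc]
        omega
    · symm
      rw [Finset.sum_eq_single_of_mem s (by simp [hs])]
      · simp [sum_cutL_nil]
      · intro lo hlo hne
        simp [sum_cutL_nil, hne.symm]

theorem sum_Icc_succ (p m : ℕ) (hp : p ≤ m) (f : ℕ → N) (h0 : f p = 0) :
    ∑ r ∈ Finset.Icc p m, f r = ∑ q ∈ Finset.range (m - p), f (p + q + 1) := by
  obtain ⟨c, rfl⟩ := Nat.exists_eq_add_of_le hp
  rw [← Finset.Ico_add_one_right_eq_Icc, Finset.sum_Ico_eq_sum_range,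
    show p + c + 1 - p = c + 1 by omega, Finset.sum_range_succ', Nat.add_zero, h0, add_zero,
    Nat.add_sub_cancel_left]
  rfl

theorem sum_Icc_add (c s m : ℕ) (f : ℕ → N) :
    ∑ e ∈ Finset.Icc (s + c) (m + c), f e = ∑ e ∈ Finset.Icc s m, f (e + c) := by
  rw [← Finset.map_add_right_Icc, Finset.sum_map]
  rfl

/-- The substitution `e = lo + a`, `r = p + q + 1`, `h = hi + (a + q)` turns the cut points for the
long word on `[0, m]` into those for the short word on `[0, m - a - q]`. The terms with `r = p` have
no `q`; they are the ones killed by `h0`. -/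
theorem sum_reindex (m : ℕ) (G : ℕ → ℕ → ℕ → ℕ → ℕ → N) 
    (h0 : ∀ a e p h, a ≤ e → e ≤ p → p ≤ h → h ≤ m → G a e p p h = 0) :
    ∑ a ∈ Finset.Icc 0 m, ∑ e ∈ Finset.Icc a m, ∑ p ∈ Finset.Icc e m, ∑ r ∈ Finset.Icc p m,
      ∑ h ∈ Finset.Icc r m, G a e p r h =
    ∑ p ∈ Finset.range m, ∑ q ∈ Finset.range (m - p), ∑ a ∈ Finset.range (p + 1),
      ∑ lo ∈ Finset.Icc 0 (p - a), ∑ hi ∈ Finset.Icc (p - a + 1) (m - a - q),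
        G a (lo + a) p (p + q + 1) (hi + (a + q)) := by
  have h1 : ∀ a ∈ Finset.Icc 0 m, ∑ e ∈ Finset.Icc a m, ∑ p ∈ Finset.Icc e m,
      ∑ r ∈ Finset.Icc p m, ∑ h ∈ Finset.Icc r m, G a e p r h =
      ∑ p ∈ Finset.Icc a m, ∑ lo ∈ Finset.Icc 0 (p - a), ∑ r ∈ Finset.Icc p m,
        ∑ h ∈ Finset.Icc r m, G a (lo + a) p r h := by
    intro a _
    rw [Finset.sum_comm' (t' := Finset.Icc a m) (s' := fun p => Finset.Icc a p)]
    · refine Finset.sum_congr rfl fun p hp => ?_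
      rw [Finset.mem_Icc] at hp
      have := sum_Icc_add a 0 (p - a) fun e => ∑ r ∈ Finset.Icc p m, ∑ h ∈ Finset.Icc r m, G a e p r h
      rw [zero_add, Nat.sub_add_cancel hp.1] at this
      exact this
    · intro e p
      simp only [Finset.mem_Icc]
      omega
  rw [Finset.sum_congr rfl h1,
    Finset.sum_comm' (t' := Finset.range (m + 1)) (s' := fun p => Finset.range (p + 1))]
  · rw [Finset.sum_range_succ]
    -- For `p = m` only `r = p` is possible.
    have hlast : ∑ a ∈ Finset.range (m + 1), ∑ lo ∈ Finset.Icc 0 (m - a), ∑ r ∈ Finset.Icc m m,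
        ∑ h ∈ Finset.Icc r m, G a (lo + a) m r h = 0 := by
      refine Finset.sum_eq_zero fun a ha => Finset.sum_eq_zero fun lo hlo => ?_
      rw [Finset.mem_range] at ha
      rw [Finset.mem_Icc] at hlo
      simp only [Finset.Icc_self, Finset.sum_singleton]
      exact h0 _ _ _ _ (by omega) (by omega) le_rfl le_rfl
    rw [hlast, add_zero]
    refine Finset.sum_congr rfl fun p hp => ?_
    rw [Finset.mem_range] at hp
    rw [Finset.sum_comm (s := Finset.range (m - p))]
    refine Finset.sum_congr rfl fun a ha => ?_
    rw [Finset.mem_range] at ha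
    rw [Finset.sum_comm (s := Finset.range (m - p))]
    refine Finset.sum_congr rfl fun lo hlo => ?_
    rw [Finset.mem_Icc] at hlo
    rw [sum_Icc_succ p m hp.le _ (Finset.sum_eq_zero fun h hh => by
      rw [Finset.mem_Icc] at hh
      exact h0 _ _ _ _ (by omega) (by omega) hh.1 hh.2)]
    refine Finset.sum_congr rfl fun q hq => ?_
    rw [Finset.mem_range] at hq
    rw [← sum_Icc_add (a + q) _ _ fun h => G a (lo + a) p (p + q + 1) h]
    congr 2 <;> omega
  · intro a p
    simp only [Finset.mem_Icc, Finset.mem_range]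
    omega

/-- The subdivision obtained by inserting an initial interval `[0, a]` and an interval
`[p, p + q + 1]` with label `2` into the interval between `A` and `B`. -/
def insertIv (v : ℕ) (b : Bool) (p q a lo hi : ℕ) (A B : List Iv) : List Iv :=
  ⟨1, false, 0, a⟩ :: (A.map (Iv.move (· + 2) a) ++ ⟨v + 2, true, lo + a, p⟩ ::
    ⟨2, false, p, p + q + 1⟩ :: ⟨v + 2, b, p + q + 1, hi + (a + q)⟩ ::
      B.map (Iv.move (· + 2) (a + q)))

/-- `hF` discards the subdivisions whose interval with label `2` is a point. The others are exactly
the `insertIv`, with `A` and `B` translated by `a` and `a + q`. -/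
theorem sum_cutL_insert (V W : List (ℕ × Bool)) (b : Bool) (v m : ℕ) (F : List Iv → N)
    (hF : ∀ a e p h, a ≤ e → e ≤ p → p ≤ h → h ≤ m → ∀ A ∈ cutL (V.map shiftKey) a e,
      ∀ B ∈ cutL (W.map shiftKey) h m, F (⟨1, false, 0, a⟩ :: (A ++ ⟨v + 2, true, e, p⟩ ::
        ⟨2, false, p, p⟩ :: ⟨v + 2, b, p, h⟩ :: B)) = 0) :
    ∑ L ∈ cutL ((1, false) :: (V.map shiftKey ++ (v + 2, true) :: (2, false) :: (v + 2, b) ::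
        W.map shiftKey)) 0 m, F L =
      ∑ p ∈ Finset.range m, ∑ q ∈ Finset.range (m - p), ∑ a ∈ Finset.range (p + 1),
        ∑ lo ∈ Finset.Icc 0 (p - a), ∑ hi ∈ Finset.Icc (p - a + 1) (m - a - q),
          ∑ A ∈ cutL V 0 lo, ∑ B ∈ cutL W hi (m - a - q), F (insertIv v b p q a lo hi A B) := by
  simp only [sum_cutL_cons, sum_cutL_append]
  have hcomm : ∀ a e, ∑ A ∈ cutL (V.map shiftKey) a e, ∑ p ∈ Finset.Icc e m,
      ∑ r ∈ Finset.Icc p m, ∑ h ∈ Finset.Icc r m, ∑ B ∈ cutL (W.map shiftKey) h m,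
        F (⟨1, false, 0, a⟩ :: (A ++ ⟨v + 2, true, e, p⟩ :: ⟨2, false, p, r⟩ ::
          ⟨v + 2, b, r, h⟩ :: B)) =
      ∑ p ∈ Finset.Icc e m, ∑ r ∈ Finset.Icc p m, ∑ h ∈ Finset.Icc r m,
        ∑ A ∈ cutL (V.map shiftKey) a e, ∑ B ∈ cutL (W.map shiftKey) h m,
          F (⟨1, false, 0, a⟩ :: (A ++ ⟨v + 2, true, e, p⟩ :: ⟨2, false, p, r⟩ ::
            ⟨v + 2, b, r, h⟩ :: B)) := by
    intro a e
    rw [Finset.sum_comm]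
    refine Finset.sum_congr rfl fun p _ => ?_
    rw [Finset.sum_comm]
    refine Finset.sum_congr rfl fun r _ => ?_
    rw [Finset.sum_comm]
  simp only [hcomm]
  rw [sum_reindex m (fun a e p r h => ∑ A ∈ cutL (V.map shiftKey) a e,
    ∑ B ∈ cutL (W.map shiftKey) h m, F (⟨1, false, 0, a⟩ :: (A ++ ⟨v + 2, true, e, p⟩ ::
      ⟨2, false, p, r⟩ :: ⟨v + 2, b, r, h⟩ :: B)))]
  · refine Finset.sum_congr rfl fun p hp => Finset.sum_congr rfl fun q hq =>
      Finset.sum_congr rfl fun a ha => Finset.sum_congr rfl fun lo _ =>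
        Finset.sum_congr rfl fun hi _ => ?_
    simp only [Finset.mem_range] at hp hq ha
    have h1 := fun f : List Iv → N => sum_cutL_move (· + 2) a V 0 lo f
    have h2 := fun f : List Iv → N => sum_cutL_move (· + 2) (a + q) W hi (m - a - q) f
    rw [zero_add] at h1
    rw [show m - a - q + (a + q) = m by omega] at h2
    refine (h1 _).trans (Finset.sum_congr rfl fun A _ => ?_)
    exact h2 _
  · intro a e p h h1 h2 h3 h4
    exact Finset.sum_eq_zero fun A hA => Finset.sum_eq_zero fun B hB =>
      hF a e p h h1 h2 h3 h4 A hA B hB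

end Reindexing

/-! ### Effect of an insertion on vertices and signs -/

section Insertion

variable {v p q a lo hi s : ℕ} {b : Bool} {A B : List Iv}

/-- The `x`-coordinates of the path that belongs to an inserted interval. -/
def pathX (p q a : ℕ) (w : ℕ) : ℕ := if w ≤ p - a then a + w else a + q + w

/-- The `y`-coordinates of the path that belongs to an inserted interval. -/
def pathY (p q a : ℕ) (w : ℕ) : ℕ := if w ≤ p - a then p + q + 1 else a + q + w

theorem isSeq_pathX {m : ℕ} (ha : a ≤ p) (hq : p + q < m) :
    IsSeq (m - a - q) m (pathX p q a) := by
  constructor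
  · intro i j hij hj
    unfold pathX
    split_ifs <;> omega
  · intro i hi
    unfold pathX
    split_ifs <;> omega

theorem isSeq_pathY {m : ℕ} (ha : a ≤ p) (hq : p + q < m) :
    IsSeq (m - a - q) m (pathY p q a) := by
  constructor
  · intro i j hij hj
    unfold pathY
    split_ifs <;> omega
  · intro i hi
    unfold pathY
    split_ifs <;> omega

theorem map_range'_of_le {f : ℕ → ℕ} {c lo n : ℕ} (h : ∀ w, lo ≤ w → w < lo + n → f w = w + c) :
    (List.range' lo n).map f = List.range' (lo + c) n := by
  apply List.ext_getElem
  · simp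
  · intro i h1 h2
    simp at h1
    simp only [List.getElem_map, List.getElem_range', one_mul]
    rw [h _ (by omega) (by omega)]
    omega

/-- Right after the index `p - a` the sequence `pathX` jumps from `p` to `p + q + 1`, so an interval
containing this step is mapped onto the two halves around the inserted interval. -/
theorem verts_insert (ha : a ≤ p) (hlo : lo ≤ p - a) (hhi : p - a < hi) :
    (⟨v, b, lo, hi⟩ : Iv).verts.map (pathX p q a) =
      (⟨v + 2, true, lo + a, p⟩ : Iv).verts ++
        (⟨v + 2, b, p + q + 1, hi + (a + q)⟩ : Iv).verts := by
  simp only [Iv.verts]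
  rw [show hi - lo + 1 = (p - a - lo + 1) + (hi - (p - a)) by omega, ← List.range'_append,
    List.map_append]
  congr 1
  · rw [map_range'_of_le (c := a)]
    · congr 1
      omega
    · intro w h1 h2
      rw [pathX, if_pos (by omega), add_comm]
  · rw [map_range'_of_le (c := a + q)]
    · congr 1 <;> omega
    · intro w h1 h2
      rw [pathX, if_neg (by omega)]
      ring

theorem dv_one_insertIv (hA : ∀ I ∈ A, I.lab ≠ 0) (hB : ∀ I ∈ B, I.lab ≠ 0) :
    dv 1 (insertIv v b p q a lo hi A B) = List.range' 0 (a + 1) := by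
  have h : ∀ (c : ℕ) (C : List Iv), (∀ I ∈ C, I.lab ≠ 0) → dv 1 (C.map (Iv.move (· + 2) c)) = [] := by
    intro c C hC
    apply dv_eq_nil
    intro J hJ
    obtain ⟨I, hI, rfl⟩ := List.mem_map.mp hJ
    have := hC I hI
    simp only [Iv.move]
    omega
  simp [insertIv, dv_cons, dv_append, h a A hA, h (a + q) B hB, Iv.verts]

theorem dv_two_insertIv (hv : v ≠ 0) (hA : ∀ I ∈ A, I.lab ≠ 0) (hB : ∀ I ∈ B, I.lab ≠ 0) :
    dv 2 (insertIv v b p q a lo hi A B) = List.range' p (q + 2) := by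
  have h : ∀ (c : ℕ) (C : List Iv), (∀ I ∈ C, I.lab ≠ 0) → dv 2 (C.map (Iv.move (· + 2) c)) = [] := by
    intro c C hC
    apply dv_eq_nil
    intro J hJ
    obtain ⟨I, hI, rfl⟩ := List.mem_map.mp hJ
    have := hC I hI
    simp only [Iv.move]
    omega
  simp [insertIv, dv_cons, dv_append, h a A hA, h (a + q) B hB, hv, Iv.verts,
    show p + q + 1 - p = q + 1 by omega]

theorem dv_insertIv {j : ℕ} (hj : 1 ≤ j) :
    dv (j + 2) (insertIv v b p q a lo hi A B) = (dv j A).map (· + a) ++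
      ((if v = j then (⟨v + 2, true, lo + a, p⟩ : Iv).verts ++
        (⟨v + 2, b, p + q + 1, hi + (a + q)⟩ : Iv).verts else []) ++
          (dv j B).map (· + (a + q))) := by
  have h : ∀ (c : ℕ) (C : List Iv), dv (j + 2) (C.map (Iv.move (· + 2) c)) = (dv j C).map (· + c) :=
    fun c C => dv_move c j fun I _ => by omega
  have hj0 : j ≠ 0 := by omega
  simp only [insertIv, dv_cons, dv_append, h]
  by_cases hv : v = j
  · simp [hv, hj0]
  · simp [hv, hj0]

theorem dv_insertIv_pathX {U V : List (ℕ × Bool)} {N : ℕ} (ha : a ≤ p) (hlo : lo ≤ p - a)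
    (hhi : p - a < hi) (hA : A ∈ cutL U 0 lo) (hB : B ∈ cutL V hi N) {j : ℕ} (hj : 1 ≤ j) :
    dv (j + 2) (insertIv v b p q a lo hi A B) =
      (dv j (A ++ ⟨v, b, lo, hi⟩ :: B)).map (pathX p q a) := by
  rw [dv_insertIv hj, dv_append, dv_cons, List.map_append, List.map_append]
  congr 1
  · apply List.map_congr_left
    intro w hw
    have := (dv_sorted hA j).2 w hw
    rw [pathX, if_pos (by omega), add_comm]
  · congr 1
    · split_ifs
      · rw [verts_insert ha hlo hhi]
      · rfl
    · apply List.map_congr_left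
      intro w hw
      have := (dv_sorted hB j).2 w hw
      rw [pathX, if_neg (by omega), add_comm]

/-- The label `j` occurs only in `B`, where `pathY` is the translation by `a + q`; the constant part
of `pathY` plays no role. -/
theorem dv_insertIv_pathY {V : List (ℕ × Bool)} {N : ℕ}
    (hhi : p - a < hi) (hB : B ∈ cutL V hi N) {j : ℕ} (hj : 1 ≤ j) (hAj : ∀ I ∈ A, I.lab ≠ j)
    (hvj : v ≠ j) :
    dv (j + 2) (insertIv v b p q a lo hi A B) =
      (dv j (A ++ ⟨v, b, lo, hi⟩ :: B)).map (pathY p q a) := by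
  rw [dv_insertIv hj, dv_append, dv_cons, dv_eq_nil hAj, if_neg hvj, if_neg hvj]
  simp only [List.map_nil, List.nil_append]
  apply List.map_congr_left
  intro w hw
  have := (dv_sorted hB j).2 w hw
  rw [pathY, if_neg (by omega), add_comm]

theorem sum_len_of_final {U : List (ℕ × Bool)} {s m : ℕ} {L : List Iv} (h : L ∈ cutL U s m)
    (hf : ∀ I ∈ L, I.inner = false) : (L.map Iv.len).sum = m - s := by
  induction U generalizing s L with
  | nil =>
    obtain ⟨rfl, rfl⟩ := mem_cutL_nil.mp h
    simp
  | cons a U ih =>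
    obtain ⟨e, h1, h2, L', hL', rfl⟩ := mem_cutL_cons.mp h
    have h3 := hf _ List.mem_cons_self
    simp only at h3
    rw [List.map_cons, List.sum_cons, ih hL' fun I hI => hf I (List.mem_cons_of_mem _ hI)]
    simp [Iv.len, h3]
    omega

theorem po_eq_zero_of_final {L : List Iv} (hf : ∀ I ∈ L, I.inner = false) : po L = 0 := by
  simp only [po, List.sum_eq_zero_iff, List.mem_map]
  rintro _ ⟨I, hI, rfl⟩
  simp [hf I hI]

/-- The labels in `A` are at most `v`, so neither the old interval `I` nor its halves `X`, `Z` are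
inverted with them. The only new inversions are those with `Y`, whose label `2` lies below all
shifted labels. -/
theorem crossInv_insert {c v : ℕ} {X Y Z I : Iv} (hX : X.lab = v + 2) (hY : Y.lab = 2)
    (hZ : Z.lab = v + 2) (hI : I.lab = v) {r : ℕ → ℕ} (hr : r = (· + 2)) {a : ℕ} {A B : List Iv}
    (hA : ∀ J ∈ A, 1 ≤ J.lab ∧ J.lab ≤ v) :
    crossInv (A.map (Iv.move r a)) (X :: Y :: Z :: B.map (Iv.move r c)) =
      crossInv A (I :: B) + (A.map Iv.len).sum * Y.len := by
  subst hr
  induction A with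
  | nil => simp [crossInv]
  | cons J A ih =>
    rw [List.map_cons, crossInv_cons, crossInv_cons, ih fun K hK => hA K (by simp [hK]),
      List.map_cons, List.sum_cons, Iv.len_move]
    have h := hA J (by simp)
    have h1 : lenBelow (Iv.move (· + 2) a J).lab (X :: Y :: Z :: B.map (Iv.move (· + 2) c)) =
        Y.len + lenBelow J.lab (I :: B) := by
      simp only [lenBelow_cons, hX, hY, hZ, hI]
      have hJ : (Iv.move (· + 2) a J).lab = J.lab + 2 := rfl
      simp only [hJ]
      rw [lenBelow_move c J.lab fun K _ => by omega, if_neg (by omega), if_pos (by omega),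
        if_neg (by omega), if_neg (by omega)]
      ring
    rw [h1]
    ring

/-- The lengths of the two halves add up to that of the split interval, so old inversions are
unchanged. The new interval with label `2` has length `q + 1` and is inverted with `A` (length `lo`)
and the left half (length `p - a - lo + 1`), which gives `(q + 1) * (p - a + 1)`. The left half is a
new inner interval ending at `p`, and the right endpoints of all other inner intervals move by `a +
q`, as `A` contains none. -/
theorem sign_insertIv {U : List (ℕ × Bool)} (ha : a ≤ p) (hlo : lo ≤ p - a)
    (hhi : p - a < hi) (hA : A ∈ cutL U 0 lo) (hAf : ∀ I ∈ A, I.inner = false)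
    (hAl : ∀ J ∈ A, 1 ≤ J.lab ∧ J.lab ≤ v) (hv : 1 ≤ v) (hB : ∀ J ∈ B, 1 ≤ J.lab) :
    pe (insertIv v b p q a lo hi A B) + po (insertIv v b p q a lo hi A B) =
      pe (A ++ ⟨v, b, lo, hi⟩ :: B) + po (A ++ ⟨v, b, lo, hi⟩ :: B) +
        ((q + 1) * (p - a + 1) + p +
          (a + q) * ((A ++ ⟨v, b, lo, hi⟩ :: B).map Iv.key).countP (·.2)) := by
  have hmono : ∀ C : List Iv, ∀ I ∈ C, ∀ J ∈ C, (I.lab + 2 < J.lab + 2 ↔ I.lab < J.lab) :=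
    fun C I _ J _ => by omega
  have hlow : ∀ (c j : ℕ) (C : List Iv), (∀ J ∈ C, 1 ≤ J.lab) → j ≤ 3 →
      lenBelow j (C.map (Iv.move (· + 2) c)) = 0 := by
    intro c j C hC hj
    apply lenBelow_eq_zero
    intro I hI
    obtain ⟨J, hJ, rfl⟩ := List.mem_map.mp hI
    have := hC J hJ
    simp only [Iv.move]
    omega
  have hAf' : ∀ I ∈ A.map (Iv.move (· + 2) a), I.inner = false := by
    intro I hI
    obtain ⟨J, hJ, rfl⟩ := List.mem_map.mp hI
    exact hAf J hJ
  have hcA : (A.map Iv.key).countP (·.2) = 0 := by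
    rw [List.countP_eq_zero]
    intro x hx
    obtain ⟨J, hJ, rfl⟩ := List.mem_map.mp hx
    simp [Iv.key, hAf J hJ]
  have hsum := sum_len_of_final hA hAf
  have hcross := crossInv_insert (c := a + q) (X := ⟨v + 2, true, lo + a, p⟩)
    (Y := ⟨2, false, p, p + q + 1⟩) (Z := ⟨v + 2, b, p + q + 1, hi + (a + q)⟩)
    (I := ⟨v, b, lo, hi⟩) rfl rfl rfl rfl rfl (a := a) (A := A) (B := B) hAl
  rw [insertIv, pe_cons, po_cons, pe_append, po_append, hcross, pe_append (A := A),
    po_append (A := A), pe_move a (hmono A), po_eq_zero_of_final hAf, po_eq_zero_of_final hAf', hsum,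
    List.map_append, List.countP_append, hcA]
  simp only [pe_cons, po_cons, lenBelow_append, lenBelow_cons, List.map_cons, List.countP_cons]
  rw [hlow a 1 A (fun J hJ => (hAl J hJ).1) (by omega), hlow _ 1 B hB (by omega),
    hlow _ 2 B hB (by omega), lenBelow_move (a + q) v (fun I _ => by omega),
    pe_move (a + q) (hmono B), po_move]
  obtain ⟨d, rfl⟩ := Nat.exists_eq_add_of_le ha
  rw [Nat.add_sub_cancel_left] at hlo hhi
  obtain ⟨x, rfl⟩ := Nat.exists_eq_add_of_le hlo
  obtain ⟨y, rfl⟩ := Nat.exists_eq_add_of_lt hhi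
  simp only [Iv.len, Iv.key]
  have e1 : lo + x + y + 1 + (a + q) - (a + (lo + x) + q + 1) = y := by omega
  have e2 : a + (lo + x) - (lo + a) = x := by omega
  have e3 : a + (lo + x) + q + 1 - (a + (lo + x)) = q + 1 := by omega
  have e4 : lo + x + y + 1 - lo = x + y + 1 := by omega
  have e5 : a + (lo + x) - a = lo + x := by omega
  rw [e1, e2, e3, e4, e5]
  have n1 : ¬ (v + 2 < 1) := by omega
  have n2 : ¬ (2 < 1) := by omega
  have n3 : 2 < v + 2 := by omega
  have n4 : ¬ (v + 2 < v + 2) := by omega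
  have n5 : ¬ (v + 2 < 2) := by omega
  simp only [n1, n2, n3, n4, n5, if_true, if_false]
  cases b <;> simp <;> ring

theorem countP_blockW (v : ℕ) (w : ℕ → ℕ) (r : ℕ) : (blockW v w r).countP (·.2) = r := by
  induction r generalizing w with
  | zero => simp [blockW]
  | succ r ih =>
    rw [blockW_succ, List.countP_cons, List.countP_cons, ih]
    simp

theorem countP_fullWord (n : ℕ) (js : List ℕ) : (fullWord n js).countP (·.2) = js.sum := by
  have : ∀ t i, (word t i js).countP (·.2) = js.sum := by
    induction js with
    | nil => intro _ _; rfl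
    | cons r js ih =>
      intro t i
      rw [word_cons, List.countP_append, ih, block, countP_blockW, List.sum_cons]
  simp [fullWord, this]

end Insertion

/-! ### Prepending a tensor factor -/

section ConsTensor

variable (k : Type v) [CommRing k] {M : Type*} [AddCommGroup M] [Module k M]

/-- The map `T ↦ c ⊗ T`. -/
def consT (n : ℕ) (c : M) : ⨂[k]^n M →ₗ[k] ⨂[k]^(n + 1) M :=
  (TensorPower.cast k M (show 1 + n = n + 1 by omega)).toLinearMap ∘ₗ
    TensorPower.mulEquiv.toLinearMap ∘ₗ
      TensorProduct.mk k _ _ (PiTensorProduct.tprod k fun _ : Fin 1 => c)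

theorem consT_tprod (n : ℕ) (c : M) (f : Fin n → M) :
    consT k n c (PiTensorProduct.tprod k f) =
      PiTensorProduct.tprod k (Fin.cons c f : Fin (n + 1) → M) := by
  have h : consT k n c (PiTensorProduct.tprod k f) =
      TensorPower.cast k M (show 1 + n = n + 1 by omega)
        (TensorPower.mulEquiv ((PiTensorProduct.tprod k fun _ : Fin 1 => c) ⊗ₜ[k]
          PiTensorProduct.tprod k f)) := rfl
  rw [h]
  have h2 := TensorPower.tprod_mul_tprod k (fun _ : Fin 1 => c) f
  rw [TensorPower.gMul_def] at h2
  rw [h2, TensorPower.cast_tprod]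
  congr 1
  funext i
  refine Fin.cases ?_ (fun i => ?_) i
  · have : Fin.cast (show n + 1 = 1 + n by omega) 0 = Fin.castAdd n (0 : Fin 1) := rfl
    simp only [Function.comp, this, Fin.append_left, Fin.cons_zero]
  · have : Fin.cast (show n + 1 = 1 + n by omega) i.succ = Fin.natAdd 1 i :=
      Fin.ext (by simp; omega)
    simp only [Function.comp, this, Fin.append_right, Fin.cons_succ]

end ConsTensor

/-! ### The recursion for the interval cuts -/

section Recursion

variable {n s : ℕ} {js : List ℕ}

theorem mem_word_of_zeros {t i : ℕ} {z : List ℕ} (hz : ∀ r ∈ z, r = 0) {a : ℕ × Bool}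
    (h : a ∈ word t i z) : a.2 = false ∧ ∃ r < t + z.length, a.1 = 2 * r + 1 := by
  induction z generalizing t i with
  | nil => simp [word_nil] at h
  | cons r z ih =>
    have h0 : r = 0 := hz r (by simp)
    subst h0
    rw [word_cons, List.mem_append] at h
    rw [List.length_cons]
    rcases h with h | h
    · simp [block, blockW] at h
      exact ⟨by rw [h], t, by omega, by rw [h]⟩
    · obtain ⟨h1, r, h2, h3⟩ := ih (fun r hr => hz r (by simp [hr])) h
      exact ⟨h1, r, by omega, h3⟩

theorem mem_oddLetters {t s : ℕ} {a : ℕ × Bool} (h : a ∈ oddLetters t s) :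
    a.2 = false ∧ ∃ r < t + s, a.1 = 2 * r + 1 := by
  simpa using mem_word_of_zeros (fun r hr => (List.mem_replicate.mp hr).2) h

theorem length_oddLetters (t s : ℕ) : (oddLetters t s).length = s := by
  suffices H : ∀ t i, (word t i (List.replicate s 0)).length = s from H t 0
  induction s with
  | zero => intro _ _; rfl
  | succ s ih =>
    intro t i
    rw [List.replicate_succ, word_cons, List.length_append, ih]
    simp [block, blockW]
    ring

theorem fullWord_at_zeros (hs : s ∈ zerosAt n js) (hn : js.length = n) :
    s < (fullWord n js).length ∧ (fullWord n js).take s = oddLetters 0 s ∧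
      ((fullWord n js).getD s (0, false)).1 = 2 * s + 1 := by
  rw [eq_of_mem_zerosAt hs hn, fullWord_split]
  refine ⟨?_, ?_, ?_⟩
  · simp [length_oddLetters, block, blockW]
  · rw [List.take_append_of_le_length (by rw [length_oddLetters]),
      List.take_of_length_le (by rw [length_oddLetters])]
  · rw [List.getD_append_right _ _ _ _ (by rw [length_oddLetters]), length_oddLetters, Nat.sub_self]
    rfl

theorem fullWord_insertIdx (hs : s ∈ zerosAt n js) (hn : js.length = n) :
    fullWord (n + 1) (insertIdx s js) =
      (1, false) :: (((fullWord n js).take s).map shiftKey ++ (2 * s + 1 + 2, true) :: (2, false) ::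
        (2 * s + 1 + 2, ((fullWord n js).getD s (0, false)).2) ::
          ((fullWord n js).drop (s + 1)).map shiftKey) := by
  obtain ⟨h1, h2, h3⟩ := fullWord_at_zeros hs hn
  have h4 : fullWord n js = oddLetters 0 s ++
      (fullWord n js).getD s (0, false) :: (fullWord n js).drop (s + 1) := by
    rw [← h2, List.getD_eq_getElem _ _ h1, List.cons_getElem_drop_succ, List.take_append_drop]
  have h5 : block s 0 (js.getD s 0) ++ word (s + 1) (js.getD s 0) (js.drop (s + 1)) ++
      [(2 * n, false)] = (fullWord n js).getD s (0, false) :: (fullWord n js).drop (s + 1) := by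
    have h6 := fullWord_split n s (js.getD s 0) (js.drop (s + 1))
    rw [← eq_of_mem_zerosAt hs hn] at h6
    rw [h6] at h4
    have h7 := List.append_cancel_left h4
    rwa [← h6] at h7
  rw [insertIdx, fullWord_insert, h5, h2, List.map_cons, shiftKey, h3]

variable (k : Type v) [CommRing k] {X Y : SSet.{u}}

/-- `pathY` also takes the value `p + q + 1` at the index `p - a + 1`, so `y` rests while `pathX`
jumps. -/
theorem pathY_const {p q a : ℕ} {w : ℕ} (ha : a ≤ p) (hw : w ≤ p - a) :
    pathY p q a w = pathY p q a (w + 1) := by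
  unfold pathY
  split_ifs <;> omega

/-- The path has constant `y`-coordinate through the step from `p - a` to `p - a + 1`. In a nonzero
term all letters up to the interval containing this step are therefore odd, and by `odd_prefix` the
position of that interval lies in `zerosAt`. -/
theorem sum_step_zerosAt (hjs : js ∈ admLists (n + 1)) {m p q a : ℕ} (ha : a ≤ p) (hq : p + q < m)
    (x : X _⦋m⦌) (y : Y _⦋m⦌) (c : ℕ → k) :
    ∑ L ∈ cutL (fullWord (n + 1) js) 0 (m - a - q),
        c (pe L + po L) • faceTensor k (n + 1) x y (pathX p q a) (pathY p q a) L =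
      ∑ s ∈ zerosAt (n + 1) js, ∑ lo ∈ Finset.Icc 0 (p - a),
        ∑ hi ∈ Finset.Icc (p - a + 1) (m - a - q),
        ∑ A ∈ cutL ((fullWord (n + 1) js).take s) 0 lo,
        ∑ B ∈ cutL ((fullWord (n + 1) js).drop (s + 1)) hi (m - a - q),
          let L := A ++ ⟨2 * s + 1, ((fullWord (n + 1) js).getD s (0, false)).2, lo, hi⟩ :: B
          c (pe L + po L) • faceTensor k (n + 1) x y (pathX p q a) (pathY p q a) L := by
  have hlen := (mem_admLists.mp hjs).1
  rw [sum_cutL_step _ _ (p - a) _ (Nat.zero_le _) (by omega)]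
  symm
  have hsub : zerosAt (n + 1) js ⊆ Finset.range (fullWord (n + 1) js).length := by
    intro s hs
    rw [Finset.mem_range]
    exact (fullWord_at_zeros hs hlen).1
  have hcongr : ∀ s ∈ zerosAt (n + 1) js, ((fullWord (n + 1) js).getD s (0, false)).1 = 2 * s + 1 :=
    fun s hs => (fullWord_at_zeros hs hlen).2.2
  rw [← Finset.sum_subset hsub]
  · refine Finset.sum_congr rfl fun s hs => ?_
    simp only [hcongr s hs]
  -- Positions outside `zerosAt` contribute nothing.
  · intro i hi hne
    rw [Finset.mem_range] at hi
    refine Finset.sum_eq_zero fun lo hlo => Finset.sum_eq_zero fun h hh =>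
      Finset.sum_eq_zero fun A hA => Finset.sum_eq_zero fun B hB => ?_
    rw [Finset.mem_Icc] at hlo hh
    by_contra hnz
    have hnz' := right_ne_zero_of_smul hnz
    set I : Iv := ⟨((fullWord (n + 1) js).getD i (0, false)).1,
      ((fullWord (n + 1) js).getD i (0, false)).2, lo, h⟩
    have hU : fullWord (n + 1) js = (fullWord (n + 1) js).take i ++
        (fullWord (n + 1) js).getD i (0, false) :: (fullWord (n + 1) js).drop (i + 1) := by
      rw [List.getD_eq_getElem _ _ hi, List.cons_getElem_drop_succ, List.take_append_drop]
    have hL : A ++ I :: B ∈ cutL (fullWord (n + 1) js) 0 (m - a - q) := by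
      rw [hU, mem_cutL_append]
      exact ⟨lo, by omega, by omega, A, hA, I :: B,
        mem_cutL_cons.mpr ⟨h, by omega, by omega, B, hB, rfl⟩, rfl⟩
    have hd := nodup_of_faceTensor_ne_zero (isSeq_pathX ha hq) (isSeq_pathY ha hq) hL hnz'
    have hodd := odd_prefix_of_step hjs (by omega) hL hd (e := p - a)
      (fun i hi => Or.inr (pathY_const ha hi.le)) (pathY_const ha le_rfl) rfl hlo.2 hh.1
    have hkey : word 0 0 js ++ [(2 * (n + 1), false)] = A.map Iv.key ++ I.key :: B.map Iv.key := by
      have := map_key_of_mem hL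
      rw [List.map_append, List.map_cons] at this
      exact this.symm
    have hp := odd_prefix hkey (by
      intro z hz
      rw [List.mem_append, List.mem_singleton] at hz
      rcases hz with hz | rfl
      · obtain ⟨J, hJ, rfl⟩ := List.mem_map.mp hz
        exact hodd J (by simp [hJ])
      · exact hodd I (by simp))
    have hlA : (A.map Iv.key).length = i := by
      rw [map_key_of_mem hA, List.length_take]
      omega
    rw [hlA] at hp
    apply hne
    simp only [zerosAt, Finset.mem_filter, Finset.mem_range]
    exact ⟨by omega, hp.2⟩

theorem faceTensor_insertIv (hjs : js ∈ admLists (n + 1)) (hs : s ∈ zerosAt (n + 1) js)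
    {m p q a lo hi : ℕ} (ha : a ≤ p) (hlo : lo ≤ p - a) (hhi : p - a < hi)
    {A B : List Iv} (hA : A ∈ cutL ((fullWord (n + 1) js).take s) 0 lo)
    (hB : B ∈ cutL ((fullWord (n + 1) js).drop (s + 1)) hi (m - a - q)) {b : Bool}
    (hb : b = ((fullWord (n + 1) js).getD s (0, false)).2)
    (x : X _⦋m⦌) (y : Y _⦋m⦌) :
    let L := A ++ ⟨2 * s + 1, b, lo, hi⟩ :: B
    let L' := insertIv (2 * s + 1) b p q a lo hi A B
    faceTensor k (n + 2) x y (fun i => i) (fun i => i) L' =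
      consT k (n + 1) (vcls k x (List.range' 0 (a + 1)) ⊗ₜ[k] vcls k y (List.range' p (q + 2)))
        (faceTensor k (n + 1) x y (pathX p q a) (pathY p q a) L) ∧
    pe L' + po L' = pe L + po L + ((q + 1) * (p - a + 1) + p + (a + q) * n) := by
  intro L L'
  obtain ⟨hlen, hsum, _⟩ := mem_admLists.mp hjs
  obtain ⟨h1, h2, h3⟩ := fullWord_at_zeros hs hlen
  have hAk : ∀ I ∈ A, I.inner = false ∧ ∃ r < s, I.lab = 2 * r + 1 := by
    intro I hI
    have : I.key ∈ oddLetters 0 s := by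
      rw [← h2, ← map_key_of_mem hA]
      exact List.mem_map_of_mem hI
    have := mem_oddLetters this
    simpa [Iv.key] using this
  have hBk : ∀ I ∈ B, 1 ≤ I.lab := by
    intro I hI
    have : I.key ∈ fullWord (n + 1) js := by
      refine List.mem_of_mem_drop (i := s + 1) ?_
      rw [← map_key_of_mem hB]
      exact List.mem_map_of_mem hI
    obtain ⟨t, _, h⟩ := fullWord_lab hjs (by omega) this
    simp only [Iv.key] at h
    omega
  have hA0 : ∀ I ∈ A, I.lab ≠ 0 := fun I hI => by
    obtain ⟨_, r, _, h⟩ := hAk I hI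
    omega
  have hB0 : ∀ I ∈ B, I.lab ≠ 0 := fun I hI => by
    have := hBk I hI
    omega
  constructor
  · unfold faceTensor
    rw [consT_tprod]
    congr 1
    funext t
    refine Fin.cases ?_ (fun t => ?_) t
    · simp only [Fin.val_zero, mul_zero, zero_add, Fin.cons_zero, List.map_id']
      rw [dv_one_insertIv hA0 hB0, dv_two_insertIv (by omega) hA0 hB0]
    · simp only [Fin.val_succ, Fin.cons_succ, List.map_id']
      rw [show 2 * (t.val + 1) + 1 = 2 * t.val + 1 + 2 by ring,
        show 2 * (t.val + 1) + 2 = 2 * t.val + 2 + 2 by ring,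
        dv_insertIv_pathX ha hlo hhi hA hB (by omega),
        dv_insertIv_pathY hhi hB (by omega) _ (by omega)]
      intro I hI
      obtain ⟨_, r, _, h⟩ := hAk I hI
      omega
  · have hk : (L.map Iv.key).countP (·.2) = n := by
      have : L.map Iv.key = fullWord (n + 1) js := by
        rw [List.map_append, List.map_cons, map_key_of_mem hA, map_key_of_mem hB]
        have hI : Iv.key ⟨2 * s + 1, b, lo, hi⟩ = (fullWord (n + 1) js).getD s (0, false) := by
          rw [Iv.key, hb, ← h3]
        rw [hI, List.getD_eq_getElem _ _ h1, List.cons_getElem_drop_succ, List.take_append_drop]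
      rw [this, countP_fullWord, hsum]
      omega
    have := sign_insertIv (v := 2 * s + 1) (b := b) (p := p) (q := q) (a := a) ha hlo hhi hA
      (fun I hI => (hAk I hI).1) (fun I hI => by
        obtain ⟨_, r, _, h⟩ := hAk I hI
        omega) (by omega) hBk
    rw [hk] at this
    exact this

theorem sum_comm_three {ι : Type*} {N : Type*} [AddCommMonoid N] (S : Finset ι) (P : Finset ℕ)
    (Q A : ℕ → Finset ℕ) (F : ι → ℕ → ℕ → ℕ → N) :
    ∑ i ∈ S, ∑ p ∈ P, ∑ q ∈ Q p, ∑ a ∈ A p, F i p q a =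
      ∑ p ∈ P, ∑ q ∈ Q p, ∑ a ∈ A p, ∑ i ∈ S, F i p q a := by
  rw [Finset.sum_comm]
  refine Finset.sum_congr rfl fun p _ => ?_
  rw [Finset.sum_comm]
  refine Finset.sum_congr rfl fun q _ => ?_
  rw [Finset.sum_comm]

/-- This mirrors the surviving part of the recursion for `gm`. The summand `1` in the exponent is
the quotient of the global signs `(-1)^(n+1)` and `(-1)^n`; the rest is the exponent from
`faceTensor_insertIv`, where `n` is the number of inner intervals of the shorter word. -/
theorem psiSum_succ (n : ℕ) {m : ℕ} (x : X _⦋m⦌) (y : Y _⦋m⦌) :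
    psiSum k (n + 2) x y (fun i => i) (fun i => i) m =
      ∑ p ∈ Finset.range m, ∑ q ∈ Finset.range (m - p), ∑ a ∈ Finset.range (p + 1),
        (-1 : k) ^ (1 + ((q + 1) * (p - a + 1) + p + (a + q) * n)) •
          consT k (n + 1)
            (vcls k x (List.range' 0 (a + 1)) ⊗ₜ[k] vcls k y (List.range' p (q + 2)))
            (psiSum k (n + 1) x y (pathX p q a) (pathY p q a) (m - a - q)) := by
  have key : ∀ js ∈ admLists (n + 1), ∀ s ∈ zerosAt (n + 1) js,
      ∑ L ∈ cutL (fullWord (n + 2) (insertIdx s js)) 0 m,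
        (-1 : k) ^ (pe L + po L) • faceTensor k (n + 2) x y (fun i => i) (fun i => i) L =
      ∑ p ∈ Finset.range m, ∑ q ∈ Finset.range (m - p), ∑ a ∈ Finset.range (p + 1),
        ∑ lo ∈ Finset.Icc 0 (p - a), ∑ hi ∈ Finset.Icc (p - a + 1) (m - a - q),
        ∑ A ∈ cutL ((fullWord (n + 1) js).take s) 0 lo,
        ∑ B ∈ cutL ((fullWord (n + 1) js).drop (s + 1)) hi (m - a - q),
          let L := A ++ ⟨2 * s + 1, ((fullWord (n + 1) js).getD s (0, false)).2, lo, hi⟩ :: B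
          (-1 : k) ^ ((q + 1) * (p - a + 1) + p + (a + q) * n) •
            consT k (n + 1)
              (vcls k x (List.range' 0 (a + 1)) ⊗ₜ[k] vcls k y (List.range' p (q + 2)))
              ((-1 : k) ^ (pe L + po L) •
                faceTensor k (n + 1) x y (pathX p q a) (pathY p q a) L) := by
    intro js hjs s hs
    have hlen := (mem_admLists.mp hjs).1
    have hU := fullWord_insertIdx hs hlen
    rw [hU, sum_cutL_insert]
    · refine Finset.sum_congr rfl fun p hp => Finset.sum_congr rfl fun q hq =>
        Finset.sum_congr rfl fun a ha => Finset.sum_congr rfl fun lo hlo =>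
          Finset.sum_congr rfl fun hi hhi => Finset.sum_congr rfl fun A hA =>
            Finset.sum_congr rfl fun B hB => ?_
      simp only [Finset.mem_range, Finset.mem_Icc] at hp hq ha hlo hhi
      obtain ⟨h1, h2⟩ := faceTensor_insertIv k hjs hs (m := m) (p := p) (q := q) (a := a) (lo := lo)
        (hi := hi) (by omega) hlo.2 (by omega) hA hB rfl x y
      dsimp only at h1 h2 ⊢
      rw [h1, h2, pow_add, map_smul, smul_smul, mul_comm]
    -- If the interval with label `2` is the point `p`, its two neighbours, which have the same odd
    -- label, both contain `p`, and that piece is degenerate.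
    · intro a e p h h1 h2 h3 h4 A hA B hB
      have hadm : insertIdx s js ∈ admLists (n + 2) := by
        have h0 := hjs
        rw [eq_of_mem_zerosAt hs hlen, mem_admLists_split] at h0
        have : insertIdx s js = List.replicate (s + 1) 0 ++ (js.getD s 0 + 1) :: js.drop (s + 1) :=
          rfl
        rw [this, mem_admLists_split]
        refine ⟨by omega, by omega, fun e he => ?_⟩
        have := h0.2.2 e he
        omega
      set b := ((fullWord (n + 1) js).getD s (0, false)).2
      have hL : ⟨1, false, 0, a⟩ :: (A ++ ⟨2 * s + 1 + 2, true, e, p⟩ :: ⟨2, false, p, p⟩ ::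
          ⟨2 * s + 1 + 2, b, p, h⟩ :: B) ∈ cutL (fullWord (n + 2) (insertIdx s js)) 0 m := by
        rw [hU]
        refine mem_cutL_cons.mpr ⟨a, by omega, by omega, _, ?_, rfl⟩
        refine mem_cutL_append.mpr ⟨e, h1, by omega, A, hA, _, ?_, rfl⟩
        refine mem_cutL_cons.mpr ⟨p, h2, by omega, _, ?_, rfl⟩
        refine mem_cutL_cons.mpr ⟨p, le_rfl, by omega, _, ?_, rfl⟩
        exact mem_cutL_cons.mpr ⟨h, h3, h4, _, hB, rfl⟩
      by_contra hnz
      have hd := nodup_of_faceTensor_ne_zero (isSeq_id m) (isSeq_id m) hL (right_ne_zero_of_smul hnz)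
      have hsn : s < n + 1 := by
        have := hs
        simp only [zerosAt, Finset.mem_filter, Finset.mem_range] at this
        exact this.1
      refine ne_of_nodup_of_flanked (ξ := fun i => i) (j := 2 * (s + 1) + 1)
        (A := ⟨1, false, 0, a⟩ :: A) (B := B) (I := ⟨2 * s + 1 + 2, true, e, p⟩)
        (J := ⟨2, false, p, p⟩) (K := ⟨2 * s + 1 + 2, b, p, h⟩)
        (hd (s + 1) (by omega)).1 ?_ ?_ h2 rfl rfl rfl
      · simp only
        ring
      · simp only
        ring
  rw [psiSum, sum_admLists_succ, Finset.sum_congr rfl fun js hjs =>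
    Finset.sum_congr rfl fun s hs => key js hjs s hs]
  have hsw : ∀ (F : List ℕ → ℕ → ℕ → ℕ → ℕ → ⨂[k]^(n + 2) (Chains k X ⊗[k] Chains k Y)),
      ∑ js ∈ admLists (n + 1), ∑ s ∈ zerosAt (n + 1) js, ∑ p ∈ Finset.range m,
        ∑ q ∈ Finset.range (m - p), ∑ a ∈ Finset.range (p + 1), F js s p q a =
      ∑ p ∈ Finset.range m, ∑ q ∈ Finset.range (m - p), ∑ a ∈ Finset.range (p + 1),
        ∑ js ∈ admLists (n + 1), ∑ s ∈ zerosAt (n + 1) js, F js s p q a := by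
    intro F
    rw [← sum_comm_three]
    exact Finset.sum_congr rfl fun js _ => sum_comm_three _ _ _ _ _
  rw [hsw, Finset.smul_sum]
  refine Finset.sum_congr rfl fun p hp => ?_
  rw [Finset.smul_sum]
  refine Finset.sum_congr rfl fun q hq => ?_
  rw [Finset.smul_sum]
  refine Finset.sum_congr rfl fun a ha => ?_
  simp only [Finset.mem_range] at hp hq ha
  rw [psiSum, map_smul, smul_smul, map_sum, Finset.smul_sum, Finset.smul_sum]
  refine Finset.sum_congr rfl fun js hjs => ?_
  rw [sum_step_zerosAt k hjs (by omega) (by omega) x y (fun e => (-1 : k) ^ e)]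
  simp only [map_sum, Finset.smul_sum, smul_smul]
  refine Finset.sum_congr rfl fun s _ => Finset.sum_congr rfl fun lo _ =>
    Finset.sum_congr rfl fun hi _ => Finset.sum_congr rfl fun A _ =>
      Finset.sum_congr rfl fun B _ => ?_
  congr 1
  rw [show n + 2 - 1 = n + 1 by omega, Nat.add_sub_cancel]
  ring

end Recursion

/-! ### Shuffles as lattice paths -/

section ShufflePath

/-- The `x`-coordinates of the path that belongs to a shuffle. -/
def stepX (p q : ℕ) (α : Finset ℕ) (w : ℕ) : ℕ :=
  if w ≤ p + q + 1 then (α.filter (· < w)).card else w - 1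

/-- The `y`-coordinates of the path that belongs to a shuffle. -/
def stepY (p q : ℕ) (α : Finset ℕ) (w : ℕ) : ℕ :=
  if w ≤ p + q + 1 then p + (w - (α.filter (· < w)).card) else w - 1

theorem card_filter_lt_succ (α : Finset ℕ) (w : ℕ) :
    (α.filter (· < w + 1)).card = (α.filter (· < w)).card + if w ∈ α then 1 else 0 := by
  have h : α.filter (· < w + 1) = α.filter (· < w) ∪ α.filter (· = w) := by
    ext i
    simp only [Finset.mem_filter, Finset.mem_union]
    constructor
    · rintro ⟨h1, h2⟩
      rcases Nat.lt_succ_iff_lt_or_eq.mp h2 with h | h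
      · exact Or.inl ⟨h1, h⟩
      · exact Or.inr ⟨h1, h⟩
    · rintro (⟨h1, h2⟩ | ⟨h1, h2⟩) <;> exact ⟨h1, by omega⟩
  rw [h, Finset.card_union_of_disjoint, Finset.filter_eq']
  · split_ifs <;> simp
  · rw [Finset.disjoint_left]
    intro i
    simp only [Finset.mem_filter]
    omega

theorem card_filter_lt_mono (α : Finset ℕ) {w w' : ℕ} (h : w ≤ w') :
    (α.filter (· < w)).card ≤ (α.filter (· < w')).card ∧
      (α.filter (· < w')).card ≤ (α.filter (· < w)).card + (w' - w) := by
  induction w', h using Nat.le_induction with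
  | base => simp
  | succ w' h ih =>
    rw [card_filter_lt_succ]
    split_ifs <;> omega

theorem card_filter_lt_le (α : Finset ℕ) (w : ℕ) : (α.filter (· < w)).card ≤ w := by
  have := (card_filter_lt_mono α (Nat.zero_le w)).2
  simpa using this

theorem card_filter_lt_top {α : Finset ℕ} {K w : ℕ} (h : α ⊆ Finset.range K) (hw : K ≤ w) :
    (α.filter (· < w)).card = α.card := by
  rw [Finset.filter_true_of_mem]
  intro i hi
  have := Finset.mem_range.mp (h hi)
  omega

theorem card_filter_sdiff {α : Finset ℕ} {K : ℕ} (h : α ⊆ Finset.range K) (w : ℕ) :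
    ((Finset.range K \ α).filter (· < w)).card = min w K - (α.filter (· < w)).card := by
  have h1 : (Finset.range K \ α).filter (· < w) = Finset.range (min w K) \ α.filter (· < w) := by
    ext i
    simp only [Finset.mem_filter, Finset.mem_sdiff, Finset.mem_range, lt_min_iff, not_and]
    tauto
  rw [h1, Finset.card_sdiff_of_subset, Finset.card_range]
  intro i hi
  rw [Finset.mem_filter] at hi
  have := Finset.mem_range.mp (h hi.1)
  rw [Finset.mem_range]
  omega

theorem isSeq_degen (S : Finset ℕ) {d m : ℕ} (h : d - (S.filter (· < d)).card ≤ m) :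
    IsSeq d m fun w => w - (S.filter (· < w)).card := by
  constructor
  · intro i j hij _
    have := card_filter_lt_mono S hij
    omega
  · intro i hi
    have := card_filter_lt_mono S hi
    omega

theorem isSeq_face (i c m : ℕ) (hc : c ≤ m) :
    IsSeq (m - c) m fun w => if w < i then w else w + c := by
  constructor
  · intro a b hab hb
    split_ifs <;> omega
  · intro a ha
    split_ifs <;> omega

variable {X Y : SSet.{u}} {m p q : ℕ} {α : Finset ℕ}

theorem isSeq_stepX (hα : α ⊆ Finset.range (p + q + 1)) (hc : α.card = p) (hq : p + q < m) :
    IsSeq (m + 1) m (stepX p q α) := by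
  have h1 := fun w => card_filter_lt_top (w := w) hα
  have key : ∀ i j, i ≤ j → stepX p q α i ≤ stepX p q α j := by
    intro i j hij
    have h2 := card_filter_lt_mono α hij
    have h3 := h1 (p + q + 1) le_rfl
    have h4 := fun h => (card_filter_lt_mono α (w := i) (w' := p + q + 1) h).1
    unfold stepX
    split_ifs with hi hj hj
    · omega
    · have := h4 hi
      omega
    · omega
    · omega
  refine ⟨fun i j hij _ => key i j hij, fun i hi => ?_⟩
  refine (key i (m + 1) hi).trans ?_
  rw [stepX, if_neg (by omega)]
  omega

theorem isSeq_stepY (hα : α ⊆ Finset.range (p + q + 1)) (hc : α.card = p) (hq : p + q < m) :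
    IsSeq (m + 1) m (stepY p q α) := by
  have h1 := card_filter_lt_top hα le_rfl
  have key : ∀ i j, i ≤ j → stepY p q α i ≤ stepY p q α j := by
    intro i j hij
    have h2 := card_filter_lt_mono α hij
    have h4 := fun h => card_filter_lt_mono α (w := i) (w' := p + q + 1) h
    have h5 := card_filter_lt_le α i
    unfold stepY
    split_ifs with hi hj hj
    · omega
    · have := h4 hi
      omega
    · omega
    · omega
  refine ⟨fun i j hij _ => key i j hij, fun i hi => ?_⟩
  refine (key i (m + 1) hi).trans ?_
  rw [stepY, if_neg (by omega)]
  omega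

/-- The degeneracies in the complement of `α` leave `x` moving exactly at the elements of `α`; the
omitted vertices `p + 1, …, p + q` become the jump from `p` to `p + q + 1`. -/
theorem iterDegen_iterFace_left (hα : α ⊆ Finset.range (p + q + 1)) (hc : α.card = p)
    (hq : p + q < m) (x : X _⦋m⦌) :
    iterDegen (m + 1) (Finset.range (p + q + 1) \ α) (iterFace x (p + 1) q) =
      pull x (m + 1) (stepX p q α) := by
  have h1 := fun w => card_filter_lt_top (w := w) hα
  have h2 := card_filter_sdiff hα
  have hf := isSeq_face (p + 1) q m (by omega)
  have hd : IsSeq (m + 1) (m - q) fun w => w - ((Finset.range (p + q + 1) \ α).filter (· < w)).card :=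
    isSeq_degen _ (by rw [h2, h1 _ (by omega)]; omega)
  unfold iterDegen iterFace
  rw [pull_pull x hf.mono hf.le hd.mono hd.le]
  apply pull_congr
  intro w _
  rw [h2, stepX]
  have h3 := card_filter_lt_le α w
  have h4 := h1 w
  have h5 := fun h => (card_filter_lt_mono α (w := w) (w' := p + q + 1) h).1
  have h6 := h1 (p + q + 1) le_rfl
  rcases le_or_gt w (p + q + 1) with hw | hw
  · rw [if_pos hw, min_eq_left hw, if_pos]
    · omega
    · have := h5 hw
      omega
  · rw [if_neg (by omega), min_eq_right hw.le, if_neg]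
    · have := h4 hw.le
      omega
    · have := h4 hw.le
      omega

/-- The omitted vertices `0, …, p - 1` let `y` start at `p`; the additional degeneracy `s_{p+q+1}`
makes it rest at `p + q + 1` while `x` jumps. -/
theorem iterDegen_iterFace_right (hα : α ⊆ Finset.range (p + q + 1)) (hc : α.card = p)
    (hq : p + q < m) (y : Y _⦋m⦌) :
    iterDegen (m + 1) (insert (p + q + 1) α) (iterFace y 0 p) =
      pull y (m + 1) (stepY p q α) := by
  have hn : p + q + 1 ∉ α := fun h => by simpa using hα h
  have h1 := fun w => card_filter_lt_top (w := w) hα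
  have h2 : ∀ w, ((insert (p + q + 1) α).filter (· < w)).card =
      (α.filter (· < w)).card + if p + q + 1 < w then 1 else 0 := by
    intro w
    rw [Finset.filter_insert]
    split_ifs with h
    · rw [Finset.card_insert_of_notMem (by simp [hn])]
    · rfl
  have hf := isSeq_face 0 p m (by omega)
  have hd : IsSeq (m + 1) (m - p) fun w => w - ((insert (p + q + 1) α).filter (· < w)).card :=
    isSeq_degen _ (by rw [h2, h1 _ (by omega), if_pos (by omega)]; omega)
  unfold iterDegen iterFace
  rw [pull_pull y hf.mono hf.le hd.mono hd.le]
  apply pull_congr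
  intro w _
  rw [h2, stepY, if_neg (by omega)]
  have h4 := h1 w
  split_ifs <;> omega

theorem stepX_succ {w : ℕ} (hw : w < p + q + 1) :
    stepX p q α (w + 1) = stepX p q α w + if w ∈ α then 1 else 0 := by
  rw [stepX, stepX, if_pos (by omega), if_pos (by omega), card_filter_lt_succ]

theorem stepY_succ {w : ℕ} (hw : w < p + q + 1) :
    stepY p q α (w + 1) = stepY p q α w + if w ∈ α then 0 else 1 := by
  rw [stepY, stepY, if_pos (by omega), if_pos (by omega), card_filter_lt_succ]
  have := card_filter_lt_le α w
  split_ifs <;> omega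

theorem stepX_or_stepY {w : ℕ} (hw : w < p + q + 1) :
    stepX p q α w = stepX p q α (w + 1) ∨ stepY p q α w = stepY p q α (w + 1) := by
  rw [stepX_succ hw, stepY_succ hw]
  split_ifs <;> simp

theorem stepY_jump (hα : α ⊆ Finset.range (p + q + 1)) (hc : α.card = p) :
    stepY p q α (p + q + 1) = stepY p q α (p + q + 1 + 1) := by
  rw [stepY, stepY, if_pos le_rfl, if_neg (by omega), card_filter_lt_top hα le_rfl]
  omega

/-- The shuffle with `a` steps in the first direction, then `q + 1` steps in the second and `p - a`
steps in the first direction. -/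
def cornerShuffle (p q a : ℕ) : Finset ℕ := Finset.range a ∪ Finset.Ico (a + q + 1) (p + q + 1)

theorem cornerShuffle_spec {a : ℕ} (ha : a ≤ p) :
    cornerShuffle p q a ⊆ Finset.range (p + q + 1) ∧ (cornerShuffle p q a).card = p := by
  constructor
  · intro i
    simp only [cornerShuffle, Finset.mem_union, Finset.mem_range, Finset.mem_Ico]
    omega
  · rw [cornerShuffle, Finset.card_union_of_disjoint]
    · simp
      omega
    · rw [Finset.disjoint_left]
      intro i
      simp only [Finset.mem_range, Finset.mem_Ico]
      omega

/-- Membership in `α` is prescribed everywhere, and `α.card = p` then forces `l = a + q + 1`. -/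
theorem eq_cornerShuffle {a l : ℕ} (hα : α ⊆ Finset.range (p + q + 1)) (hc : α.card = p)
    (hal : a ≤ l) (hl : l ≤ p + q + 1) (h1 : ∀ i < a, i ∈ α) (h2 : ∀ i, a ≤ i → i < l → i ∉ α)
    (h3 : ∀ i, l ≤ i → i < p + q + 1 → i ∈ α) :
    a ≤ p ∧ l = a + q + 1 ∧ α = cornerShuffle p q a := by
  have h : α = Finset.range a ∪ Finset.Ico l (p + q + 1) := by
    ext i
    simp only [Finset.mem_union, Finset.mem_range, Finset.mem_Ico]
    constructor
    · intro hi
      have h5 := Finset.mem_range.mp (hα hi)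
      by_contra hcon
      exact h2 i (by omega) (by omega) hi
    · rintro (hi | hi)
      · exact h1 i hi
      · exact h3 i hi.1 hi.2
  have hcard : a + (p + q + 1 - l) = p := by
    have h4 := congrArg Finset.card h
    rw [hc, Finset.card_union_of_disjoint, Finset.card_range, Nat.card_Ico] at h4
    · exact h4.symm
    · rw [Finset.disjoint_left]
      intro i
      simp only [Finset.mem_range, Finset.mem_Ico]
      omega
  have hl' : l = a + q + 1 := by omega
  exact ⟨by omega, hl', by rw [h, hl', cornerShuffle]⟩

theorem stepX_corner {a w : ℕ} (ha : a ≤ p) :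
    (w ≤ a → stepX p q (cornerShuffle p q a) w = w) ∧
    stepX p q (cornerShuffle p q a) (a + q + 1 + w) = pathX p q a w := by
  have hc : ∀ w, ((cornerShuffle p q a).filter (· < w)).card = min a w + (min w (p + q + 1) - (a + q + 1)) := by
    intro w
    have : (cornerShuffle p q a).filter (· < w) =
        Finset.range (min a w) ∪ Finset.Ico (a + q + 1) (min w (p + q + 1)) := by
      ext i
      simp only [cornerShuffle, Finset.mem_filter, Finset.mem_union, Finset.mem_range,
        Finset.mem_Ico, lt_min_iff]
      omega
    rw [this, Finset.card_union_of_disjoint]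
    · simp
    · rw [Finset.disjoint_left]
      intro i
      simp only [Finset.mem_range, Finset.mem_Ico]
      omega
  constructor
  · intro hw
    rw [stepX, hc, if_pos (by omega)]
    omega
  · rw [stepX, hc, pathX]
    split_ifs <;> omega

theorem stepY_corner {a w : ℕ} (ha : a ≤ p) :
    (w ≤ q + 1 → stepY p q (cornerShuffle p q a) (a + w) = p + w) ∧
    stepY p q (cornerShuffle p q a) (a + q + 1 + w) = pathY p q a w := by
  have hX := fun w => (stepX_corner (q := q) (w := w) ha).2
  constructor
  · intro hw
    induction w with
    | zero =>
      have := (stepX_corner (q := q) (w := a) ha).1 le_rfl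
      rw [stepX, if_pos (by omega)] at this
      rw [stepY, Nat.add_zero, if_pos (by omega), this]
      omega
    | succ w ih =>
      rw [← add_assoc, stepY_succ (by omega), ih (by omega), if_neg]
      · ring
      · simp only [cornerShuffle, Finset.mem_union, Finset.mem_range, Finset.mem_Ico]
        omega
  · have h := hX w
    unfold stepX pathX at h
    unfold stepY pathY
    split_ifs at h ⊢ <;> omega

/-- Only the last `p - a` elements of the shuffle lie behind complementary ones, and they lie behind
all `q + 1` of them. -/
theorem shuffleInv_corner {a : ℕ} (ha : a ≤ p) :
    shuffleInv (cornerShuffle p q a) (Finset.range (p + q + 1) \ cornerShuffle p q a) =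
      (p - a) * (q + 1) := by
  have : ((cornerShuffle p q a ×ˢ (Finset.range (p + q + 1) \ cornerShuffle p q a)).filter
      fun ab => ab.2 < ab.1) =
      Finset.Ico (a + q + 1) (p + q + 1) ×ˢ Finset.Ico a (a + q + 1) := by
    ext ⟨i, j⟩
    simp only [cornerShuffle, Finset.mem_filter, Finset.mem_product, Finset.mem_union,
      Finset.mem_range, Finset.mem_Ico, Finset.mem_sdiff]
    omega
  rw [shuffleInv, this, Finset.card_product, Nat.card_Ico, Nat.card_Ico]
  congr 1 <;> omega

end ShufflePath

/-! ### Diagonal, Alexander–Whitney map and the maps `G_n` on simplices -/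

section Coproducts

variable (k : Type v) [CommRing k] {X Y : SSet.{u}} {m : ℕ}

theorem vcls_range' (z : X _⦋m⦌) (lo c : ℕ) :
    vcls k z (List.range' lo (c + 1)) = cls k (pull z c fun i => lo + i) := by
  unfold vcls
  rw [List.length_range', Nat.add_sub_cancel]
  congr 1
  apply pull_congr
  intro i hi
  rw [List.getD_eq_getElem _ _ (by simp; omega), List.getElem_range', one_mul]

theorem cls_frontFace (z : X _⦋m⦌) (l : ℕ) :
    cls k (frontFace z l) = vcls k z (List.range' 0 (l + 1)) := by
  rw [vcls_range', frontFace]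
  simp only [zero_add]

theorem cls_backFace (z : X _⦋m⦌) (l : ℕ) :
    cls k (backFace z l) = vcls k z (List.range' l (m - l + 1)) := by
  rw [vcls_range', backFace]

theorem pairwise_le_range' (lo c : ℕ) : (List.range' lo c).Pairwise (· ≤ ·) :=
  List.pairwise_le_range' 1

theorem diag_cls (z : X _⦋m⦌) : diag k X (cls k z) =
    ∑ l ∈ Finset.range (m + 1), cls k (frontFace z l) ⊗ₜ[k] cls k (backFace z l) := by
  refine chainLift_cls k (fun m z => _) z fun hz => ?_
  obtain ⟨i, him, hi⟩ := cls_eq_zero_or (k := k) hz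
  refine Finset.sum_eq_zero fun l hl => ?_
  rw [Finset.mem_range] at hl
  rw [cls_frontFace, cls_backFace]
  rcases lt_or_ge i l with h | h
  · rw [hi (List.range' 0 (l + 1)) (pairwise_le_range' _ _), TensorProduct.zero_tmul] <;>
      simp only [List.mem_range'_1] <;> omega
  · rw [hi (List.range' l (m - l + 1)) (pairwise_le_range' _ _), TensorProduct.tmul_zero] <;>
      simp only [List.mem_range'_1] <;> omega

theorem alexanderWhitney_cls (z : (sprod X Y) _⦋m⦌) : alexanderWhitney k X Y (cls k z) =
    ∑ l ∈ Finset.range (m + 1), vcls k ((prX X Y).app _ z) (List.range' 0 (l + 1)) ⊗ₜ[k]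
      vcls k ((prY X Y).app _ z) (List.range' l (m - l + 1)) := by
  have h : ∀ {d : ℕ} (w : (sprod X Y) _⦋d⦌), ∑ l ∈ Finset.range (d + 1),
      cls k (frontFace ((prX X Y).app _ w) l) ⊗ₜ[k] cls k (backFace ((prY X Y).app _ w) l) =
      ∑ l ∈ Finset.range (d + 1), chainMap k (prX X Y) (vcls k w (List.range' 0 (l + 1))) ⊗ₜ[k]
        chainMap k (prY X Y) (vcls k w (List.range' l (d - l + 1))) := by
    intro d w
    refine Finset.sum_congr rfl fun l _ => ?_
    rw [chainMap_vcls, chainMap_vcls, cls_frontFace, cls_backFace]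
  have h2 : alexanderWhitney k X Y (cls k z) = ∑ l ∈ Finset.range (m + 1),
      chainMap k (prX X Y) (vcls k z (List.range' 0 (l + 1))) ⊗ₜ[k]
        chainMap k (prY X Y) (vcls k z (List.range' l (m - l + 1))) := by
    rw [← h]
    refine chainLift_cls k (fun m z => _) z fun hz => ?_
    obtain ⟨i, him, hi⟩ := cls_eq_zero_or (k := k) hz
    rw [h]
    refine Finset.sum_eq_zero fun l hl => ?_
    rw [Finset.mem_range] at hl
    rcases lt_or_ge i l with h | h
    · rw [hi (List.range' 0 (l + 1)) (pairwise_le_range' _ _), map_zero,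
        TensorProduct.zero_tmul] <;> simp only [List.mem_range'_1] <;> omega
    · rw [hi (List.range' l (m - l + 1)) (pairwise_le_range' _ _), map_zero,
        TensorProduct.tmul_zero] <;> simp only [List.mem_range'_1] <;> omega
  rw [h2]
  simp only [chainMap_vcls]

theorem gm_one : gm k X Y 1 = (PiTensorProduct.subsingletonEquiv (0 : Fin 1)).symm.toLinearMap ∘ₗ
    alexanderWhitney k X Y := by
  rw [gm]

theorem gm_one_apply (c : Chains k (sprod X Y)) : gm k X Y 1 c =
    PiTensorProduct.tprod k fun _ : Fin 1 => alexanderWhitney k X Y c := by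
  rw [gm_one]
  exact PiTensorProduct.subsingletonEquiv_symm_apply' (0 : Fin 1) _

/-- The summand of the recursion for `gm`. -/
def gmSummand (X Y : SSet.{u}) (n : ℕ) (i : Fin (n + 1)) :
    Chains k (sprod X Y) ⊗[k] Chains k (sprod X Y) →ₗ[k]
      ⨂[k]^(n + 2) (Chains k X ⊗[k] Chains k Y) :=
  (TensorPower.cast k (Chains k X ⊗[k] Chains k Y)
    (show (i.val + 1) + (n + 1 - i.val) = n + 2 by omega)).toLinearMap ∘ₗ
      TensorPower.mulEquiv.toLinearMap ∘ₗ
        TensorProduct.map (gm k X Y (i.val + 1) ∘ₗ (signOp k (sprod X Y) ^ (n - i.val)))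
          (gm k X Y (n + 1 - i.val))

theorem gm_succ_succ (n : ℕ) : gm k X Y (n + 2) = (-1 : k) • ∑ i : Fin (n + 1),
    (-1 : k) ^ (n + 1 - i.val) •
      (gmSummand k X Y n i ∘ₗ diag k (sprod X Y) ∘ₗ emHomotopy k X Y) := by
  rw [gm]
  rfl

theorem gmSummand_tmul (n : ℕ) (i : Fin (n + 1)) {d : ℕ} (w : (sprod X Y) _⦋d⦌)
    (c : Chains k (sprod X Y)) : gmSummand k X Y n i (cls k w ⊗ₜ[k] c) =
      (-1 : k) ^ (d * (n - i.val)) • TensorPower.cast k (Chains k X ⊗[k] Chains k Y)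
        (show (i.val + 1) + (n + 1 - i.val) = n + 2 by omega)
          (TensorPower.mulEquiv (gm k X Y (i.val + 1) (cls k w) ⊗ₜ[k] gm k X Y (n + 1 - i.val) c)) := by
  have : gmSummand k X Y n i (cls k w ⊗ₜ[k] c) =
      TensorPower.cast k (Chains k X ⊗[k] Chains k Y)
        (show (i.val + 1) + (n + 1 - i.val) = n + 2 by omega)
          (TensorPower.mulEquiv (gm k X Y (i.val + 1) ((signOp k (sprod X Y) ^ (n - i.val)) (cls k w))
            ⊗ₜ[k] gm k X Y (n + 1 - i.val) c)) := rfl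
  rw [this, signOp_pow_cls, map_smul, ← TensorProduct.smul_tmul', map_smul, map_smul]

theorem gmSummand_zero_tmul (n : ℕ) {d : ℕ} (w : (sprod X Y) _⦋d⦌)
    (c : Chains k (sprod X Y)) : gmSummand k X Y n 0 (cls k w ⊗ₜ[k] c) =
      (-1 : k) ^ (d * n) • consT k (n + 1) (alexanderWhitney k X Y (cls k w)) (gm k X Y (n + 1) c) := by
  rw [gmSummand_tmul]
  change (-1 : k) ^ (d * n) • TensorPower.cast k (Chains k X ⊗[k] Chains k Y)
        (show 1 + (n + 1) = n + 2 by omega)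
          (TensorPower.mulEquiv (gm k X Y 1 (cls k w) ⊗ₜ[k] gm k X Y (n + 1) c)) = _
  rw [gm_one_apply]
  rfl

theorem consT_sum_left (n : ℕ) {M : Type*} [AddCommGroup M] [Module k M] {ι : Type*} (s : Finset ι)
    (f : ι → M) (T : ⨂[k]^n M) : consT k n (∑ i ∈ s, f i) T = ∑ i ∈ s, consT k n (f i) T := by
  have h : ∀ c : M, (PiTensorProduct.tprod k fun _ : Fin 1 => c) =
      (PiTensorProduct.subsingletonEquiv (s := fun _ => M) (R := k) (0 : Fin 1)).symm c :=
    fun c => (PiTensorProduct.subsingletonEquiv_symm_apply' (0 : Fin 1) c).symm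
  simp only [consT, LinearMap.comp_apply, h, map_sum, LinearMap.sum_apply]

theorem psiSum_congr (n : ℕ) {m m' : ℕ} (x : X _⦋m⦌) (y : Y _⦋m'⦌) {ξ ξ' η η' : ℕ → ℕ} {d d' : ℕ}
    (hd : d = d') (hξ : ∀ i ≤ d, ξ i = ξ' i) (hη : ∀ i ≤ d, η i = η' i) :
    psiSum k n x y ξ η d = psiSum k n x y ξ' η' d' := by
  subst hd
  unfold psiSum
  congr 1
  refine Finset.sum_congr rfl fun js _ => Finset.sum_congr rfl fun L hL => ?_
  congr 1
  unfold faceTensor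
  congr 1
  funext t
  congr 2 <;> refine List.map_congr_left fun i hi => ?_
  · exact hξ i ((dv_sorted hL _).2 i hi).2
  · exact hη i ((dv_sorted hL _).2 i hi).2

/-- The simplex `(x, y)` of `X × Y`. -/
def pairSimplex {X Y : SSet.{u}} {d : ℕ} (x : X _⦋d⦌) (y : Y _⦋d⦌) : (sprod X Y) _⦋d⦌ := (x, y)

/-- Restricting to nondegenerate simplices avoids checking that the formula vanishes on degenerate
ones; by `chains_ext` this suffices. -/
theorem emHomotopy_cls (z : (sprod X Y) _⦋m⦌) (hz : z ∈ (sprod X Y).nonDegenerate m) :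
    emHomotopy k X Y (cls k z) =
      ∑ p ∈ Finset.range m, ∑ q ∈ Finset.range (m - p),
        ∑ α ∈ (Finset.range (p + q + 1)).powersetCard p,
          (-1 : k) ^ (p + q + shuffleInv α (Finset.range (p + q + 1) \ α)) •
            cls k (pairSimplex (pull ((prX X Y).app _ z) (m + 1) (stepX p q α))
              (pull ((prY X Y).app _ z) (m + 1) (stepY p q α))) := by
  unfold emHomotopy
  rw [chainLift_cls k _ z fun h => absurd hz h]
  refine Finset.sum_congr rfl fun p hp => Finset.sum_congr rfl fun q hq =>
    Finset.sum_congr rfl fun α hα => ?_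
  rw [Finset.mem_powersetCard] at hα
  simp only [Finset.mem_range] at hp hq
  rw [iterDegen_iterFace_left hα.1 hα.2 (by omega), iterDegen_iterFace_right hα.1 hα.2 (by omega)]
  rfl

theorem admLists_one : admLists 1 = {[0]} := by
  ext js
  rw [mem_admLists, Finset.mem_singleton]
  constructor
  · rintro ⟨h1, h2, _⟩
    obtain ⟨a, rfl⟩ := List.length_eq_one_iff.mp h1
    simpa using h2
  · rintro rfl
    simp

/-- The only word is `(1, 2)`: it has no inversion and both intervals are final, so all signs are
trivial. -/
theorem psiSum_one (x : X _⦋m⦌) (y : Y _⦋m⦌) :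
    psiSum k 1 x y (fun i => i) (fun i => i) m = PiTensorProduct.tprod k fun _ : Fin 1 =>
      ∑ l ∈ Finset.range (m + 1), vcls k x (List.range' 0 (l + 1)) ⊗ₜ[k]
        vcls k y (List.range' l (m - l + 1)) := by
  have h : ∀ c : Chains k X ⊗[k] Chains k Y, (PiTensorProduct.tprod k fun _ : Fin 1 => c) =
      (PiTensorProduct.subsingletonEquiv (s := fun _ => Chains k X ⊗[k] Chains k Y) (R := k)
        (0 : Fin 1)).symm c :=
    fun c => (PiTensorProduct.subsingletonEquiv_symm_apply' (0 : Fin 1) c).symm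
  rw [h, map_sum, psiSum, admLists_one, Finset.sum_singleton]
  have hw : fullWord 1 [0] = [(1, false), (2, false)] := rfl
  rw [hw, sum_cutL_cons, Nat.sub_self, pow_zero, one_smul]
  have hI : Finset.Icc 0 m = Finset.range (m + 1) := by
    ext i
    simp
  rw [hI]
  refine Finset.sum_congr rfl fun l hl => ?_
  rw [Finset.mem_range] at hl
  rw [sum_cutL_cons, Finset.sum_eq_single_of_mem m (by simp; omega)]
  · rw [sum_cutL_nil, if_pos rfl, ← h, faceTensor]
    simp only [pe, po, lenBelow, dv, List.map_id']
    simp [Iv.verts]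
  · intro e _ he
    rw [sum_cutL_nil, if_neg he]

end Coproducts

/-! ### The chain-level identity -/

section Comparison

variable (k : Type v) [CommRing k] {X Y : SSet.{u}} {m : ℕ}

theorem IsSeq.comp {d e : ℕ} {ξ ζ : ℕ → ℕ} (h : IsSeq d m ξ) (h' : IsSeq e d ζ) :
    IsSeq e m fun i => ξ (ζ i) :=
  ⟨fun i j hij hj => h.mono _ _ (h'.mono i j hij hj) (h'.le j hj), fun i hi => h.le _ (h'.le i hi)⟩

theorem isSeq_front {l d : ℕ} (hl : l ≤ d) : IsSeq l d fun i => i :=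
  ⟨fun _ _ h _ => h, fun _ h => h.trans hl⟩

theorem isSeq_back {l d : ℕ} (hl : l ≤ d) : IsSeq (d - l) d fun i => l + i :=
  ⟨fun _ _ h _ => by omega, fun _ h => by omega⟩

section Faces

variable {x : X _⦋m⦌} {y : Y _⦋m⦌} {d : ℕ} {ξ η : ℕ → ℕ} (hξ : IsSeq d m ξ) (hη : IsSeq d m η)
  {w : (sprod X Y) _⦋d⦌} (hx : (prX X Y).app _ w = pull x d ξ)
  (hy : (prY X Y).app _ w = pull y d η) {l : ℕ} (hl : l ≤ d)

include hξ hη hx hy hl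

theorem psiSum_frontFace (n : ℕ) : psiSum k n ((prX X Y).app _ (frontFace w l))
    ((prY X Y).app _ (frontFace w l)) (fun i => i) (fun i => i) l = psiSum k n x y ξ η l := by
  have hf := isSeq_front hl
  rw [frontFace, app_pull, app_pull, hx, hy, pull_pull x hξ.mono hξ.le hf.mono hf.le,
    pull_pull y hη.mono hη.le hf.mono hf.le]
  exact psiSum_pull k n x y (hξ.comp hf) (hη.comp hf)

theorem psiSum_backFace (n : ℕ) : psiSum k n ((prX X Y).app _ (backFace w l))
    ((prY X Y).app _ (backFace w l)) (fun i => i) (fun i => i) (d - l) =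
      psiSum k n x y (fun i => ξ (l + i)) (fun i => η (l + i)) (d - l) := by
  have hf := isSeq_back hl
  rw [backFace, app_pull, app_pull, hx, hy, pull_pull x hξ.mono hξ.le hf.mono hf.le,
    pull_pull y hη.mono hη.le hf.mono hf.le]
  exact psiSum_pull k n x y (hξ.comp hf) (hη.comp hf)

theorem alexanderWhitney_frontFace : alexanderWhitney k X Y (cls k (frontFace w l)) =
    ∑ a ∈ Finset.range (l + 1), vcls k x ((List.range' 0 (a + 1)).map ξ) ⊗ₜ[k]
      vcls k y ((List.range' a (l - a + 1)).map η) := by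
  have hf := isSeq_front hl
  have h1 := hξ.comp hf
  have h2 := hη.comp hf
  rw [alexanderWhitney_cls]
  refine Finset.sum_congr rfl fun a ha => ?_
  rw [Finset.mem_range] at ha
  rw [frontFace, app_pull, app_pull, hx, hy, pull_pull x hξ.mono hξ.le hf.mono hf.le,
    pull_pull y hη.mono hη.le hf.mono hf.le,
    vcls_pull k x h1.mono h1.le (pairwise_le_range' _ _) _ (by simp),
    vcls_pull k y h2.mono h2.le (pairwise_le_range' _ _) _ (by simp)] <;>
  · intro i hi
    rw [List.mem_range'_1] at hi
    omega

end Faces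

variable {k}

theorem vcls_range'_map_eq_zero {x : X _⦋m⦌} {d : ℕ} {ξ : ℕ → ℕ} (hξ : IsSeq d m ξ) {lo c i : ℕ}
    (hd : lo + c ≤ d) (h1 : lo ≤ i) (h2 : i < lo + c) (h : ξ i = ξ (i + 1)) :
    vcls k x ((List.range' lo (c + 1)).map ξ) = 0 := by
  have hs := map_sorted hξ (pairwise_le_range' lo (c + 1)) fun a ha => by
    rw [List.mem_range'_1] at ha
    omega
  apply vcls_eq_zero k x hs.1 hs.2
  intro hn
  have := List.inj_on_of_nodup_map hn (x := i) (y := i + 1) (by rw [List.mem_range'_1]; omega)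
    (by rw [List.mem_range'_1]; omega) h
  omega

section Shuffles

variable {p q : ℕ} {α : Finset ℕ} (hα : α ⊆ Finset.range (p + q + 1)) (hc : α.card = p)
  (hq : p + q < m) (x : X _⦋m⦌) (y : Y _⦋m⦌)

include hα hc hq

/-- If the front face stops before the jump, the whole path consists of shuffle steps and
`eq_one_of_shuffle` applies. Otherwise `y` rests at the jump, so every earlier step must move `x`;
but `α` has only `p` of the `p + q + 1` steps. -/
theorem psiSum_shuffle_eq_zero {n l : ℕ} (hn : 2 ≤ n) (hl : l ≤ m + 1) :
    psiSum k n x y (stepX p q α) (stepY p q α) l = 0 := by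
  have hX := isSeq_stepX hα hc hq
  have hY := isSeq_stepY hα hc hq
  rw [psiSum, Finset.sum_eq_zero, smul_zero]
  refine fun js hjs => Finset.sum_eq_zero fun L hL => ?_
  by_contra hnz
  have hd := nodup_of_faceTensor_ne_zero (hX.comp (isSeq_front hl)) (hY.comp (isSeq_front hl)) hL
    (right_ne_zero_of_smul hnz)
  rcases le_or_gt l (p + q + 1) with h | h
  · have := eq_one_of_shuffle hjs (by omega) hL hd (e := l)
      (fun i hi => stepX_or_stepY (by omega)) rfl
    omega
  · have hne : ∀ i < p + q + 1, i ∈ α := by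
      intro i hi
      have := step_ne_of_nodup hjs (by omega) hL hd (e := p + q + 1) (fun i hi => stepX_or_stepY hi)
        h (stepY_jump hα hc) hi
      by_contra hcon
      rw [stepX_succ hi, if_neg hcon] at this
      exact this rfl
    have := Finset.card_le_card (show Finset.range (p + q + 1) ⊆ α from
      fun i hi => hne i (Finset.mem_range.mp hi))
    rw [Finset.card_range] at this
    omega

/-- The first factor being nonzero means that `x` moves on the first `a` steps. By the second one,
`y` moves on the steps from `a` to `l` and the jump comes after `l`. In the third factor `y` rests
at the jump, so `x` moves on all shuffle steps from `l` on. This determines `α`. -/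
theorem corner_of_ne_zero {n l a : ℕ} (hl : l ≤ m + 1) (ha : a ≤ l)
    (h1 : vcls k x ((List.range' 0 (a + 1)).map (stepX p q α)) ≠ 0)
    (h2 : vcls k y ((List.range' a (l - a + 1)).map (stepY p q α)) ≠ 0)
    (h3 : psiSum k (n + 1) x y (fun i => stepX p q α (l + i)) (fun i => stepY p q α (l + i))
      (m + 1 - l) ≠ 0) :
    a ≤ p ∧ l = a + q + 1 ∧ α = cornerShuffle p q a := by
  have hX := isSeq_stepX hα hc hq
  have hY := isSeq_stepY hα hc hq
  have e1 : ∀ i < a, i < p + q + 1 → i ∈ α := by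
    intro i hi hi'
    by_contra hcon
    exact h1 (vcls_range'_map_eq_zero hX (by omega) (Nat.zero_le i) (by omega)
      (by rw [stepX_succ hi', if_neg hcon]; rfl))
  have hlt : a ≤ p + q + 1 := by
    by_contra hcon
    have := Finset.card_le_card (show Finset.range (p + q + 1) ⊆ α from fun i hi =>
      e1 i (by rw [Finset.mem_range] at hi; omega) (Finset.mem_range.mp hi))
    rw [Finset.card_range] at this
    omega
  have hl' : l ≤ p + q + 1 := by
    by_contra hcon
    exact h2 (vcls_range'_map_eq_zero hY (by omega) hlt (by omega) (stepY_jump hα hc))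
  refine eq_cornerShuffle hα hc ha hl' (fun i hi => e1 i hi (by omega)) (fun i hi hi' => ?_)
    (fun i hi hi' => ?_)
  · intro hcon
    exact h2 (vcls_range'_map_eq_zero hY (by omega) hi (by omega)
      (by rw [stepY_succ (by omega), if_pos hcon]; rfl))
  · by_contra hcon
    apply h3
    rw [psiSum, Finset.sum_eq_zero, smul_zero]
    refine fun js hjs => Finset.sum_eq_zero fun L hL => ?_
    by_contra hnz
    have hd := nodup_of_faceTensor_ne_zero (hX.comp (isSeq_back hl)) (hY.comp (isSeq_back hl)) hL
      (right_ne_zero_of_smul hnz)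
    -- `p + q + 1 - l` is the index of the jump in the back face.
    have := step_ne_of_nodup hjs (by omega) hL hd (e := p + q + 1 - l)
      (fun i hi => stepX_or_stepY (by omega)) (by omega)
      (by
        rw [show l + (p + q + 1 - l) = p + q + 1 by omega,
          show l + (p + q + 1 - l + 1) = p + q + 1 + 1 by omega]
        exact stepY_jump hα hc) (i := i - l) (by omega)
    rw [show l + (i - l) = i by omega, show l + (i - l + 1) = i + 1 by omega, stepX_succ hi',
      if_neg hcon] at this
    exact this rfl

end Shuffles

variable (k)

/-- By `corner_of_ne_zero` each `a ≤ p` contributes a single term: the corner shuffle, cut at `l = a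
+ q + 1`. The coefficient `c` will carry the signs. -/
theorem sum_shuffles {p q : ℕ} (hq : p + q < m) (x : X _⦋m⦌) (y : Y _⦋m⦌) (n : ℕ)
    (c : Finset ℕ → ℕ → k) :
    ∑ α ∈ (Finset.range (p + q + 1)).powersetCard p, ∑ l ∈ Finset.range (m + 2),
      c α l • consT k (n + 1)
        (∑ a ∈ Finset.range (l + 1), vcls k x ((List.range' 0 (a + 1)).map (stepX p q α)) ⊗ₜ[k]
          vcls k y ((List.range' a (l - a + 1)).map (stepY p q α)))
        (psiSum k (n + 1) x y (fun i => stepX p q α (l + i)) (fun i => stepY p q α (l + i))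
          (m + 1 - l)) =
    ∑ a ∈ Finset.range (p + 1), c (cornerShuffle p q a) (a + q + 1) •
      consT k (n + 1) (vcls k x (List.range' 0 (a + 1)) ⊗ₜ[k] vcls k y (List.range' p (q + 2)))
        (psiSum k (n + 1) x y (pathX p q a) (pathY p q a) (m - a - q)) := by
  simp only [consT_sum_left, Finset.smul_sum, Finset.sum_sigma']
  symm
  refine Finset.sum_of_injOn
    (fun a => (⟨cornerShuffle p q a, ⟨a + q + 1, a⟩⟩ : Σ _ : Finset ℕ, Σ _ : ℕ, ℕ)) ?_ ?_ ?_ ?_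
  · intro a _ a' _ h
    exact congrArg (fun s => s.2.2) h
  · intro a ha
    simp only [Finset.coe_range, Set.mem_Iio] at ha
    have := cornerShuffle_spec (q := q) (Nat.lt_succ_iff.mp ha)
    simp only [Finset.mem_coe, Finset.mem_sigma, Finset.mem_powersetCard, Finset.mem_range]
    exact ⟨this, by omega, by omega⟩
  · rintro ⟨α, l, a⟩ h hne
    simp only [Finset.mem_sigma, Finset.mem_powersetCard, Finset.mem_range] at h
    by_contra hnz
    have h0 := right_ne_zero_of_smul hnz
    have h1 : vcls k x ((List.range' 0 (a + 1)).map (stepX p q α)) ⊗ₜ[k]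
        vcls k y ((List.range' a (l - a + 1)).map (stepY p q α)) ≠ 0 := by
      intro h
      apply h0
      simp only [h, consT, LinearMap.comp_apply, TensorProduct.mk_apply]
      rw [MultilinearMap.map_coord_zero _ (0 : Fin 1) rfl, TensorProduct.zero_tmul]
      simp
    obtain ⟨h2, rfl, rfl⟩ := corner_of_ne_zero (k := k) (n := n) h.1.1 h.1.2 hq x y (l := l)
      (a := a) (by omega) (by omega) (fun h => h1 (by rw [h, TensorProduct.zero_tmul]))
      (fun h => h1 (by rw [h, TensorProduct.tmul_zero])) (fun h => h0 (by simp only [h, map_zero]))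
    exact hne ⟨a, by simpa using Nat.lt_succ_of_le h2, rfl⟩
  · intro a ha
    rw [Finset.mem_range] at ha
    have ha' : a ≤ p := by omega
    dsimp only
    congr 2
    · congr 3
      · symm
        conv_rhs => rw [← List.map_id (List.range' 0 (a + 1))]
        refine List.map_congr_left fun i hi => ?_
        rw [List.mem_range'_1] at hi
        exact (stepX_corner ha').1 (by omega)
      · rw [show a + q + 1 - a + 1 = q + 2 by omega]
        apply List.ext_getElem
        · simp
        · intro i h1 h2
          simp at h1
          simp only [List.getElem_map, List.getElem_range', one_mul]
          exact ((stepY_corner ha').1 (by omega)).symm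
    · exact psiSum_congr k _ x y (by omega) (fun i _ => ((stepX_corner ha').2).symm)
        (fun i _ => ((stepY_corner ha').2).symm)

theorem gm_cls (X Y : SSet.{u}) (n : ℕ) (hn : 1 ≤ n) :
    gm k X Y n = PiTensorProduct.map
      (fun _ : Fin n => TensorProduct.map (chainMap k (prX X Y)) (chainMap k (prY X Y))) ∘ₗ
        psiHgc k (sprod X Y) n := by
  induction n using Nat.strong_induction_on with
  | _ n ih =>
  -- This is needed for all simplices, as the faces of a shuffle simplex may be degenerate.
  have ih' : ∀ n' < n, 1 ≤ n' → ∀ {d : ℕ} (z : (sprod X Y) _⦋d⦌), gm k X Y n' (cls k z) =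
      psiSum k n' ((prX X Y).app _ z) ((prY X Y).app _ z) (fun i => i) (fun i => i) d := by
    intro n' h1 h2 d z
    rw [ih n' h1 h2, LinearMap.comp_apply, map_psiHgc_cls k _ _ h2]
  refine chains_ext k fun m z hz => ?_
  rw [LinearMap.comp_apply, map_psiHgc_cls k _ _ hn]
  obtain rfl | ⟨n, rfl⟩ : n = 1 ∨ ∃ n', n = n' + 2 := by
    rcases n with _ | _ | n
    · omega
    · exact Or.inl rfl
    · exact Or.inr ⟨n, rfl⟩
  · rw [psiSum_one, gm_one_apply, alexanderWhitney_cls]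
  set x := (prX X Y).app _ z with hxdef
  set y := (prY X Y).app _ z with hydef
  rw [psiSum_succ, gm_succ_succ, LinearMap.smul_apply, LinearMap.sum_apply]
  have hterm : ∀ i : Fin (n + 1), ((-1 : k) ^ (n + 1 - i.val) •
      (gmSummand k X Y n i ∘ₗ diag k (sprod X Y) ∘ₗ emHomotopy k X Y)) (cls k z) =
      (-1 : k) ^ (n + 1 - i.val) • ∑ p ∈ Finset.range m, ∑ q ∈ Finset.range (m - p),
        ∑ α ∈ (Finset.range (p + q + 1)).powersetCard p,
          (-1 : k) ^ (p + q + shuffleInv α (Finset.range (p + q + 1) \ α)) •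
            ∑ l ∈ Finset.range (m + 2), gmSummand k X Y n i
              (cls k (frontFace
                (pairSimplex (pull x (m + 1) (stepX p q α)) (pull y (m + 1) (stepY p q α))) l) ⊗ₜ[k]
              cls k (backFace
                (pairSimplex (pull x (m + 1) (stepX p q α)) (pull y (m + 1) (stepY p q α))) l)) := by
    intro i
    rw [LinearMap.smul_apply, LinearMap.comp_apply, LinearMap.comp_apply, emHomotopy_cls k z hz]
    simp only [map_sum, map_smul, diag_cls]
    rfl
  -- The terms with `l ≥ 2` in the Gugenheim–Munkholm recursion vanish on front faces.
  have hpos : ∀ i : Fin n, ((-1 : k) ^ (n + 1 - i.succ.val) •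
      (gmSummand k X Y n i.succ ∘ₗ diag k (sprod X Y) ∘ₗ emHomotopy k X Y)) (cls k z) = 0 := by
    intro i
    rw [hterm]
    refine smul_eq_zero_of_right _ (Finset.sum_eq_zero fun p hp => Finset.sum_eq_zero fun q hq =>
      Finset.sum_eq_zero fun α hα => smul_eq_zero_of_right _ (Finset.sum_eq_zero fun l hl => ?_))
    rw [Finset.mem_powersetCard] at hα
    simp only [Finset.mem_range] at hp hq hl
    rw [gmSummand_tmul, ih' _ (by simp only [Fin.val_succ]; omega) (by omega),
      psiSum_frontFace k (isSeq_stepX hα.1 hα.2 (by omega)) (isSeq_stepY hα.1 hα.2 (by omega))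
        rfl rfl (by omega), psiSum_shuffle_eq_zero hα.1 hα.2 (by omega) x y
          (by simp only [Fin.val_succ]; omega) (by omega), TensorProduct.zero_tmul, map_zero, map_zero,
      smul_zero]
  rw [Fin.sum_univ_succ, Finset.sum_eq_zero fun i _ => hpos i, add_zero, hterm, Finset.smul_sum,
    Finset.smul_sum]
  refine Finset.sum_congr rfl fun p hp => ?_
  rw [Finset.smul_sum, Finset.smul_sum]
  refine Finset.sum_congr rfl fun q hq => ?_
  simp only [Finset.mem_range] at hp hq
  have hα' : ∀ α ∈ (Finset.range (p + q + 1)).powersetCard p,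
      (-1 : k) ^ (p + q + shuffleInv α (Finset.range (p + q + 1) \ α)) •
            ∑ l ∈ Finset.range (m + 2), gmSummand k X Y n 0
              (cls k (frontFace
                (pairSimplex (pull x (m + 1) (stepX p q α)) (pull y (m + 1) (stepY p q α))) l) ⊗ₜ[k]
              cls k (backFace
                (pairSimplex (pull x (m + 1) (stepX p q α)) (pull y (m + 1) (stepY p q α))) l)) =
      ∑ l ∈ Finset.range (m + 2),
        ((-1 : k) ^ (p + q + shuffleInv α (Finset.range (p + q + 1) \ α)) * (-1) ^ (l * n)) •
        consT k (n + 1)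
        (∑ a ∈ Finset.range (l + 1), vcls k x ((List.range' 0 (a + 1)).map (stepX p q α)) ⊗ₜ[k]
          vcls k y ((List.range' a (l - a + 1)).map (stepY p q α)))
        (psiSum k (n + 1) x y (fun i => stepX p q α (l + i)) (fun i => stepY p q α (l + i))
          (m + 1 - l)) := by
    intro α hα
    rw [Finset.mem_powersetCard] at hα
    rw [Finset.smul_sum]
    refine Finset.sum_congr rfl fun l hl => ?_
    rw [Finset.mem_range] at hl
    have hX := isSeq_stepX hα.1 hα.2 (show p + q < m by omega)
    have hY := isSeq_stepY hα.1 hα.2 (show p + q < m by omega)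
    rw [gmSummand_zero_tmul, alexanderWhitney_frontFace k hX hY rfl rfl (by omega),
      ih' (n + 1) (by omega) (by omega), psiSum_backFace k hX hY rfl rfl (by omega), smul_smul]
  rw [Finset.sum_congr rfl hα', sum_shuffles k (by omega) x y n
    (fun α l => (-1 : k) ^ (p + q + shuffleInv α (Finset.range (p + q + 1) \ α)) * (-1) ^ (l * n)),
    Finset.smul_sum, Finset.smul_sum]
  refine Finset.sum_congr rfl fun a ha => ?_
  rw [Finset.mem_range] at ha
  rw [smul_smul, smul_smul, shuffleInv_corner (by omega)]
  congr 1
  simp only [Fin.val_zero, Nat.sub_zero]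
  rw [← pow_add, ← pow_succ', ← pow_add]
  apply neg_one_pow_congr
  obtain ⟨d, rfl⟩ := Nat.exists_eq_add_of_le (show a ≤ p by omega)
  rw [Nat.add_sub_cancel_left]
  -- On the left stand the two signs of the recursion, the sign of `h` with `d * (q + 1)`
  -- inversions, and the Koszul sign for the front face of dimension `a + q + 1`.
  have : n + 1 + 1 + (a + d + q + d * (q + 1) + (a + q + 1) * n) =
      (1 + ((q + 1) * (d + 1) + (a + d) + (a + q) * n)) + 2 * n := by ring
  rw [this]
  simp [Nat.even_add]

end Comparison

/-! ### Lengths of intervals by label -/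

section Lengths

/-- The sum of the lengths of the intervals with label `j`. -/
def labLen (j : ℕ) (L : List Iv) : ℕ := (L.map fun I => if I.lab = j then I.len else 0).sum

/-- The sum of the lengths of all intervals. -/
def totLen (L : List Iv) : ℕ := (L.map Iv.len).sum

theorem labLen_cons (j : ℕ) (I : Iv) (L : List Iv) :
    labLen j (I :: L) = (if I.lab = j then I.len else 0) + labLen j L := by
  simp [labLen]

theorem totLen_cons (I : Iv) (L : List Iv) : totLen (I :: L) = I.len + totLen L := by
  simp [totLen]

theorem totLen_add {U : List (ℕ × Bool)} {s m : ℕ} {L : List Iv} (h : L ∈ cutL U s m) :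
    totLen L + s = m + U.countP (·.2) := by
  induction U generalizing s L with
  | nil =>
    obtain ⟨rfl, rfl⟩ := mem_cutL_nil.mp h
    simp [totLen]
  | cons a U ih =>
    obtain ⟨e, h1, h2, L', hL', rfl⟩ := mem_cutL_cons.mp h
    have := ih hL'
    rw [totLen_cons, List.countP_cons]
    simp only [Iv.len]
    split_ifs <;> omega

/-- An interval has one vertex more than `hi - lo`; for inner intervals the extra 1 in `len`
accounts for it. If the label has exactly one final interval, `labLen` is therefore the dimension of
the piece, hence the degree of any homogeneous cochain not vanishing on it. -/
theorem dv_length_eq (j : ℕ) (L : List Iv) :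
    (dv j L).length = labLen j L + (L.map Iv.key).count (j, false) := by
  induction L with
  | nil => rfl
  | cons I L ih =>
    rw [dv_cons, List.length_append, ih, labLen_cons, List.map_cons, List.count_cons]
    obtain ⟨l, b, lo, hi⟩ := I
    by_cases h : l = j <;> cases b <;> simp [Iv.key, Iv.len, Iv.verts, h] <;> omega

theorem sum_labLen (S : Finset ℕ) (L : List Iv) :
    ∑ j ∈ S, labLen j L = (L.map fun I => if I.lab ∈ S then I.len else 0).sum := by
  induction L with
  | nil => simp [labLen]
  | cons I L ih =>
    simp only [labLen_cons, Finset.sum_add_distrib, ih, List.map_cons, List.sum_cons,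
      Finset.sum_ite_eq]

theorem sum_labLen_eq_lenBelow {S : Finset ℕ} {L : List Iv} {j : ℕ}
    (h : ∀ I ∈ L, (I.lab ∈ S ↔ I.lab < j)) : ∑ i ∈ S, labLen i L = lenBelow j L := by
  rw [sum_labLen, lenBelow]
  congr 1
  exact List.map_congr_left fun I hI => by simp only [h I hI]

theorem sum_labLen_eq_totLen {S : Finset ℕ} {L : List Iv} (h : ∀ I ∈ L, I.lab ∈ S) :
    ∑ i ∈ S, labLen i L = totLen L := by
  rw [sum_labLen, totLen]
  congr 1
  exact List.map_congr_left fun I hI => by rw [if_pos (h I hI)]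

theorem crossInv_eq_mul {A B : List Iv} {j : ℕ}
    (h : ∀ I ∈ A, I.lab = j ∨ lenBelow I.lab B = 0) :
    crossInv A B = labLen j A * lenBelow j B := by
  induction A with
  | nil => simp [crossInv, labLen]
  | cons I A ih =>
    rw [crossInv_cons, labLen_cons, ih fun J hJ => h J (by simp [hJ]), add_mul]
    congr 1
    split_ifs with hI
    · rw [hI]
    · rw [(h I (by simp)).resolve_left hI, mul_zero, zero_mul]

theorem labLen_move {r : ℕ → ℕ} (c j : ℕ) {L : List Iv} {j' : ℕ}
    (h : ∀ I ∈ L, (r I.lab = j' ↔ I.lab = j)) : labLen j' (L.map (Iv.move r c)) = labLen j L := by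
  simp only [labLen, List.map_map]
  congr 1
  apply List.map_congr_left
  intro I hI
  simp only [Function.comp, Iv.len_move]
  simp only [Iv.move, h I hI]

theorem totLen_move (r : ℕ → ℕ) (c : ℕ) (L : List Iv) :
    totLen (L.map (Iv.move r c)) = totLen L := by
  simp only [totLen, List.map_map]
  congr 1
  exact List.map_congr_left fun I _ => Iv.len_move r c I

theorem labLen_le_totLen (j : ℕ) (L : List Iv) : labLen j L ≤ totLen L := by
  induction L with
  | nil => simp [labLen, totLen]
  | cons I L ih =>
    rw [labLen_cons, totLen_cons]
    split_ifs <;> omega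

/-- Moving the smallest label `v` behind all other labels, while keeping the order of the latter,
complements the inversions that involve `v`. -/
theorem pe_move_add_pe {v : ℕ} {r : ℕ → ℕ} (c : ℕ) {L : List Iv} (h1 : ∀ I ∈ L, v ≤ I.lab)
    (h2 : ∀ I ∈ L, I.lab ≠ v → r I.lab < r v)
    (h3 : L.Pairwise fun I J => I.lab ≠ v → J.lab ≠ v → I.lab ≤ J.lab ∧ r I.lab ≤ r J.lab) :
    pe (L.map (Iv.move r c)) + pe L = labLen v L * (totLen L - labLen v L) := by
  induction L with
  | nil => rfl
  | cons I L ih =>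
    rw [List.pairwise_cons] at h3
    have ih' := ih (fun J hJ => h1 J (by simp [hJ])) (fun J hJ => h2 J (by simp [hJ])) h3.2
    rw [List.map_cons, pe_cons, pe_cons, Iv.len_move]
    have hle := labLen_le_totLen v L
    -- A leading interval with label `v` has inversions only after the move, with everything that
    -- has another label; any other leading interval has them only before the move, with the later
    -- intervals labelled `v`.
    by_cases hI : I.lab = v
    · have e1 : lenBelow I.lab L = 0 := lenBelow_eq_zero fun J hJ => by
        rw [hI]
        exact h1 J (by simp [hJ])
      have e2 : lenBelow (I.move r c).lab (L.map (Iv.move r c)) + labLen v L = totLen L := by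
        have hL : ∀ J ∈ L, J.lab ≠ v → r J.lab < r v := fun J hJ => h2 J (by simp [hJ])
        simp only [Iv.move, hI]
        clear ih ih' h1 h2 h3 e1 hle
        induction L with
        | nil => rfl
        | cons J L ih =>
          rw [List.map_cons, lenBelow_cons, labLen_cons, totLen_cons]
          have := ih fun K hK => hL K (by simp [hK])
          have h4 := hL J (by simp)
          change (if r J.lab < r v then (J.move r c).len else 0) + _ + _ = _
          rw [Iv.len_move]
          by_cases hJ : J.lab = v
          · rw [if_neg (by rw [hJ]; omega), if_pos hJ]
            omega
          · rw [if_pos (h4 hJ), if_neg hJ]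
            omega
      rw [e1, labLen_cons, totLen_cons, if_pos hI,
        show I.len + totLen L - (I.len + labLen v L) = totLen L - labLen v L by omega, add_mul,
        ← ih', ← e2, Nat.add_sub_cancel]
      ring
    · have e1 : lenBelow I.lab L = labLen v L := by
        rw [lenBelow, labLen]
        congr 1
        refine List.map_congr_left fun J hJ => ?_
        have hv := h1 I (by simp)
        by_cases hJv : J.lab = v
        · rw [if_pos hJv, if_pos (by omega)]
        · have := (h3.1 J hJ hI hJv).1
          rw [if_neg hJv, if_neg (by omega)]
      have e2 : lenBelow (I.move r c).lab (L.map (Iv.move r c)) = 0 := by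
        refine lenBelow_eq_zero fun J' hJ' => ?_
        obtain ⟨J, hJ, rfl⟩ := List.mem_map.mp hJ'
        change r I.lab ≤ r J.lab
        by_cases hJv : J.lab = v
        · rw [hJv]
          exact (h2 I (by simp) hI).le
        · exact (h3.1 J hJ hI hJv).2
      rw [e1, e2, labLen_cons, totLen_cons, if_neg hI, zero_add,
        show I.len + totLen L - labLen v L = I.len + (totLen L - labLen v L) by omega, mul_add,
        ← ih']
      ring

end Lengths

/-! ### Counting final letters -/

section Counts

theorem pairwise_blockW (v r : ℕ) {w : ℕ → ℕ} (hw : Monotone w) :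
    (blockW v w r).Pairwise fun a b => a.1 ≠ v → b.1 ≠ v → a.1 ≤ b.1 := by
  induction r generalizing w with
  | zero => simp [blockW]
  | succ r ih =>
    rw [blockW_succ, List.pairwise_cons, List.pairwise_cons]
    refine ⟨fun _ _ h => absurd rfl h, fun b hb _ h => ?_, ih fun a b h => hw (by omega)⟩
    rcases mem_blockW hb with hb | ⟨c, _, hb⟩
    · exact absurd hb h
    · rw [hb]
      exact hw (Nat.zero_le _)

theorem count_odd_block (t i r : ℕ) : (block t i r).count (2 * t + 1, false) = 1 := by
  induction r generalizing i with
  | zero => simp [block, blockW]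
  | succ r ih =>
    rw [block_succ, List.count_cons, List.count_cons, ih]
    simp
    omega

theorem count_even_block (t i r c : ℕ) :
    (block t i r).count (2 * c + 2, false) = if i ≤ c ∧ c < i + r then 1 else 0 := by
  induction r generalizing i with
  | zero =>
    rw [if_neg (by omega), List.count_eq_zero]
    simp [block, blockW]
    omega
  | succ r ih =>
    rw [block_succ, List.count_cons, List.count_cons, ih]
    have : ¬ ((2 * t + 1, true) == (2 * c + 2, false)) = true := by simp
    rw [if_neg this]
    simp only [beq_iff_eq, Prod.mk.injEq, and_true]
    split_ifs <;> omega

theorem count_even_word (t i c : ℕ) (js : List ℕ) :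
    (word t i js).count (2 * c + 2, false) = if i ≤ c ∧ c < i + js.sum then 1 else 0 := by
  induction js generalizing t i with
  | nil =>
    rw [if_neg (by simp), word_nil, List.count_nil]
  | cons r js ih =>
    rw [word_cons, List.count_append, count_even_block, ih, List.sum_cons]
    split_ifs <;> omega

end Counts

/-! ### Signs with integer exponents -/

section Signs

variable (k : Type v) [CommRing k]

theorem sgn_add (x y : ℤ) : sgn k (x + y) = sgn k x * sgn k y := by
  simp [sgn, Int.negOnePow_add]

theorem sgn_natCast (n : ℕ) : sgn k n = (-1) ^ n := by
  simp [sgn, Int.negOnePow_def]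

theorem sgn_congr {x y : ℤ} (h : Even (x - y)) : sgn k x = sgn k y := by
  rw [sgn, sgn, (Int.negOnePow_eq_iff x y).mpr h]

theorem sgn_zero : sgn k 0 = 1 := by
  simp [sgn]

/-- The sum of all products of pairs of the given integers. -/
def pairSum {n : ℕ} (p : Fin n → ℤ) : ℤ := ∑ s : Fin n, ∑ t ∈ Finset.Ioi s, p s * p t

/-- `pairSum` is determined by the sum and the sum of squares, hence independent of the order of the
entries. Pair sums in different orders can thus be compared without reindexing double sums. -/
theorem two_mul_pairSum {n : ℕ} (p : Fin n → ℤ) :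
    2 * pairSum p + ∑ s, p s ^ 2 = (∑ s, p s) ^ 2 := by
  induction n with
  | zero => simp [pairSum]
  | succ n ih =>
    have h : pairSum p = p 0 * ∑ s : Fin n, p s.succ + pairSum fun s => p s.succ := by
      rw [pairSum, Fin.sum_univ_succ]
      congr 1
      · rw [Finset.mul_sum, Fin.sum_Ioi_zero]
      · exact Finset.sum_congr rfl fun s _ => by rw [Fin.sum_Ioi_succ]
    have := ih fun s => p s.succ
    rw [h, Fin.sum_univ_succ, Fin.sum_univ_succ]
    linear_combination this

end Signs

/-! ### Cup products and operations `E_r` on faces `x(s…e)` -/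

section Values

variable {k : Type v} [CommRing k] {X : SSet.{u}} {m : ℕ}

theorem GradedCochain.IsHomogeneous.length_eq {a : GradedCochain k X} (ha : a.IsHomogeneous)
    (x : X _⦋m⦌) {l : List ℕ} (h : a.val (vcls k x l) ≠ 0) : ((l.length - 1 : ℕ) : ℤ) = a.deg := by
  by_contra hne
  exact h (ha _ _ hne)

theorem GradedCochain.IsHomogeneous.labLen_eq {a : GradedCochain k X} (ha : a.IsHomogeneous)
    (x : X _⦋m⦌) {L : List Iv} {j : ℕ} (hj : (L.map Iv.key).count (j, false) = 1)
    (h : a.val (vcls k x (dv j L)) ≠ 0) : (labLen j L : ℤ) = a.deg := by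
  rw [← ha.length_eq x h, dv_length_eq, hj, Nat.add_sub_cancel]

theorem vcls_range'_vcls (x : X _⦋m⦌) {s e : ℕ} (hem : e ≤ m) (hse : s ≤ e) {l : List ℕ}
    (hl : l.Pairwise (· ≤ ·)) (hb : ∀ i ∈ l, i ≤ e - s) (hne : l ≠ []) :
    vcls k (pull x (e - s) fun i => s + i) l = vcls k x (l.map (· + s)) := by
  rw [vcls_pull k x (fun i j h _ => by omega) (fun i hi => by omega) hl hb hne]
  congr 1
  exact List.map_congr_left fun i _ => Nat.add_comm s i

theorem diag_vcls_range' (x : X _⦋m⦌) {s : ℕ} (hs : s ≤ m) :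
    diag k X (vcls k x (List.range' s (m - s + 1))) =
      ∑ e ∈ Finset.Icc s m, vcls k x (List.range' s (e - s + 1)) ⊗ₜ[k]
        vcls k x (List.range' e (m - e + 1)) := by
  rw [vcls_range', diag_cls]
  refine Finset.sum_nbij' (fun l => s + l) (fun e => e - s) ?_ ?_ ?_ ?_ ?_
  · intro l hl
    simp only [Finset.mem_range, Finset.mem_Icc] at *
    omega
  · intro e he
    simp only [Finset.mem_range, Finset.mem_Icc] at *
    omega
  · intro l _
    simp
  · intro e he
    simp only [Finset.mem_Icc] at he
    omega
  · intro l hl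
    rw [Finset.mem_range] at hl
    rw [cls_frontFace, cls_backFace, vcls_range'_vcls x le_rfl hs (pairwise_le_range' _ _) _ (by simp),
      vcls_range'_vcls x le_rfl hs (pairwise_le_range' _ _) _ (by simp)]
    · congr 2
      · rw [show (fun i => i + s) = (fun i => s + i) from funext fun i => Nat.add_comm i s,
          List.map_add_range']
        congr 1
        omega
      · rw [show (fun i => i + s) = (fun i => s + i) from funext fun i => Nat.add_comm i s,
          List.map_add_range']
        congr 1
        omega
    · intro i hi
      rw [List.mem_range'_1] at hi
      omega
    · intro i hi
      rw [List.mem_range'_1] at hi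
      omega

theorem cup_vcls_range' (f g : GradedCochain k X) (x : X _⦋m⦌) {s : ℕ} (hs : s ≤ m) :
    (cup f g).val (vcls k x (List.range' s (m - s + 1))) = sgn k (f.deg * g.deg) *
      ∑ e ∈ Finset.Icc s m, f.val (vcls k x (List.range' s (e - s + 1))) *
        g.val (vcls k x (List.range' e (m - e + 1))) := by
  simp only [cup, transpose, zero_mul, sgn_zero, one_smul, LinearMap.comp_apply,
    diag_vcls_range' x hs, dualTensorTwo, LinearMap.smul_apply, map_sum,
    TensorProduct.dualDistrib_apply, smul_eq_mul, Finset.mul_sum]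

theorem decorate_surjE (r : ℕ) : decorate (surjE r) = blockW 1 (fun c => c + 2) r :=
  decorate_block 1 (fun a b h => by simpa using h) (fun c => by omega) r

theorem mem_surjE {r j : ℕ} (h : j ∈ surjE r) : ∃ i < r + 1, j = i + 1 := by
  simp only [surjE, List.mem_cons, List.mem_flatMap, List.mem_range, List.not_mem_nil, or_false] at h
  rcases h with rfl | ⟨i, hi, rfl | rfl⟩
  · exact ⟨0, by omega, rfl⟩
  · exact ⟨i + 1, by omega, rfl⟩
  · exact ⟨0, by omega, rfl⟩

theorem hgaE_vcls_range' {r : ℕ} (a : GradedCochain k X) (b : Fin r → GradedCochain k X)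
    (x : X _⦋m⦌) {s e : ℕ} (hse : s ≤ e) (hem : e ≤ m) :
    (hgaE a b).val (vcls k x (List.range' s (e - s + 1))) =
      sgn k (r * (a.deg + ∑ c, (b c).deg) +
        pairSum (Fin.cons a.deg fun c => (b c).deg : Fin (r + 1) → ℤ)) *
      ∑ A ∈ cutL (blockW 1 (fun c => c + 2) r) 0 (e - s), (-1) ^ (pe A + po A) *
        (a.val (vcls k x ((dv 1 A).map (· + s))) *
          ∏ c : Fin r, (b c).val (vcls k x ((dv (c.val + 2) A).map (· + s)))) := by
  have hdeg : ∀ i, (Fin.cons (α := fun _ => GradedCochain k X) a b i).deg =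
      (Fin.cons a.deg fun c => (b c).deg : Fin (r + 1) → ℤ) i :=
    fun i => Fin.cases rfl (fun _ => rfl) i
  rw [hgaE, vcls_range']
  simp only [transpose, LinearMap.smul_apply, LinearMap.comp_apply, hgcE, smul_eq_mul]
  rw [intervalCut_cls, decorate_surjE, dualTensor]
  · simp only [hdeg, map_sum, map_smul, LinearMap.smul_apply, PiTensorProduct.dualDistrib_apply,
      smul_eq_mul]
    rw [sgn_add, mul_assoc, Fin.sum_univ_succ]
    simp only [Fin.cons_zero, Fin.cons_succ, pairSum, Finset.mul_sum]
    refine Finset.sum_congr rfl fun A hA => ?_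
    rw [Fin.prod_univ_succ]
    simp only [Fin.cons_zero, Fin.cons_succ, Fin.val_zero, Fin.val_succ]
    have hv : ∀ j, j ∈ surjE r → vcls k (pull x (e - s) fun i => s + i) (dv j A) =
        vcls k x ((dv j A).map (· + s)) := by
      intro j hj
      refine vcls_range'_vcls x hem hse (dv_sorted hA j).1 (fun i hi => ((dv_sorted hA j).2 i hi).2)
        (dv_ne_nil ?_)
      rw [map_key_of_mem hA, ← decorate_surjE, decorate_map_fst]
      exact hj
    rw [hv _ (by simp [surjE])]
    rw [Finset.prod_congr rfl fun c _ => by rw [hv (c.val + 1 + 1) (by simp [surjE])]]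
    ring
  · intro y j hj h
    obtain ⟨i, hi, rfl⟩ := mem_surjE hj
    exact MultilinearMap.map_coord_zero _ (⟨i, hi⟩ : Fin (r + 1)) h

end Values

/-! ### Relabelling `(1, 2, 1, …, r + 1, 1)` as a block of `u(j)` -/

section Blocks

theorem map_move_mem_cutL (r : ℕ → ℕ) (c : ℕ) {U : List (ℕ × Bool)} {s m : ℕ} {L : List Iv}
    (h : L ∈ cutL U s m) :
    L.map (Iv.move r c) ∈ cutL (U.map fun a => (r a.1, a.2)) (s + c) (m + c) := by
  induction U generalizing s L with
  | nil =>
    obtain ⟨rfl, rfl⟩ := mem_cutL_nil.mp h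
    exact mem_cutL_nil.mpr ⟨rfl, rfl⟩
  | cons a U ih =>
    obtain ⟨e, h1, h2, L', hL', rfl⟩ := mem_cutL_cons.mp h
    exact mem_cutL_cons.mpr ⟨e + c, by omega, by omega, _, ih hL', rfl⟩

theorem lab_of_mem_cutL {U : List (ℕ × Bool)} {s m : ℕ} {L : List Iv} (hL : L ∈ cutL U s m) {I : Iv}
    (hI : I ∈ L) : I.key ∈ U := by
  rw [← map_key_of_mem hL]
  exact List.mem_map_of_mem hI

/-- The relabelling of the surjection `(1, 2, 1, 3, …, 1, r + 1, 1)` as a block. -/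
def blockLab (t i j : ℕ) : ℕ := if j = 1 then 2 * t + 1 else 2 * (i + (j - 2)) + 2

theorem map_blockLab (t i r : ℕ) :
    ((blockW 1 (fun c => c + 2) r).map fun a => (blockLab t i a.1, a.2)) = block t i r := by
  simp only [blockW, block, List.map_cons, List.map_flatMap, List.map_nil]
  simp [blockLab]
  rfl

theorem lab_blockW {s m r : ℕ} {L : List Iv} (hL : L ∈ cutL (blockW 1 (fun c => c + 2) r) s m)
    {I : Iv} (hI : I ∈ L) : I.lab = 1 ∨ 2 ≤ I.lab := by
  rcases mem_blockW (lab_of_mem_cutL hL hI) with h | ⟨c, _, h⟩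
  · exact Or.inl h
  · right
    change I.lab = _ at h
    omega

theorem lab_block {t i s m r : ℕ} {L : List Iv} (hL : L ∈ cutL (block t i r) s m)
    {I : Iv} (hI : I ∈ L) : I.lab = 2 * t + 1 ∨ ∃ c, i ≤ c ∧ c < i + r ∧ I.lab = 2 * c + 2 :=
  mem_block (lab_of_mem_cutL hL hI)

theorem totLen_block {t i r s e : ℕ} {A : List Iv} (hA : A ∈ cutL (block t i r) s e) :
    totLen A = labLen (2 * t + 1) A + ∑ c ∈ Finset.Ico i (i + r), labLen (2 * c + 2) A := by
  rw [← sum_labLen_eq_totLen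
    (S := insert (2 * t + 1) ((Finset.Ico i (i + r)).image fun c => 2 * c + 2)),
    Finset.sum_insert, Finset.sum_image]
  · intro c _ c' _ h
    dsimp only at h
    omega
  · simp only [Finset.mem_image, not_exists, not_and]
    intro c _ h
    omega
  · intro I hI
    rw [Finset.mem_insert, Finset.mem_image]
    rcases lab_block hA hI with h | ⟨c, h1, h2, h3⟩
    · exact Or.inl h
    · exact Or.inr ⟨c, by rw [Finset.mem_Ico]; omega, h3.symm⟩

/-- As `i + r ≤ t`, the new labels of the `b`'s lie below `2 * t + 1`: the smallest label `1`
becomes the largest, and the others keep their order. -/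
theorem pe_block_move {t i r s e c : ℕ} (hir : i + r ≤ t) {A : List Iv}
    (hA : A ∈ cutL (blockW 1 (fun c => c + 2) r) s e) :
    pe (A.map (Iv.move (blockLab t i) c)) + pe A = labLen 1 A * (totLen A - labLen 1 A) := by
  have hlt : ∀ I ∈ A, I.lab ≠ 1 → I.lab < r + 2 := by
    intro I hI h
    rcases mem_blockW (lab_of_mem_cutL hA hI) with h' | ⟨c, hc, h'⟩
    · exact absurd h' h
    · change I.lab = _ at h'
      omega
  refine pe_move_add_pe c (fun I hI => ?_) (fun I hI h => ?_) ?_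
  · rcases lab_blockW hA hI with h | h <;> omega
  · have := hlt I hI h
    have := (lab_blockW hA hI).resolve_left h
    rw [blockLab, blockLab, if_neg h, if_pos rfl]
    omega
  · have h := pairwise_blockW 1 r (w := fun c => c + 2) fun a b h => by simpa using h
    rw [← map_key_of_mem hA, List.pairwise_map] at h
    refine h.imp fun {I J} h hI hJ => ?_
    have h' : I.lab ≤ J.lab := h hI hJ
    rw [blockLab, blockLab, if_neg hI, if_neg hJ]
    omega

end Blocks

/-! ### Evaluation of a single block -/

section Evaluation

variable {k : Type v} [CommRing k] {X : SSet.{u}} {m : ℕ} (a b : ℕ → GradedCochain k X)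

/-- The sum of the degrees of `b i, …, b (i + r - 1)`. -/
def degB (i r : ℕ) : ℤ := ∑ c ∈ Finset.Ico i (i + r), (b c).deg

/-- The sum of all products of pairs of degrees of `a t, b i, …, b (i + r - 1)`. -/
def blockPairs (t i r : ℕ) : ℤ :=
  pairSum (Fin.cons (a t).deg fun c : Fin r => (b (i + c.val)).deg : Fin (r + 1) → ℤ)

theorem prod_univ_eq_Ico {M : Type*} [CommMonoid M] (i r : ℕ) (f : ℕ → M) :
    ∏ c : Fin r, f (i + c.val) = ∏ c ∈ Finset.Ico i (i + r), f c := by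
  rw [Finset.prod_Ico_eq_prod_range, Nat.add_sub_cancel_left, Finset.prod_range]

theorem sum_univ_eq_Ico {M : Type*} [AddCommMonoid M] (i r : ℕ) (f : ℕ → M) :
    ∑ c : Fin r, f (i + c.val) = ∑ c ∈ Finset.Ico i (i + r), f c := by
  rw [Finset.sum_Ico_eq_sum_range, Nat.add_sub_cancel_left, Finset.sum_range]

/-- The value of `a t` on the piece with label `2 t + 1`. -/
def valA (x : X _⦋m⦌) (L : List Iv) (t : ℕ) : k := (a t).val (vcls k x (dv (2 * t + 1) L))

/-- The value of `b c` on the piece with label `2 c + 2`. -/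
def valB (x : X _⦋m⦌) (L : List Iv) (c : ℕ) : k := (b c).val (vcls k x (dv (2 * c + 2) L))

variable {a b}

theorem sum_labLen_even {x : X _⦋m⦌} {L : List Iv} {S : Finset ℕ}
    (hb : ∀ c ∈ S, (b c).IsHomogeneous) (h0 : ∏ c ∈ S, valB b x L c ≠ 0)
    (h : ∀ c ∈ S, (L.map Iv.key).count (2 * c + 2, false) = 1) :
    ((∑ c ∈ S, labLen (2 * c + 2) L : ℕ) : ℤ) = ∑ c ∈ S, (b c).deg := by
  rw [Nat.cast_sum]
  refine Finset.sum_congr rfl fun c hc => (hb c hc).labLen_eq x (h c hc) fun h1 => h0 ?_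
  exact Finset.prod_eq_zero hc h1

theorem labLen_odd {x : X _⦋m⦌} {t i r s e : ℕ} {A : List Iv} (hA : A ∈ cutL (block t i r) s e)
    (ha : (a t).IsHomogeneous) (h0 : valA a x A t ≠ 0) : (labLen (2 * t + 1) A : ℤ) = (a t).deg :=
  ha.labLen_eq x (by rw [map_key_of_mem hA, count_odd_block]) h0

theorem sum_labLen_even_block {x : X _⦋m⦌} {t i r s e : ℕ} {A : List Iv}
    (hA : A ∈ cutL (block t i r) s e) (hb : ∀ c, c < i + r → (b c).IsHomogeneous)
    (h0 : ∏ c ∈ Finset.Ico i (i + r), valB b x A c ≠ 0) :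
    ((∑ c ∈ Finset.Ico i (i + r), labLen (2 * c + 2) A : ℕ) : ℤ) = degB b i r := by
  refine sum_labLen_even (fun c hc => hb c (Finset.mem_Ico.mp hc).2) h0 fun c hc => ?_
  rw [map_key_of_mem hA, count_even_block, if_pos (Finset.mem_Ico.mp hc)]

/-- The total length of the block is the sum of the degrees, and it exceeds `e - s` by one for each
of the `r` inner intervals. -/
theorem block_sub_eq {x : X _⦋m⦌} {t i r s e : ℕ} {A : List Iv} (hA : A ∈ cutL (block t i r) s e)
    (ha : (a t).IsHomogeneous) (hb : ∀ c, c < i + r → (b c).IsHomogeneous)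
    (h0 : valA a x A t * ∏ c ∈ Finset.Ico i (i + r), valB b x A c ≠ 0) :
    (e : ℤ) = s + ((a t).deg + degB b i r) - r := by
  have h1 := labLen_odd hA ha (left_ne_zero_of_mul h0)
  have h2 := sum_labLen_even_block hA hb (right_ne_zero_of_mul h0)
  have h3 := totLen_block hA
  have h4 := totLen_add hA
  rw [block, countP_blockW] at h4
  rw [← h1, ← h2]
  omega

variable (a b)

/-- The sign exponent of the operation `E_r(a t; b i, …, b (i + r - 1))`. -/
def blockExp (t i r : ℕ) : ℤ :=
  r * ((a t).deg + degB b i r) + blockPairs a b t i r + (a t).deg * degB b i r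

variable {a b}

/-- Relabelling complements the inversions between `a t` and the `b`'s, which gives `(a t).deg *
degB b i r`. Translation by `s` moves the right endpoints of the `r` inner intervals, which gives `s
* r`. -/
theorem hgaE_vcls_block {t i r : ℕ} (hir : i + r ≤ t) (ha : (a t).IsHomogeneous)
    (hb : ∀ c, c < i + r → (b c).IsHomogeneous) (x : X _⦋m⦌) {s e : ℕ} (hse : s ≤ e) (hem : e ≤ m) :
    (hgaE (a t) fun c : Fin r => b (i + c.val)).val (vcls k x (List.range' s (e - s + 1))) =
      ∑ A ∈ cutL (block t i r) s e, sgn k (blockExp a b t i r + s * r + (pe A + po A : ℕ)) *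
        (valA a x A t * ∏ c ∈ Finset.Ico i (i + r), valB b x A c) := by
  have hs : cutL (block t i r) s e =
      cutL ((blockW 1 (fun c => c + 2) r).map fun a => (blockLab t i a.1, a.2)) (0 + s)
        (e - s + s) := by
    rw [map_blockLab, Nat.zero_add, Nat.sub_add_cancel hse]
  rw [hgaE_vcls_range' _ _ x hse hem, Finset.mul_sum, hs, sum_cutL_move]
  refine Finset.sum_congr rfl fun A hA => ?_
  have hA' : A.map (Iv.move (blockLab t i) s) ∈ cutL (block t i r) s e := by
    rw [hs]
    exact map_move_mem_cutL _ _ hA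
  have h1 : ∀ I ∈ A, (blockLab t i I.lab = 2 * t + 1 ↔ I.lab = 1) := by
    intro I hI
    have := lab_blockW hA hI
    rw [blockLab]
    split_ifs <;> omega
  have h2 : ∀ c, ∀ I ∈ A, (blockLab t i I.lab = 2 * (i + c) + 2 ↔ I.lab = c + 2) := by
    intro c I hI
    have := lab_blockW hA hI
    rw [blockLab]
    split_ifs <;> omega
  have e1 : (a t).val (vcls k x ((dv 1 A).map (· + s))) =
      valA a x (A.map (Iv.move (blockLab t i) s)) t := by
    rw [valA, dv_move s 1 h1]
  have e2 : ∏ c : Fin r, (b (i + c.val)).val (vcls k x ((dv (c.val + 2) A).map (· + s))) =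
      ∏ c ∈ Finset.Ico i (i + r), valB b x (A.map (Iv.move (blockLab t i) s)) c := by
    rw [← prod_univ_eq_Ico]
    refine Finset.prod_congr rfl fun c _ => ?_
    rw [valB, dv_move s (c.val + 2) (h2 c)]
  rw [e1, e2, ← mul_assoc]
  -- Lengths can be replaced by degrees only in a nonzero term.
  by_cases h0 : valA a x (A.map (Iv.move (blockLab t i) s)) t *
      ∏ c ∈ Finset.Ico i (i + r), valB b x (A.map (Iv.move (blockLab t i) s)) c = 0
  · rw [h0, mul_zero, mul_zero]
  congr 1
  rw [← sgn_natCast, ← sgn_add]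
  apply sgn_congr
  have h3 := labLen_odd hA' ha (left_ne_zero_of_mul h0)
  have h4 := sum_labLen_even_block hA' hb (right_ne_zero_of_mul h0)
  have h5 := totLen_block hA'
  have h6 := pe_block_move (c := s) hir hA
  have h7 := po_move (blockLab t i) s A
  rw [map_key_of_mem hA, countP_blockW] at h7
  rw [← labLen_move s 1 h1, ← totLen_move (blockLab t i) s A, h5, Nat.add_sub_cancel_left] at h6
  have h8 := congrArg (Nat.cast : ℕ → ℤ) h6
  rw [Nat.cast_mul, h3, h4, Nat.cast_add] at h8
  rw [sum_univ_eq_Ico i r fun c => (b c).deg, h7]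
  push_cast
  change Even (r * ((a t).deg + degB b i r) + blockPairs a b t i r + (pe A + po A) -
    (blockExp a b t i r + s * r + (pe (A.map (Iv.move (blockLab t i) s)) + (po A + s * r))))
  rw [blockExp]
  exact ⟨(pe A : ℤ) - (a t).deg * degB b i r - s * r, by linear_combination -h8⟩

end Evaluation

/-! ### Products of blocks -/

section Fold

variable {k : Type v} [CommRing k] {X : SSet.{u}} {m : ℕ} (a b : ℕ → GradedCochain k X)

/-- The product of the operations `E_r` for the entries `r` of a list, and of `b (n - 1)`. -/
def foldE (n t i : ℕ) (js : List ℕ) : GradedCochain k X :=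
  match js with
  | [] => b (n - 1)
  | r :: js => cup (hgaE (a t) fun c : Fin r => b (i + c.val)) (foldE n (t + 1) (i + r) js)

theorem foldr_finRange_eq_foldE {n : ℕ} (j : Fin n → ℕ) : (List.finRange n).foldr
      (fun t r => cup (hgaE (a t.val) fun i : Fin (j t) => b (partialSum j t + i.val)) r)
      (b (n - 1)) = foldE a b n 0 0 (List.ofFn j) := by
  have h : ∀ (t i : ℕ) (js : List ℕ), (triples t i js).foldr
      (fun x r => cup (hgaE (a x.1) fun c : Fin x.2.2 => b (x.2.1 + c.val)) r) (b (n - 1)) =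
        foldE a b n t i js := by
    intro t i js
    induction js generalizing t i with
    | nil => rfl
    | cons r js ih => rw [triples, List.foldr_cons, ih, foldE]
  rw [← h, ← map_finRange_eq_triples, List.foldr_map]

/-- The sum of the degrees of all variables in `foldE`. -/
def tailDeg (n t i : ℕ) (js : List ℕ) : ℤ :=
  match js with
  | [] => (b (n - 1)).deg
  | r :: js => (a t).deg + degB b i r + tailDeg n (t + 1) (i + r) js

theorem hgaE_deg (t i r : ℕ) :
    (hgaE (a t) fun c : Fin r => b (i + c.val)).deg = (a t).deg + degB b i r - r := by
  simp only [hgaE, Fin.sum_univ_succ, Fin.cons_zero, Fin.cons_succ]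
  rw [sum_univ_eq_Ico i r fun c => (b c).deg]
  rfl

theorem foldE_deg (n t i : ℕ) (js : List ℕ) :
    (foldE a b n t i js).deg = tailDeg a b n t i js - js.sum := by
  induction js generalizing t i with
  | nil => simp [foldE, tailDeg]
  | cons r js ih =>
    rw [foldE, cup, hgaE_deg, ih, tailDeg, List.sum_cons]
    push_cast
    ring

/-- The sign exponent of `foldE`. -/
def foldExp (n t i : ℕ) (js : List ℕ) : ℤ :=
  match js with
  | [] => 0
  | r :: js => ((a t).deg + degB b i r - r) * tailDeg a b n (t + 1) (i + r) js +
      blockExp a b t i r + (a t).deg * ∑ c ∈ Finset.Ico (i + r) t, (b c).deg +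
      foldExp n (t + 1) (i + r) js

/-- The tuples for which every block only contains variables `b c` with `c < t`. -/
def AdmFrom (t i : ℕ) (js : List ℕ) : Prop :=
  match js with
  | [] => True
  | r :: js => i + r ≤ t ∧ AdmFrom (t + 1) (i + r) js

theorem admFrom_of_mem {n : ℕ} {js : List ℕ} (h : js ∈ admLists n) : AdmFrom 0 0 js := by
  have H : ∀ (t i : ℕ) (js : List ℕ), (∀ e < js.length, i + (js.take (e + 1)).sum < t + e + 1) →
      AdmFrom t i js := by
    intro t i js
    induction js generalizing t i with
    | nil => intro _; trivial
    | cons r js ih =>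
      intro h
      refine ⟨?_, ih _ _ fun e he => ?_⟩
      · have := h 0 (by simp)
        simp at this
        omega
      · have := h (e + 1) (by simp; omega)
        rw [List.take_succ_cons, List.sum_cons] at this
        omega
  obtain ⟨h1, _, h3⟩ := mem_admLists.mp h
  refine H 0 0 js fun e he => ?_
  have := h3 e (by omega)
  omega

/-- The product of the values of the variables in `foldE` on the pieces of a subdivision. -/
def foldVal (n : ℕ) (x : X _⦋m⦌) (t i : ℕ) (js : List ℕ) (L : List Iv) : k :=
  (∏ τ ∈ Finset.Ico t (t + js.length), valA a x L τ) *
    ((∏ c ∈ Finset.Ico i (i + js.sum), valB b x L c) * valB b x L (n - 1))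

theorem lab_tail {n t i e : ℕ} {js : List ℕ} (hsum : i + js.sum < n) {B : List Iv}
    (hB : B ∈ cutL (word t i js ++ [(2 * n, false)]) e m) {I : Iv} (hI : I ∈ B) :
    (∃ τ, t ≤ τ ∧ I.lab = 2 * τ + 1) ∨ ∃ c, i ≤ c ∧ I.lab = 2 * c + 2 := by
  have := lab_of_mem_cutL hB hI
  rw [List.mem_append, List.mem_singleton] at this
  rcases this with h | h
  · rcases mem_word h with ⟨τ, h1, _, h3⟩ | ⟨c, h1, _, h3⟩
    · exact Or.inl ⟨τ, h1, h3⟩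
    · exact Or.inr ⟨c, h1, h3⟩
  · refine Or.inr ⟨n - 1, by omega, ?_⟩
    have : I.lab = 2 * n := congrArg Prod.fst h
    omega

/-- The block and the tail of the word have no label in common, so each piece lies entirely in `A`
or in `B`. -/
theorem foldVal_append {n t i r : ℕ} (hir : i + r ≤ t) {js : List ℕ}
    (hlen : t + 1 + js.length = n) (hsum : i + r + js.sum = n - 1) (x : X _⦋m⦌) {s e : ℕ}
    {A B : List Iv} (hA : A ∈ cutL (block t i r) s e)
    (hB : B ∈ cutL (word (t + 1) (i + r) js ++ [(2 * n, false)]) e m) :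
    foldVal a b n x t i (r :: js) (A ++ B) =
      (valA a x A t * ∏ c ∈ Finset.Ico i (i + r), valB b x A c) *
        foldVal a b n x (t + 1) (i + r) js B := by
  have hlabB := fun I (hI : I ∈ B) => lab_tail (by omega) hB hI
  have hA1 : ∀ τ, t + 1 ≤ τ → dv (2 * τ + 1) A = [] := fun τ hτ => dv_eq_nil fun I hI => by
    rcases lab_block hA hI with h | ⟨c, _, _, h⟩ <;> omega
  have hA2 : ∀ c, i + r ≤ c → dv (2 * c + 2) A = [] := fun c hc => dv_eq_nil fun I hI => by
    rcases lab_block hA hI with h | ⟨c', _, _, h⟩ <;> omega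
  have hB1 : dv (2 * t + 1) B = [] := dv_eq_nil fun I hI => by
    rcases hlabB I hI with ⟨c, _, h⟩ | ⟨c, _, h⟩ <;> omega
  have hB2 : ∀ c, c < i + r → dv (2 * c + 2) B = [] := fun c hc => dv_eq_nil fun I hI => by
    rcases hlabB I hI with ⟨c, _, h⟩ | ⟨c, _, h⟩ <;> omega
  have f1 : valA a x (A ++ B) t = valA a x A t := by
    rw [valA, valA, dv_append, hB1, List.append_nil]
  have f2 : ∀ τ ∈ Finset.Ico (t + 1) (t + 1 + js.length), valA a x (A ++ B) τ = valA a x B τ := by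
    intro τ hτ
    rw [valA, valA, dv_append, hA1 τ (Finset.mem_Ico.mp hτ).1, List.nil_append]
  have f3 : ∀ c ∈ Finset.Ico i (i + r), valB b x (A ++ B) c = valB b x A c := by
    intro c hc
    rw [valB, valB, dv_append, hB2 c (Finset.mem_Ico.mp hc).2, List.append_nil]
  have f4 : ∀ c, i + r ≤ c → valB b x (A ++ B) c = valB b x B c := by
    intro c hc
    rw [valB, valB, dv_append, hA2 c hc, List.nil_append]
  rw [foldVal, foldVal, List.length_cons, List.sum_cons, f4 (n - 1) (by omega),
    Finset.prod_eq_prod_Ico_succ_bot (by omega), f1,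
    ← Finset.prod_Ico_consecutive _ (show i ≤ i + r by omega)
      (show i + r ≤ i + (r + js.sum) by omega), Finset.prod_congr rfl f3,
    show t + (js.length + 1) = t + 1 + js.length by omega, Finset.prod_congr rfl f2,
    ← Nat.add_assoc i r, Finset.prod_congr rfl fun c hc => f4 c (Finset.mem_Ico.mp hc).1]
  ring

/-- Of the letters in the block only `2 * t + 1` has smaller letters in the tail, namely `2 * c + 2`
for `i + r ≤ c < t`. -/
theorem crossInv_block {n t i r : ℕ} (hir : i + r ≤ t) {js : List ℕ}
    (hlen : t + 1 + js.length = n) (hsum : i + r + js.sum = n - 1) {x : X _⦋m⦌} {s e : ℕ}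
    {A B : List Iv} (hA : A ∈ cutL (block t i r) s e)
    (hB : B ∈ cutL (word (t + 1) (i + r) js ++ [(2 * n, false)]) e m)
    (ha : (a t).IsHomogeneous) (hb : ∀ c < n, (b c).IsHomogeneous)
    (hA0 : valA a x A t ≠ 0)
    (hB0 : ∏ c ∈ Finset.Ico (i + r) (i + r + js.sum), valB b x B c ≠ 0) :
    (crossInv A B : ℤ) = (a t).deg * ∑ c ∈ Finset.Ico (i + r) t, (b c).deg := by
  have hlabB := fun I (hI : I ∈ B) => lab_tail (by omega) hB hI
  rw [crossInv_eq_mul (j := 2 * t + 1), Nat.cast_mul, labLen_odd hA ha hA0,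
    ← sum_labLen_eq_lenBelow (S := (Finset.Ico (i + r) t).image fun c => 2 * c + 2),
    Finset.sum_image, sum_labLen_even (b := b) (x := x)]
  · intro c hc
    rw [Finset.mem_Ico] at hc
    exact hb c (by omega)
  · intro h
    apply hB0
    rw [← Finset.prod_Ico_consecutive _ hir (show t ≤ i + r + js.sum by omega), h, zero_mul]
  · intro c hc
    rw [Finset.mem_Ico] at hc
    rw [map_key_of_mem hB, List.count_append, count_even_word, if_pos (by omega),
      List.count_eq_zero_of_not_mem]
    simp
    omega
  · intro c _ c' _ h
    dsimp only at h
    omega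
  · intro I hI
    simp only [Finset.mem_image, Finset.mem_Ico]
    constructor
    · rintro ⟨c, hc, h⟩
      omega
    · intro h
      rcases hlabB I hI with ⟨c, h1, h2⟩ | ⟨c, h1, h2⟩
      · omega
      · exact ⟨c, by omega, h2.symm⟩
  · intro I hI
    rcases lab_block hA hI with h | ⟨c, h1, h2, h⟩
    · exact Or.inl h
    · refine Or.inr (lenBelow_eq_zero fun J hJ => ?_)
      rcases hlabB J hJ with ⟨c, h3, h4⟩ | ⟨c, h3, h4⟩ <;> omega

/-- The induction needs the evaluation on all back faces `x(s…m)`; the term `s * js.sum` records the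
translation of the inner intervals. -/
theorem foldE_vcls {n : ℕ} (hn : 1 ≤ n) (ha : ∀ i < n, (a i).IsHomogeneous)
    (hb : ∀ i < n, (b i).IsHomogeneous) (x : X _⦋m⦌) (js : List ℕ) : ∀ t i s : ℕ,
    t + js.length = n → i + js.sum = n - 1 → AdmFrom t i js → s ≤ m →
      (foldE a b n t i js).val (vcls k x (List.range' s (m - s + 1))) =
        ∑ L ∈ cutL (word t i js ++ [(2 * n, false)]) s m,
          sgn k (foldExp a b n t i js + s * js.sum + (pe L + po L : ℕ)) *
            foldVal a b n x t i js L := by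
  induction js with
  | nil =>
    intro t i s _ _ _ hs
    rw [word_nil, List.nil_append, sum_cutL_cons,
      Finset.sum_eq_single_of_mem m (Finset.mem_Icc.mpr ⟨hs, le_rfl⟩), sum_cutL_nil, if_pos rfl]
    · have h : dv (2 * (n - 1) + 2) [(⟨2 * n, false, s, m⟩ : Iv)] = List.range' s (m - s + 1) := by
        rw [dv_cons, dv_nil, List.append_nil, if_pos (by simp only; omega)]
        rfl
      simp only [foldVal, valB, h]
      simp [foldExp, foldE, pe, po, lenBelow, sgn_zero]
    · intro e _ he
      rw [sum_cutL_nil, if_neg he]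
  | cons r js ih =>
    intro t i s hlen hsum hadm hs
    rw [List.length_cons] at hlen
    rw [List.sum_cons] at hsum
    obtain ⟨hir, hadm⟩ := hadm
    rw [foldE, cup_vcls_range' _ _ x hs, word_cons, List.append_assoc, sum_cutL_append,
      Finset.mul_sum]
    refine Finset.sum_congr rfl fun e he => ?_
    rw [Finset.mem_Icc] at he
    rw [hgaE_vcls_block hir (ha t (by omega)) (fun c hc => hb c (by omega)) x he.1 he.2,
      ih (t + 1) (i + r) e (by omega) (by omega) hadm he.2, Finset.sum_mul_sum, Finset.mul_sum]
    refine Finset.sum_congr rfl fun A hA => ?_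
    rw [Finset.mul_sum]
    refine Finset.sum_congr rfl fun B hB => ?_
    rw [foldVal_append a b hir (by omega) (by omega) x hA hB]
    by_cases h0 : (valA a x A t * ∏ c ∈ Finset.Ico i (i + r), valB b x A c) *
        foldVal a b n x (t + 1) (i + r) js B = 0
    · rw [h0, mul_zero, mul_mul_mul_comm, h0, mul_zero, mul_zero]
    have hA0 := left_ne_zero_of_mul h0
    have hB0 := right_ne_zero_of_mul h0
    rw [mul_mul_mul_comm, ← mul_assoc, ← sgn_add, ← sgn_add]
    congr 1
    apply sgn_congr
    -- Substituting for `e` in the term `e * js.sum` of the tail cancels the part of the cup product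
    -- sign that contains `js.sum`.
    have h1 := block_sub_eq hA (ha t (by omega)) (fun c hc => hb c (by omega)) hA0
    have h2 := crossInv_block a b hir (by omega) (by omega) hA hB (ha t (by omega)) hb
      (left_ne_zero_of_mul hA0) (left_ne_zero_of_mul (right_ne_zero_of_mul hB0))
    rw [hgaE_deg, foldE_deg, pe_append, po_append, foldExp, h1, List.sum_cons]
    push_cast
    rw [h2]
    -- The inversions between `A` and `B` occur on the right only, and twice: in `pe (A ++ B)` and
    -- in `foldExp`.
    refine ⟨-(a t).deg * ∑ c ∈ Finset.Ico (i + r) t, (b c).deg, ?_⟩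
    ring

end Fold

/-! ### Comparison of the signs and end of the proof -/

section Comparison

variable {k : Type v} [CommRing k] {X : SSet.{u}} {m : ℕ} (a b : ℕ → GradedCochain k X)

/-- The exponent of the Koszul sign, computed block by block. -/
def koszulFrom (t i : ℕ) (js : List ℕ) : ℤ :=
  match js with
  | [] => 0
  | r :: js => (∑ c ∈ Finset.Ico i t, (b c).deg * (a t).deg) +
      r * ((∑ τ ∈ Finset.range t, (a τ).deg) + ∑ c ∈ Finset.range i, (b c).deg) +
      koszulFrom (t + 1) (i + r) js

theorem koszulExp_eq {n : ℕ} (j : Fin n → ℕ) : koszulExp a b j = koszulFrom a b 0 0 (List.ofFn j) := by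
  have h : ∀ (t i : ℕ) (js : List ℕ), ((triples t i js).map fun x =>
      (∑ c ∈ Finset.Ico x.2.1 x.1, (b c).deg * (a x.1).deg) +
        (x.2.2 : ℤ) * ((∑ τ ∈ Finset.range x.1, (a τ).deg) +
          ∑ c ∈ Finset.range x.2.1, (b c).deg)).sum = koszulFrom a b t i js := by
    intro t i js
    induction js generalizing t i with
    | nil => rfl
    | cons r js ih => rw [triples, List.map_cons, List.sum_cons, ih, koszulFrom]
  rw [← h, ← map_finRange_eq_triples, List.map_map, koszulExp, Fin.sum_univ_def]
  rfl

/-- The sum of all products of pairs of degrees of the variables in `foldE`. -/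
def tailPairs (n t i : ℕ) (js : List ℕ) : ℤ :=
  match js with
  | [] => 0
  | r :: js => ((a t).deg + degB b i r) * tailDeg a b n (t + 1) (i + r) js + blockPairs a b t i r +
      tailPairs n (t + 1) (i + r) js

theorem two_mul_blockPairs (t i r : ℕ) : 2 * blockPairs a b t i r + (a t).deg ^ 2 +
    ∑ c ∈ Finset.Ico i (i + r), (b c).deg ^ 2 = ((a t).deg + degB b i r) ^ 2 := by
  have h := two_mul_pairSum (Fin.cons (a t).deg fun c : Fin r => (b (i + c.val)).deg :
    Fin (r + 1) → ℤ)
  simp only [Fin.sum_univ_succ, Fin.cons_zero, Fin.cons_succ] at h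
  rw [sum_univ_eq_Ico i r fun c => (b c).deg, sum_univ_eq_Ico i r fun c => (b c).deg ^ 2] at h
  rw [blockPairs, degB]
  linear_combination h

theorem tailDeg_eq (n t i : ℕ) (js : List ℕ) : tailDeg a b n t i js =
    ∑ τ ∈ Finset.Ico t (t + js.length), (a τ).deg +
      ∑ c ∈ Finset.Ico i (i + js.sum), (b c).deg + (b (n - 1)).deg := by
  induction js generalizing t i with
  | nil => simp [tailDeg]
  | cons r js ih =>
    rw [tailDeg, ih, List.length_cons, List.sum_cons, degB,
      Finset.sum_eq_sum_Ico_succ_bot (show t < t + (js.length + 1) by omega),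
      ← Finset.sum_Ico_consecutive _ (show i ≤ i + r by omega)
        (show i + r ≤ i + (r + js.sum) by omega), ← Nat.add_assoc i r,
      show t + (js.length + 1) = t + 1 + js.length by omega]
    ring

theorem two_mul_tailPairs (n t i : ℕ) (js : List ℕ) : 2 * tailPairs a b n t i js +
    ∑ τ ∈ Finset.Ico t (t + js.length), (a τ).deg ^ 2 +
      ∑ c ∈ Finset.Ico i (i + js.sum), (b c).deg ^ 2 + (b (n - 1)).deg ^ 2 =
        tailDeg a b n t i js ^ 2 := by
  induction js generalizing t i with
  | nil => simp [tailPairs, tailDeg]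
  | cons r js ih =>
    rw [tailDeg, tailPairs, List.length_cons, List.sum_cons,
      Finset.sum_eq_sum_Ico_succ_bot (show t < t + (js.length + 1) by omega),
      ← Finset.sum_Ico_consecutive _ (show i ≤ i + r by omega)
        (show i + r ≤ i + (r + js.sum) by omega), ← Nat.add_assoc i r,
      show t + (js.length + 1) = t + 1 + js.length by omega]
    linear_combination ih (t + 1) (i + r) + two_mul_blockPairs a b t i r

/-- The Koszul products of `a t` with the `b c`, `i ≤ c < t`, cancel those from the relabelling (`c
< i + r`) and from the inversions with later blocks (`i + r ≤ c`). Each `E_r` contributes `r` times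
the degrees of its own variables by transposition, of the later ones by the cup product and of the
earlier ones by the Koszul rule, altogether `r` times the total degree. -/
theorem even_foldExp (n t i : ℕ) (js : List ℕ) (h : AdmFrom t i js) :
    Even (foldExp a b n t i js + koszulFrom a b t i js -
      (js.sum * ((∑ τ ∈ Finset.range t, (a τ).deg) + (∑ c ∈ Finset.range i, (b c).deg) +
        tailDeg a b n t i js) + tailPairs a b n t i js)) := by
  induction js generalizing t i with
  | nil => simp [foldExp, koszulFrom, tailPairs]
  | cons r js ih =>
    obtain ⟨c, hc⟩ := ih (t + 1) (i + r) h.2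
    have h1 : ∑ c ∈ Finset.Ico i t, (b c).deg * (a t).deg =
        (degB b i r + ∑ c ∈ Finset.Ico (i + r) t, (b c).deg) * (a t).deg := by
      rw [degB, Finset.sum_Ico_consecutive _ (by omega) h.1, Finset.sum_mul]
    have h2 : ∑ c ∈ Finset.range (i + r), (b c).deg =
        ∑ c ∈ Finset.range i, (b c).deg + degB b i r := by
      rw [degB, Finset.range_eq_Ico, Finset.range_eq_Ico,
        Finset.sum_Ico_consecutive _ (by omega) (by omega)]
    rw [h2, Finset.sum_range_succ] at hc
    rw [foldExp, koszulFrom, tailPairs, tailDeg, h1, blockExp, List.sum_cons]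
    refine ⟨c + (a t).deg * degB b i r + (a t).deg * ∑ c ∈ Finset.Ico (i + r) t, (b c).deg -
      r * tailDeg a b n (t + 1) (i + r) js, ?_⟩
    rw [Nat.cast_add]
    linear_combination hc

/-- For a full tuple the variables are all `a i` and `b i`, and `js.sum = n - 1`, so the exponent no
longer depends on the tuple. It is the one of `phiGM`: transposition of `G_n`, then the two
canonical maps to the dual of a tensor product. -/
theorem even_foldExp_of_mem {n : ℕ} (hn : 1 ≤ n) {js : List ℕ} (hjs : js ∈ admLists n) :
    Even (foldExp a b n 0 0 js + koszulFrom a b 0 0 js -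
      (((n : ℤ) - 1) * (∑ i : Fin n, ((a i.val).deg + (b i.val).deg)) +
        (pairSum (fun i : Fin n => (a i.val).deg + (b i.val).deg) +
          ∑ i : Fin n, (a i.val).deg * (b i.val).deg))) := by
  obtain ⟨c, hc⟩ := even_foldExp a b n 0 0 js (admFrom_of_mem hjs)
  obtain ⟨h1, h2, _⟩ := mem_admLists.mp hjs
  have hlast : ∀ f : ℕ → ℤ, ∑ c ∈ Finset.Ico 0 (n - 1), f c + f (n - 1) = ∑ i : Fin n, f i.val := by
    intro f
    rw [← Finset.range_eq_Ico, ← Finset.sum_range_succ, Nat.sub_add_cancel hn, Finset.sum_range]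
  have hall : ∀ f : ℕ → ℤ, ∑ τ ∈ Finset.Ico 0 n, f τ = ∑ i : Fin n, f i.val := by
    intro f
    rw [← Finset.range_eq_Ico, Finset.sum_range]
  have e1 := tailDeg_eq a b n 0 0 js
  have e2 := two_mul_tailPairs a b n 0 0 js
  have e3 := two_mul_pairSum fun i : Fin n => (a i.val).deg + (b i.val).deg
  rw [h1, h2, Nat.zero_add, Nat.zero_add, hall] at e1 e2
  rw [add_assoc, hlast fun c => (b c).deg, ← Finset.sum_add_distrib] at e1
  rw [add_assoc, hlast fun c => (b c).deg ^ 2, e1] at e2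
  have e4 : ∑ i : Fin n, ((a i.val).deg + (b i.val).deg) ^ 2 = ∑ i : Fin n, (a i.val).deg ^ 2 +
      2 * ∑ i : Fin n, (a i.val).deg * (b i.val).deg + ∑ i : Fin n, (b i.val).deg ^ 2 := by
    rw [Finset.mul_sum, ← Finset.sum_add_distrib, ← Finset.sum_add_distrib]
    exact Finset.sum_congr rfl fun i _ => by ring
  -- Twice either side is the square of the total degree minus the sum of all squared degrees.
  have e5 : tailPairs a b n 0 0 js = pairSum (fun i : Fin n => (a i.val).deg + (b i.val).deg) +
      ∑ i : Fin n, (a i.val).deg * (b i.val).deg := by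
    linarith
  rw [e1, e5, h2] at hc
  refine ⟨c, ?_⟩
  rw [← hc]
  push_cast [hn]
  simp

theorem sgn_sum {ι : Type*} (s : Finset ι) (f : ι → ℤ) :
    sgn k (∑ i ∈ s, f i) = ∏ i ∈ s, sgn k (f i) := by
  classical
  induction s using Finset.induction_on with
  | empty => simp [sgn_zero]
  | insert i s hi ih => rw [Finset.sum_insert hi, Finset.prod_insert hi, sgn_add, ih]

theorem phiHga_cls {n : ℕ} (hn : 1 ≤ n) (ha : ∀ i < n, (a i).IsHomogeneous)
    (hb : ∀ i < n, (b i).IsHomogeneous) (x : X _⦋m⦌) :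
    phiHga a b n (cls k x) = (-1) ^ (n - 1) * ∑ js ∈ admLists n,
      ∑ L ∈ cutL (fullWord n js) 0 m,
        sgn k (koszulFrom a b 0 0 js + foldExp a b n 0 0 js + (pe L + po L : ℕ)) *
          foldVal a b n x 0 0 js L := by
  have h : ∀ j ∈ decomps n, phiJ a b j (cls k x) = ∑ L ∈ cutL (fullWord n (List.ofFn j)) 0 m,
        sgn k (koszulFrom a b 0 0 (List.ofFn j) + foldExp a b n 0 0 (List.ofFn j) +
          (pe L + po L : ℕ)) * foldVal a b n x 0 0 (List.ofFn j) L := by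
    intro j hj
    have hjs : List.ofFn j ∈ admLists n := Finset.mem_image_of_mem _ hj
    obtain ⟨h1, h2, _⟩ := mem_admLists.mp hjs
    have hx : cls k x = vcls k x (List.range' 0 (m - 0 + 1)) := by
      rw [← cls_backFace, backFace]
      simp only [zero_add]
      exact (congrArg (cls k) (pull_self x)).symm
    rw [phiJ, LinearMap.smul_apply, foldr_finRange_eq_foldE, koszulExp_eq, hx,
      foldE_vcls a b hn ha hb x _ 0 0 0 (by omega) (by omega) (admFrom_of_mem hjs) (Nat.zero_le m),
      smul_eq_mul, Finset.mul_sum, fullWord]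
    refine Finset.sum_congr rfl fun L _ => ?_
    rw [← mul_assoc, ← sgn_add]
    simp only [Nat.cast_zero, zero_mul, add_zero, ← add_assoc]
  rw [phiHga, LinearMap.smul_apply, LinearMap.sum_apply, smul_eq_mul, Finset.sum_congr rfl h,
    sum_admLists n fun js => ∑ L ∈ cutL (fullWord n js) 0 m,
        sgn k (koszulFrom a b 0 0 js + foldExp a b n 0 0 js + (pe L + po L : ℕ)) *
          foldVal a b n x 0 0 js L]

/-- By the chain-level identity for `X × X`, evaluated on the diagonal simplex, whose two
projections are both `x`. Homogeneity plays no role here, as the signs are formed from the given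
degrees. -/
theorem phiGM_cls {n : ℕ} (hn : 1 ≤ n) (x : X _⦋m⦌) :
    phiGM a b n (cls k x) = (-1) ^ (n - 1) * ∑ js ∈ admLists n,
      ∑ L ∈ cutL (fullWord n js) 0 m,
        sgn k (((n : ℤ) - 1) * (∑ i : Fin n, ((a i.val).deg + (b i.val).deg)) +
          (pairSum (fun i : Fin n => (a i.val).deg + (b i.val).deg) +
            ∑ i : Fin n, (a i.val).deg * (b i.val).deg) + (pe L + po L : ℕ)) *
          foldVal a b n x 0 0 js L := by
  have hg : gm k X X n (cls k ((diagMap X).app _ x)) =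
      psiSum k n x x (fun i => i) (fun i => i) m := by
    rw [gm_cls k X X n hn, LinearMap.comp_apply, map_psiHgc_cls k _ _ hn]
    rfl
  simp only [phiGM, transpose, LinearMap.comp_apply, LinearMap.smul_apply, chainMap_cls, hg,
    dualTensor, psiSum, map_smul, map_sum, smul_eq_mul, Finset.mul_sum, faceTensor, List.map_id',
    PiTensorProduct.dualDistrib_apply, dualTensorTwo, TensorProduct.dualDistrib_apply]
  refine Finset.sum_congr rfl fun js hjs => Finset.sum_congr rfl fun L _ => ?_
  obtain ⟨h1, h2, _⟩ := mem_admLists.mp hjs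
  rw [Finset.prod_mul_distrib, Finset.prod_mul_distrib, ← sgn_sum, sgn_add, sgn_add, sgn_add,
    sgn_natCast, foldVal, h1, h2, Nat.zero_add, Nat.zero_add, ← Finset.range_eq_Ico,
    ← Finset.range_eq_Ico, ← Finset.prod_range_succ, Nat.sub_add_cancel hn, Finset.prod_range,
    Finset.prod_range]
  simp only [valA, valB, pairSum]
  ring

theorem phiGM_eq_phiHga {n : ℕ} (hn : 1 ≤ n) (ha : ∀ i < n, (a i).IsHomogeneous)
    (hb : ∀ i < n, (b i).IsHomogeneous) : phiGM a b n = phiHga a b n := by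
  refine chains_ext k fun m x _ => ?_
  rw [phiGM_cls a b hn, phiHga_cls a b hn ha hb]
  congr 1
  refine Finset.sum_congr rfl fun js hjs => Finset.sum_congr rfl fun L _ => ?_
  congr 1
  obtain ⟨c, hc⟩ := even_foldExp_of_mem a b hn hjs
  exact sgn_congr k ⟨-c, by linear_combination -hc⟩

end Comparison

end ShcCochains

end

open ShcCochains

theorem mainTheorem4 (k : Type v) [CommRing k] (X : SSet.{u}) :
    (∀ n : ℕ, 1 ≤ n → ∀ a b : ℕ → GradedCochain k X,
      (∀ i < n, (a i).IsHomogeneous) → (∀ i < n, (b i).IsHomogeneous) →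
        phiGM a b n = phiHga a b n) ∧
    (∀ (Y : SSet.{u}) (n : ℕ), 1 ≤ n →
      gm k X Y n =
        PiTensorProduct.map
            (fun _ : Fin n => TensorProduct.map (chainMap k (prX X Y)) (chainMap k (prY X Y))) ∘ₗ
          psiHgc k (sprod X Y) n) :=
  ⟨fun _ hn a b ha hb => phiGM_eq_phiHga a b hn ha hb, fun Y n hn => gm_cls k X Y n hn⟩
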